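/- Let $\mathbb F\in\{\mathbb C,\mathbb R\}$. **Deformations.** A matrix representation $A$ of dimension $(n_v)$ of a quiver assigns to each arrow $\alpha:i\to j$ a matrix $A_\alpha\in\mathbb F^{n_j\times n_i}$. A *deformation* of $A$ with parameters $\lambda=(\lambda_1,\dots,\lambda_k)$ is a parametric representation $\mathcal A(\lambda)$ whose entries are power series over $\mathbb F$ convergent near $0$, with $\mathcal A(0)=A$. Deformations $\mathcal A(\lambda),\mathcal B(\lambda)$ of $A$ are *equivalent* if there are square matrices $\mathcal I_v(\lambda)$, one per vertex, whose entries are power series convergent near $0$, with $\mathcal I_v(0)=I$ and $\mathcal B_\alpha(\lambda)=\mathcal I_j(\lambda)\mathcal A_\alpha(\lambda)\mathcal I_i(\lambda)^{-1}$ near $0$ for every arrow $\alpha:i\to j$. $\mathcal A$ is *versal* if every deformation $\mathcal B(\mu)$ of $A$ is equivalent to $\mathcal A(\varphi(\mu))$ for some $\varphi=(\varphi_1,\dots,\varphi_k)$ whose components are power series convergent near $0$ with $\varphi(0)=0$. A versal $\mathcal A$ is *miniversal* if no versal deformation of $A$ has fewer parameters. A miniversal deformation is *simplest* if it is obtained from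 $A$ by adding $\lambda_1,\dots,\lambda_k$ to $k$ distinct entries of $A$, one parameter to each. Square matrices under similarity are the representations of the quiver with one vertex and one loop. Pairs $(A,B)$, $A\in\mathbb F^{m\times n}$, $B\in\mathbb F^{n\times m}$, under contragredient equivalence $(A,B)\mapsto(SAR^{-1},RBS^{-1})$ are the representations of the quiver with two vertices and two opposite arrows between them. **Blocks.** $J_r(\lambda)$ is the upper triangular $r\times r$ Jordan block and $J_r=J_r(0)$. Put $J_r^{\mathbb C}(\lambda)=J_r(\lambda)$ for $\lambda\in\mathbb C$. For $\lambda=a+bi$ with $b\ge0$ put $J_r^{\mathbb R}(\lambda)=J_r(\lambda)$ if $b=0$; if $b>0$ (then $r$ is even) $J_r^{\mathbb R}(\lambda)$ is the $r\times r$ matrix with $2\times2$ blocks $\begin{bmatrix}a&b\\-b&a\end{bmatrix}$ on the diagonal, $I_2$ on the first block superdiagonal and zeros elsewhere. For $r\ge1$, $F_r=\begin{bmatrix}I_{r-1}\\0\end{bmatrix}$ is $r\times(r-1)$ and $G_r=\begin{bmatrix}0&I_{r-1}\end{bmatrix}$ is $(r-1)\times r$. A $p\times q$ block $H$ has independent parameters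 in its first column if $p\le q$, and in its last row if $p>q$; its other entries are $0$. $\mathcal H$ denotes a block matrix all of whose blocks (with respect to the partition given by the direct sums below) are of type $H$. All parameters in all blocks are independent. **The canonical pair.** Let $C=\bigoplus_i\Phi(\lambda_i)$ be nonsingular, with $\Phi(\lambda_i)=\operatorname{diag}(J^{\mathbb F}_{s_{i1}}(\lambda_i),J^{\mathbb F}_{s_{i2}}(\lambda_i),\dots)$, $s_{i1}\ge s_{i2}\ge\cdots\ge1$, where the $\lambda_i\in\mathbb C$ are distinct (and have $\operatorname{Im}\lambda_i\ge0$ if $\mathbb F=\mathbb R$). Let $$(A,B)=(I,C)\oplus\bigoplus_{j=1}^{t_1}(I_{r_{1j}},J_{r_{1j}})\oplus\bigoplus_{j=1}^{t_2}(J_{r_{2j}},I_{r_{2j}})\oplus\bigoplus_{j=1}^{t_3}(F_{r_{3j}},G_{r_{3j}})\oplus\bigoplus_{j=1}^{t_4}(G_{r_{4j}},F_{r_{4j}}),$$ where $r_{l1}\ge r_{l2}\ge\dots\ge r_{lt_l}\ge1$ for $l=1,2,3,4$. **Theorem.** (1) Let $\tilde C$ be any simplest miniversal $\mathbb F$-deformation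 of $C$ under similarity. Then the direct sum of $(I,\tilde C)$ and $$\left(\left[\begin{array}{c|c|c}\bigoplus_jI_{r_{1j}}&0&0\\\hline0&\bigoplus_jJ_{r_{2j}}+\mathcal H&\mathcal H\\\hline0&\mathcal H&\begin{matrix}P_3&\mathcal H\\0&Q_4\end{matrix}\end{array}\right],\left[\begin{array}{c|c|c}\bigoplus_jJ_{r_{1j}}+\mathcal H&\mathcal H&\mathcal H\\\hline\mathcal H&\bigoplus_jI_{r_{2j}}&0\\\hline\mathcal H&0&\begin{matrix}Q_3&0\\\mathcal H&P_4\end{matrix}\end{array}\right]\right)$$ is a simplest miniversal $\mathbb F$-deformation of $(A,B)$ under contragredient equivalence, where for $l=3,4$ $$P_l=\begin{bmatrix}F_{r_{l1}}+H&H&\cdots&H\\&F_{r_{l2}}+H&\ddots&\vdots\\&&\ddots&H\\0&&&F_{r_{lt_l}}+H\end{bmatrix},\qquad Q_l=\begin{bmatrix}G_{r_{l1}}&&&0\\H&G_{r_{l2}}&&\\\vdots&\ddots&\ddots&\\H&\cdots&H&G_{r_{lt_l}}\end{bmatrix}.$$ (2) One can take $\tilde C=\bigoplus_i(\Phi(\lambda_i)+\mathcal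 H_i)$, where $\mathcal H_i$ is of type $\mathcal H$ with respect to the cells of $\Phi(\lambda_i)$: this is a simplest miniversal $\mathbb F$-deformation of $C$ under similarity. -/

import Mathlib

open scoped Topology

/-! ### Quivers, matrix representations, deformations -/

/-- A quiver (directed graph) with vertex set `Vert` and arrow set `Arrow`. -/
structure QuiverData where
  Vert : Type
  Arrow : Type
  src : Arrow → Vert
  tgt : Arrow → Vert

/-- Matrix representations over `𝕜` of dimension `d` of a quiver: a matrix
`A α : d j × d i` for each arrow `α : i → j`.  The dimension at a vertex `v` is given by a
(finite) type `d v` that indexes the rows and columns. -/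
abbrev MatRep (Q : QuiverData) (d : Q.Vert → Type) (𝕜 : Type) : Type :=
  ∀ α : Q.Arrow, Matrix (d (Q.tgt α)) (d (Q.src α)) 𝕜

section Deformations

variable {𝕜 : Type} [RCLike 𝕜] {Q : QuiverData} {d : Q.Vert → Type}
  [∀ v, Fintype (d v)] [∀ v, DecidableEq (d v)]

/-- `𝒜` is a deformation of `A` with parameters `(x c)`, `c : κ`: the entries are convergent
power series near `0` and `𝒜 0 = A`.  (Values of `𝒜` away from `0` are irrelevant.) -/
def IsDeformation {κ : Type} [Fintype κ] (A : MatRep Q d 𝕜)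
    (𝒜 : (κ → 𝕜) → MatRep Q d 𝕜) : Prop :=
  (∀ α i j, AnalyticAt 𝕜 (fun x => 𝒜 x α i j) 0) ∧ 𝒜 0 = A

/-- Equivalence of deformations: `ℬ_α = ℐ_j 𝒜_α ℐ_i⁻¹` near `0` for each arrow `α : i → j`, where
`ℐ` is a deformation of the identity isomorphism. -/
def DeformationEquiv {κ : Type} [Fintype κ] (𝒜 ℬ : (κ → 𝕜) → MatRep Q d 𝕜) : Prop :=
  ∃ ℐ : (κ → 𝕜) → ∀ v : Q.Vert, Matrix (d v) (d v) 𝕜,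
    (∀ v i j, AnalyticAt 𝕜 (fun x => ℐ x v i j) 0) ∧
    (∀ v, ℐ 0 v = 1) ∧
    ∀ᶠ x in 𝓝 (0 : κ → 𝕜), ∀ α,
      ℬ x α = ℐ x (Q.tgt α) * 𝒜 x α * (ℐ x (Q.src α))⁻¹

/-- Versal deformations: every deformation is equivalent to one obtained by an analytic
change of parameters `φ`, `φ 0 = 0`. -/
def IsVersal {κ : Type} [Fintype κ] (A : MatRep Q d 𝕜)
    (𝒜 : (κ → 𝕜) → MatRep Q d 𝕜) : Prop :=
  IsDeformation A 𝒜 ∧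
  ∀ (l : ℕ) (ℬ : (Fin l → 𝕜) → MatRep Q d 𝕜), IsDeformation A ℬ →
    ∃ φ : (Fin l → 𝕜) → κ → 𝕜,
      (∀ c, AnalyticAt 𝕜 (fun μ => φ μ c) 0) ∧ φ 0 = 0 ∧
      DeformationEquiv ℬ (fun μ => 𝒜 (φ μ))

/-- Miniversal deformations: versal, and no versal deformation has fewer parameters. -/
def IsMiniversal {κ : Type} [Fintype κ] (A : MatRep Q d 𝕜)
    (𝒜 : (κ → 𝕜) → MatRep Q d 𝕜) : Prop :=
  IsVersal A 𝒜 ∧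
  ∀ (l : ℕ) (ℬ : (Fin l → 𝕜) → MatRep Q d 𝕜), l < Fintype.card κ → ¬ IsVersal A ℬ

/-- Simplest miniversal deformations: miniversal, and obtained from `A` by adding the
parameters to pairwise distinct entries `pos c` of `A`, one parameter to each. -/
def IsSimplestMiniversal {κ : Type} [Fintype κ] (A : MatRep Q d 𝕜)
    (𝒜 : (κ → 𝕜) → MatRep Q d 𝕜) : Prop :=
  IsMiniversal A 𝒜 ∧
  ∃ pos : κ → (Σ α : Q.Arrow, d (Q.tgt α) × d (Q.src α)), Function.Injective pos ∧
    ∀ x : κ → 𝕜,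
      (∀ c, 𝒜 x (pos c).1 (pos c).2.1 (pos c).2.2 = A (pos c).1 (pos c).2.1 (pos c).2.2 + x c) ∧
      ∀ p, p ∉ Set.range pos → 𝒜 x p.1 p.2.1 p.2.2 = A p.1 p.2.1 p.2.2

end Deformations

/-! ### The two quivers: one loop (similarity), two opposite arrows (contragredient equivalence) -/

/-- One vertex and one loop.  Its representations are square matrices, up to similarity. -/
def loopQuiver : QuiverData where
  Vert := Unit
  Arrow := Unit
  src := id
  tgt := id

/-- A square matrix as a representation of the loop quiver. -/
def loopRep {n 𝕜 : Type} (C : Matrix n n 𝕜) : MatRep loopQuiver (fun _ => n) 𝕜 :=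
  fun _ => C

/-- Two vertices `U = false` and `V = true`, and two arrows `A = false : U → V`,
`B = true : V → U`. -/
def contraQuiver : QuiverData where
  Vert := Bool
  Arrow := Bool
  src := id
  tgt := not

/-- The dimension `n` at the vertex `U` and `m` at the vertex `V`. -/
def contraDim (m n : Type) : contraQuiver.Vert → Type
  | false => n
  | true => m

instance {m n : Type} [Fintype m] [Fintype n] : ∀ v, Fintype (contraDim m n v)
  | false => inferInstanceAs (Fintype n)
  | true => inferInstanceAs (Fintype m)

instance {m n : Type} [DecidableEq m] [DecidableEq n] : ∀ v, DecidableEq (contraDim m n v)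
  | false => inferInstanceAs (DecidableEq n)
  | true => inferInstanceAs (DecidableEq m)

/-- A pair `A : U → V`, `B : V → U` of counter mappings as a representation; isomorphisms are
the transformations `(S A R⁻¹, R B S⁻¹)`. -/
def contraRep {m n 𝕜 : Type} (A : Matrix m n 𝕜) (B : Matrix n m 𝕜) :
    MatRep contraQuiver (contraDim m n) 𝕜
  | false => A
  | true => B

/-! ### The elementary blocks -/

/-- The upper triangular Jordan block `J_r(a)`. -/
def jordanBlock {𝕜 : Type} [RCLike 𝕜] (r : ℕ) (a : 𝕜) : Matrix (Fin r) (Fin r) 𝕜 :=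
  Matrix.of fun i j => if i = j then a else if j.val = i.val + 1 then 1 else 0

/-- The matrix `T_{ab} = [a b; -b a]`. -/
def rotBlock {𝕜 : Type} [RCLike 𝕜] (a b : ℝ) : Matrix (Fin 2) (Fin 2) 𝕜 :=
  !![(a : 𝕜), (b : 𝕜); -(b : 𝕜), (a : 𝕜)]

/-- The `r × r` real Jordan block (`r` even) with blocks `T_{ab}` on the diagonal and `I_2` on
the first block superdiagonal. -/
def realJordanBlock {𝕜 : Type} [RCLike 𝕜] (r : ℕ) (a b : ℝ) : Matrix (Fin r) (Fin r) 𝕜 :=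
  Matrix.of fun i j =>
    if i.val / 2 = j.val / 2 then rotBlock a b (Fin.ofNat 2 i.val) (Fin.ofNat 2 j.val)
    else if j.val = i.val + 2 then 1 else 0

open Classical in
/-- The cell `J_r^𝕜(z)`.  For `RCLike` fields, `RCLike.I = 0` means `𝕜 = ℝ`; in that case a
non-real `z = a + b i` gives the real Jordan block with `T_{ab}`; in the other cases (`𝕜 = ℂ`,
or `z` real) the cell is `J_r(z)`. -/
noncomputable def jordanCell (𝕜 : Type) [RCLike 𝕜] (r : ℕ) (z : ℂ) :
    Matrix (Fin r) (Fin r) 𝕜 :=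
  if (RCLike.I : 𝕜) = 0 ∧ z.im ≠ 0 then realJordanBlock r z.re z.im
  else jordanBlock r ((z.re : 𝕜) + (z.im : 𝕜) * RCLike.I)

/-- The `r × (r-1)` matrix `F_r`: the identity with a zero row below. -/
def Fblock {𝕜 : Type} [RCLike 𝕜] (r : ℕ) : Matrix (Fin r) (Fin (r - 1)) 𝕜 :=
  Matrix.of fun i j => if i.val = j.val then 1 else 0

/-- The `(r-1) × r` matrix `G_r`: the identity with a zero column on the left. -/
def Gblock {𝕜 : Type} [RCLike 𝕜] (r : ℕ) : Matrix (Fin (r - 1)) (Fin r) 𝕜 :=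
  Matrix.of fun i j => if j.val = i.val + 1 then 1 else 0

/-! ### Stars -/

/-- The places of the stars in a `p × q` block `H`: the first column if `p ≤ q`, the last row
if `p > q`. -/
def IsStarH (p q : ℕ) (i : Fin p) (j : Fin q) : Prop :=
  (p ≤ q ∧ j.val = 0) ∨ (q < p ∧ i.val + 1 = p)

/-- The places of the stars in a block matrix whose `(k, l)` block has size `p k × q l`, where
the `(k, l)` block is of type `H` if `has k l` and has no stars otherwise. -/
def starPlaces {K L : Type} (p : K → ℕ) (q : L → ℕ) (has : K → L → Prop)
    (i : Σ k, Fin (p k)) (j : Σ l, Fin (q l)) : Prop :=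
  has i.1 j.1 ∧ IsStarH (p i.1) (q j.1) i.2 j.2

/-- The index set of the independent parameters written as stars on the places `P`. -/
def Stars {m n : Type} (P : m → n → Prop) : Type := {e : m × n // P e.1 e.2}

noncomputable instance {m n : Type} [Fintype m] [Fintype n] (P : m → n → Prop) :
    Fintype (Stars P) := by
  classical
  exact inferInstanceAs (Fintype {e : m × n // P e.1 e.2})

open Classical in
/-- The parametric matrix with independent parameters on the places `P`, zeros elsewhere. -/
noncomputable def starMatrix {m n 𝕜 : Type} [RCLike 𝕜] (P : m → n → Prop)
    (x : Stars P → 𝕜) : Matrix m n 𝕜 :=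
  Matrix.of fun i j => if h : P i j then x ⟨(i, j), h⟩ else 0

/-! ### The matrix `C = ⊕ᵢ Φ(zᵢ)` and its deformation `⊕ᵢ (Φ(zᵢ) + ℋᵢ)` -/

/-- The index set of `⊕ᵢ Φ(zᵢ)`, where `Φ(zᵢ)` has the `T i` cells of sizes
`s i 0, s i 1, …`. -/
abbrev CIdx {g : ℕ} (T : Fin g → ℕ) (s : ∀ i, Fin (T i) → ℕ) : Type :=
  Σ k : (Σ i, Fin (T i)), Fin (s k.1 k.2)

/-- `⊕ᵢ Φ(zᵢ)`, `Φ(zᵢ) = diag(J(zᵢ), J(zᵢ), …)` with cells of sizes `s i 0, s i 1, …`. -/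
noncomputable def canonicalC (𝕜 : Type) [RCLike 𝕜] {g : ℕ} (z : Fin g → ℂ) (T : Fin g → ℕ)
    (s : ∀ i, Fin (T i) → ℕ) : Matrix (CIdx T s) (CIdx T s) 𝕜 :=
  Matrix.blockDiagonal' fun k : (Σ i, Fin (T i)) => jordanCell 𝕜 (s k.1 k.2) (z k.1)

/-- The stars of `⊕ᵢ ℋᵢ`: in the blocks whose two cells belong to the same `zᵢ`. -/
def starsC {g : ℕ} (T : Fin g → ℕ) (s : ∀ i, Fin (T i) → ℕ) :
    CIdx T s → CIdx T s → Prop :=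
  starPlaces (fun k : (Σ i, Fin (T i)) => s k.1 k.2) (fun k : (Σ i, Fin (T i)) => s k.1 k.2)
    (fun k l => k.1 = l.1)

/-! ### The nilpotent part of the canonical pair and its deformation -/

/-- The cells of the nilpotent part, of four kinds: `c1 j = (I, J)`, `c2 j = (J, I)`,
`c3 j = (F, G)`, `c4 j = (G, F)`, with `t1, …, t4` cells of each kind. -/
inductive Cell (t1 t2 t3 t4 : ℕ) : Type
  | c1 (j : Fin t1)
  | c2 (j : Fin t2)
  | c3 (j : Fin t3)
  | c4 (j : Fin t4)
  deriving DecidableEq, Fintype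

section Nilpotent

variable {t1 t2 t3 t4 : ℕ}
  (r1 : Fin t1 → ℕ) (r2 : Fin t2 → ℕ) (r3 : Fin t3 → ℕ) (r4 : Fin t4 → ℕ)

/-- Number of rows of the first matrix of a cell (= number of columns of the second). -/
def cellV : Cell t1 t2 t3 t4 → ℕ
  | .c1 j => r1 j
  | .c2 j => r2 j
  | .c3 j => r3 j
  | .c4 j => r4 j - 1

/-- Number of columns of the first matrix of a cell (= number of rows of the second). -/
def cellU : Cell t1 t2 t3 t4 → ℕ
  | .c1 j => r1 j
  | .c2 j => r2 j
  | .c3 j => r3 j - 1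
  | .c4 j => r4 j

/-- The first matrix of a cell. -/
def cellA (𝕜 : Type) [RCLike 𝕜] : ∀ k : Cell t1 t2 t3 t4,
    Matrix (Fin (cellV r1 r2 r3 r4 k)) (Fin (cellU r1 r2 r3 r4 k)) 𝕜
  | .c1 j => (1 : Matrix (Fin (r1 j)) (Fin (r1 j)) 𝕜)
  | .c2 j => jordanBlock (r2 j) 0
  | .c3 j => Fblock (r3 j)
  | .c4 j => Gblock (r4 j)

/-- The second matrix of a cell. -/
def cellB (𝕜 : Type) [RCLike 𝕜] : ∀ k : Cell t1 t2 t3 t4,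
    Matrix (Fin (cellU r1 r2 r3 r4 k)) (Fin (cellV r1 r2 r3 r4 k)) 𝕜
  | .c1 j => jordanBlock (r1 j) 0
  | .c2 j => (1 : Matrix (Fin (r2 j)) (Fin (r2 j)) 𝕜)
  | .c3 j => Gblock (r3 j)
  | .c4 j => Fblock (r4 j)

/-- Row index set of the first matrix of the nilpotent part. -/
abbrev VIdx : Type := Σ k : Cell t1 t2 t3 t4, Fin (cellV r1 r2 r3 r4 k)

/-- Column index set of the first matrix of the nilpotent part. -/
abbrev UIdx : Type := Σ k : Cell t1 t2 t3 t4, Fin (cellU r1 r2 r3 r4 k)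

/-- The first matrix of the nilpotent part: the direct sum of the first matrices of the cells. -/
def nilA (𝕜 : Type) [RCLike 𝕜] : Matrix (VIdx r1 r2 r3 r4) (UIdx r1 r2 r3 r4) 𝕜 :=
  Matrix.blockDiagonal' (cellA r1 r2 r3 r4 𝕜)

/-- The second matrix of the nilpotent part. -/
def nilB (𝕜 : Type) [RCLike 𝕜] : Matrix (UIdx r1 r2 r3 r4) (VIdx r1 r2 r3 r4) 𝕜 :=
  Matrix.blockDiagonal' (cellB r1 r2 r3 r4 𝕜)

/-- The blocks of the first matrix that contain a block `H` of parameters: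
all blocks in `(2,2)`, `(2,3)`, `(2,4)`, `(3,2)`, `(4,2)`, `(3,4)`; the blocks of `(3,3)` on and
above the diagonal (that is `P₃`); the blocks of `(4,4)` below the diagonal (that is `Q₄`). -/
def hasHA : Cell t1 t2 t3 t4 → Cell t1 t2 t3 t4 → Prop
  | .c2 _, .c2 _ => True
  | .c2 _, .c3 _ => True
  | .c2 _, .c4 _ => True
  | .c3 _, .c2 _ => True
  | .c4 _, .c2 _ => True
  | .c3 i, .c3 j => i ≤ j
  | .c3 _, .c4 _ => True
  | .c4 i, .c4 j => j < i
  | _, _ => False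

/-- The blocks of the second matrix that contain a block `H` of parameters:
all blocks in `(1,1)`, `(1,2)`, `(1,3)`, `(1,4)`, `(2,1)`, `(3,1)`, `(4,1)`, `(4,3)`; the blocks of
`(3,3)` below the diagonal (that is `Q₃`); the blocks of `(4,4)` on and above the diagonal
(that is `P₄`). -/
def hasHB : Cell t1 t2 t3 t4 → Cell t1 t2 t3 t4 → Prop
  | .c1 _, .c1 _ => True
  | .c1 _, .c2 _ => True
  | .c1 _, .c3 _ => True
  | .c1 _, .c4 _ => True
  | .c2 _, .c1 _ => True
  | .c3 _, .c1 _ => True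
  | .c4 _, .c1 _ => True
  | .c3 i, .c3 j => j < i
  | .c4 _, .c3 _ => True
  | .c4 i, .c4 j => i ≤ j
  | _, _ => False

/-- The places of the parameters in the first matrix of the nilpotent part. -/
def starsA : VIdx r1 r2 r3 r4 → UIdx r1 r2 r3 r4 → Prop :=
  starPlaces (cellV r1 r2 r3 r4) (cellU r1 r2 r3 r4) hasHA

/-- The places of the parameters in the second matrix of the nilpotent part. -/
def starsB : UIdx r1 r2 r3 r4 → VIdx r1 r2 r3 r4 → Prop :=
  starPlaces (cellU r1 r2 r3 r4) (cellV r1 r2 r3 r4) hasHB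

end Nilpotent

/-- The direct sum `(I, C) ⊕ (A, B)` of pairs. -/
def directSumIC {N m n 𝕜 : Type} [RCLike 𝕜] [DecidableEq N] (C : Matrix N N 𝕜)
    (A : Matrix m n 𝕜) (B : Matrix n m 𝕜) :
    MatRep contraQuiver (contraDim (N ⊕ m) (N ⊕ n)) 𝕜 :=
  contraRep (Matrix.fromBlocks 1 0 0 A) (Matrix.fromBlocks C 0 0 B)

/-! ### Analyticity of matrix products, determinants and inverses. -/

section AnalyticMatrices

variable {𝕜 E : Type} [RCLike 𝕜] [NormedAddCommGroup E] [NormedSpace 𝕜 E]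

/-! Versality is an infinitesimal condition. The tangent space at `A` to its orbit under base change
is the range of `infinitesimalAction A`. Differentiating an equivalence between the line `A + tE`
and a reparametrized versal family shows that a versal deformation is transversal to this space
(`IsVersal.exists_tangent`). Conversely, transversality makes `(X, x) ↦ (1+X)⁻¹ 𝒜(x) (1+X)` a
submersion at `0`, and every deformation lifts analytically through it
(`isVersal_of_exists_tangent`). Hence the least number of parameters is at least the codimension of
the tangent space, and independent parameters put on a set of places give a simplest miniversal
deformation as soon as the representations supported on these places form a complement of the
tangent space (`IsComplement`). Once one set of places is known to be a complement, counting
dimensions shows that the places of any simplest miniversal deformation form one too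
(`IsSimplestMiniversal.exists_isComplement`); an arbitrary deformation of `C` is handled through
this.

What remains is linear algebra, block by block. For two cells `M`, `N` of `C` with distinct
eigenvalues, coprime annihilating polynomials make `XN - MX = E` uniquely solvable, so no parameter
is needed. For equal eigenvalues and sizes `p ≤ q`, a power of `cellPoly` has degree `q` and
annihilates both cells. As the larger cell has a cyclic vector and a cyclic covector, a commutator
supported in the first column vanishes, and the equation is solvable off that column
(`intertwining_of_supported_column`, `exists_sylvester_modulo_column`). Reflection in the
antidiagonal gives the last row when `p > q`. Real and complex cells are treated together.

In the nilpotent part, the basis vectors of each cell form one chain alternating between the two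
spaces, and `[0 A; B 0]` acts on it as one nilpotent Jordan block (`fromBlocks_nilA_nilB`).
Contragredient equivalence thus becomes similarity graded by parity. Commutators identify
neighbouring matrix units on a diagonal, so the only obstruction is the sum along each diagonal from
the first column to the last row. The stars meet every such diagonal of odd parity exactly once
(`starNode_obstructed`, `starNode_unique`, `exists_starNode`).

Finally, `(I, C)` does not interact with the nilpotent part: after eliminating one unknown, the
mixed blocks are Sylvester equations between the nonsingular `C` and the nilpotent `AB` or `BA`
(`isComplement_directSumIC`). -/

theorem analyticAt_matrix_mul {l m n : Type} [Fintype m] {f : E → Matrix l m 𝕜}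
    {g : E → Matrix m n 𝕜} {x : E} (hf : ∀ i j, AnalyticAt 𝕜 (fun y => f y i j) x)
    (hg : ∀ i j, AnalyticAt 𝕜 (fun y => g y i j) x) (i : l) (j : n) :
    AnalyticAt 𝕜 (fun y => (f y * g y) i j) x := by
  simp only [Matrix.mul_apply]
  exact Finset.analyticAt_fun_sum _ fun k _ => (hf i k).fun_mul (hg k j)

theorem analyticAt_matrix_det {n : Type} [Fintype n] [DecidableEq n] {f : E → Matrix n n 𝕜}
    {x : E} (hf : ∀ i j, AnalyticAt 𝕜 (fun y => f y i j) x) :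
    AnalyticAt 𝕜 (fun y => (f y).det) x := by
  simp only [Matrix.det_apply']
  exact Finset.analyticAt_fun_sum _ fun σ _ =>
    analyticAt_const.fun_mul (Finset.analyticAt_fun_prod _ fun k _ => hf _ _)

theorem analyticAt_matrix_inv {n : Type} [Fintype n] [DecidableEq n] {f : E → Matrix n n 𝕜}
    {x : E} (hf : ∀ i j, AnalyticAt 𝕜 (fun y => f y i j) x) (hx : (f x).det ≠ 0) (i j : n) :
    AnalyticAt 𝕜 (fun y => (f y)⁻¹ i j) x := by
  simp only [Matrix.inv_def, Ring.inverse_eq_inv', Matrix.smul_apply, Matrix.adjugate_apply,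
    smul_eq_mul]
  refine ((analyticAt_matrix_det hf).fun_inv hx).fun_mul (analyticAt_matrix_det fun k l => ?_)
  by_cases hk : k = j
  · subst hk
    simpa only [Matrix.updateRow_self] using analyticAt_const
  · simpa only [Matrix.updateRow_ne hk] using hf k l

end AnalyticMatrices

/-! ### Versality is transversality to the orbit. -/

section Transversality

variable {𝕜 : Type} [RCLike 𝕜] {Q : QuiverData} {d : Q.Vert → Type}
  [∀ v, Fintype (d v)]

/-- The infinitesimal action `X ↦ X A - A X` of the base change algebra at `A`. -/
def infinitesimalAction (A : MatRep Q d 𝕜) :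
    (∀ v, Matrix (d v) (d v) 𝕜) →ₗ[𝕜] MatRep Q d 𝕜 where
  toFun X := fun α => X (Q.tgt α) * A α - A α * X (Q.src α)
  map_add' X Y := by
    funext α
    simp only [Pi.add_apply, Matrix.add_mul, Matrix.mul_add]
    abel
  map_smul' c X := by
    funext α
    simp [smul_sub]

theorem infinitesimalAction_apply (A : MatRep Q d 𝕜) (X : ∀ v, Matrix (d v) (d v) 𝕜)
    (α : Q.Arrow) :
    infinitesimalAction A X α = X (Q.tgt α) * A α - A α * X (Q.src α) := rfl

variable [∀ v, DecidableEq (d v)]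

/-- First order consequence of a conjugation relation along a curve. -/
theorem tangent_relation {J : 𝕜 → ∀ v, Matrix (d v) (d v) 𝕜} {a b : 𝕜 → MatRep Q d 𝕜}
    {J' : ∀ v, Matrix (d v) (d v) 𝕜} {a' b' : MatRep Q d 𝕜}
    (hJ : ∀ v i j, HasDerivAt (fun t => J t v i j) (J' v i j) 0)
    (ha : ∀ α i j, HasDerivAt (fun t => a t α i j) (a' α i j) 0)
    (hb : ∀ α i j, HasDerivAt (fun t => b t α i j) (b' α i j) 0)
    (hJ0 : ∀ v, J 0 v = 1)
    (h : ∀ᶠ t in 𝓝 (0 : 𝕜), ∀ α, J t (Q.tgt α) * b t α = a t α * J t (Q.src α)) (α : Q.Arrow) :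
    J' (Q.tgt α) * b 0 α + b' α = a' α + a 0 α * J' (Q.src α) := by
  ext i j
  have h1 : HasDerivAt (fun t => (J t (Q.tgt α) * b t α) i j)
      ((J' (Q.tgt α) * b 0 α + J 0 (Q.tgt α) * b' α) i j) 0 := by
    simp only [Matrix.mul_apply, Matrix.add_apply, ← Finset.sum_add_distrib]
    exact HasDerivAt.fun_sum fun k _ => (hJ _ i k).mul (hb α k j)
  have h2 : HasDerivAt (fun t => (a t α * J t (Q.src α)) i j)
      ((a' α * J 0 (Q.src α) + a 0 α * J' (Q.src α)) i j) 0 := by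
    simp only [Matrix.mul_apply, Matrix.add_apply, ← Finset.sum_add_distrib]
    exact HasDerivAt.fun_sum fun k _ => (ha α i k).mul (hJ _ k j)
  have h3 := h1.unique (h2.congr_of_eventuallyEq (h.mono fun t ht => congrFun (congrFun (ht α) i) j))
  simpa [hJ0] using h3

theorem eventually_isUnit_det [Finite Q.Vert] {E : Type} [TopologicalSpace E]
    {J : E → ∀ v, Matrix (d v) (d v) 𝕜} {x : E}
    (hJ : ∀ v i j, ContinuousAt (fun y => J y v i j) x) (hJ0 : ∀ v, J x v = 1) :
    ∀ᶠ y in 𝓝 x, ∀ v, IsUnit (J y v).det := by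
  rw [Filter.eventually_all]
  intro v
  have hc : ContinuousAt (fun y => (J y v).det) x := by
    have : ContinuousAt (fun y => J y v) x :=
      continuousAt_pi.2 fun i => continuousAt_pi.2 fun j => hJ v i j
    exact ContinuousAt.comp (g := Matrix.det) (Continuous.matrix_det continuous_id).continuousAt
      this
  have : (J x v).det ≠ 0 := by simp [hJ0]
  exact (hc.eventually_ne this).mono fun y hy => hy.isUnit

/-- A versal deformation is transversal to the orbit. -/
theorem IsVersal.exists_tangent [Finite Q.Vert] {κ : Type} [Fintype κ] {A : MatRep Q d 𝕜}
    {𝒜 : (κ → 𝕜) → MatRep Q d 𝕜} (h : IsVersal A 𝒜) (E : MatRep Q d 𝕜) :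
    ∃ (X : ∀ v, Matrix (d v) (d v) 𝕜) (y : κ → 𝕜), ∀ α i j,
      E α i j = infinitesimalAction A X α i j + fderiv 𝕜 (fun x => 𝒜 x α i j) 0 y := by
  obtain ⟨⟨han, h0⟩, hv⟩ := h
  have hproj : ∀ x : Fin 1 → 𝕜, AnalyticAt 𝕜 (fun x : Fin 1 → 𝕜 => x 0) x := fun x =>
    (ContinuousLinearMap.proj (R := 𝕜) (φ := fun _ : Fin 1 => 𝕜) 0).analyticAt x
  -- Versality is tested on the line through `A` in the direction `E`, whose velocity is `E` itself.
  obtain ⟨φ, hφ, hφ0, ℐ, hI, hI0, hev⟩ := hv 1 (fun μ α => A α + μ 0 • E α)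
    ⟨fun α i j => by
      simp only [Matrix.add_apply, Matrix.smul_apply, smul_eq_mul]
      exact analyticAt_const.fun_add ((hproj 0).fun_mul analyticAt_const), by
      funext α
      simp⟩
  let c : 𝕜 → Fin 1 → 𝕜 := fun t _ => t
  have hc0 : c 0 = 0 := rfl
  have hc : AnalyticAt 𝕜 c 0 := AnalyticAt.pi fun _ => analyticAt_id
  have hct : Filter.Tendsto c (𝓝 0) (𝓝 0) := hc.continuousAt
  have hJ : ∀ v i j, HasDerivAt (fun t => ℐ (c t) v i j)
      (deriv (fun t => ℐ (c t) v i j) 0) 0 := fun v i j =>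
    ((hI v i j).comp (f := c) (x := 0) hc).differentiableAt.hasDerivAt
  have hφc : HasDerivAt (fun t => φ (c t)) (deriv (fun t => φ (c t)) 0) 0 :=
    ((AnalyticAt.pi hφ).comp (f := c) (x := 0) hc).differentiableAt.hasDerivAt
  have ha : ∀ α i j, HasDerivAt (fun t => 𝒜 (φ (c t)) α i j)
      (fderiv 𝕜 (fun x => 𝒜 x α i j) 0 (deriv (fun t => φ (c t)) 0)) 0 := fun α i j => by
    have h1 : HasFDerivAt (fun x => 𝒜 x α i j) (fderiv 𝕜 (fun x => 𝒜 x α i j) 0) (φ (c 0)) := by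
      rw [hc0, hφ0]
      exact (han α i j).differentiableAt.hasFDerivAt
    exact h1.comp_hasDerivAt (0 : 𝕜) hφc
  have hb : ∀ α i j, HasDerivAt (fun t => (A α + c t 0 • E α) i j) (E α i j) 0 := fun α i j => by
    simp only [Matrix.add_apply, Matrix.smul_apply, smul_eq_mul]
    simpa using ((hasDerivAt_id (0 : 𝕜)).mul_const (E α i j)).const_add (A α i j)
  have hunit := eventually_isUnit_det (fun v i j => (hI v i j).continuousAt) hI0
  have hrel := tangent_relation (a := fun t => 𝒜 (φ (c t))) (b := fun t α => A α + c t 0 • E α)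
    (J := fun t => ℐ (c t)) (J' := fun v => Matrix.of fun i j => deriv (fun t => ℐ (c t) v i j) 0)
    (a' := fun α => Matrix.of fun i j =>
      fderiv 𝕜 (fun x => 𝒜 x α i j) 0 (deriv (fun t => φ (c t)) 0)) (b' := E)
    hJ ha hb hI0 (by
      filter_upwards [hct.eventually hev, hct.eventually hunit] with t ht hu α
      rw [ht α, Matrix.nonsing_inv_mul_cancel_right _ _ (hu _)])
  -- The sign is negative because `ℐ` carries the line into the versal family, so its derivative
  -- appears on the side of `E`.
  refine ⟨fun v => -Matrix.of fun i j => deriv (fun t => ℐ (c t) v i j) 0,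
    deriv (fun t => φ (c t)) 0, fun α i j => ?_⟩
  have h1 := congrFun (congrFun (hrel α) i) j
  simp only [hc0, hφ0, h0, Matrix.add_apply, Matrix.of_apply, Pi.zero_apply, zero_smul,
    add_zero] at h1
  rw [infinitesimalAction_apply, Matrix.neg_mul, Matrix.mul_neg, Matrix.sub_apply,
    Matrix.neg_apply, Matrix.neg_apply]
  linear_combination h1

/-- A deformation transversal to the orbit is versal. -/
theorem isVersal_of_exists_tangent [Fintype Q.Vert] [Fintype Q.Arrow] {κ : Type} [Fintype κ]
    {A : MatRep Q d 𝕜} {𝒜 : (κ → 𝕜) → MatRep Q d 𝕜} (hdef : IsDeformation A 𝒜)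
    (h : ∀ E : MatRep Q d 𝕜, ∃ (X : ∀ v, Matrix (d v) (d v) 𝕜) (y : κ → 𝕜), ∀ α i j,
      E α i j = infinitesimalAction A X α i j + fderiv 𝕜 (fun x => 𝒜 x α i j) 0 y) :
    IsVersal A 𝒜 := by
  refine ⟨hdef, fun l ℬ hℬ => ?_⟩
  obtain ⟨han, h0⟩ := hdef
  let G := ∀ v : Q.Vert, d v → d v → 𝕜
  let P := ∀ α : Q.Arrow, d (Q.tgt α) → d (Q.src α) → 𝕜
  let J : G → ∀ v, Matrix (d v) (d v) 𝕜 := fun X v => 1 + Matrix.of (X v)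
  -- A lift of a deformation `ℬ` through `Ψ` is precisely a base change together with a change of
  -- parameters.
  let Ψ : G × (κ → 𝕜) → P := fun u α i j =>
    ((J u.1 (Q.tgt α))⁻¹ * 𝒜 u.2 α * J u.1 (Q.src α)) i j
  have hJ0 : ∀ v, J 0 v = 1 := fun v => by
    ext i j
    exact add_zero _
  have hJan : ∀ v i j, AnalyticAt 𝕜 (fun u : G × (κ → 𝕜) => J u.1 v i j) 0 := fun v i j => by
    have h1 : AnalyticAt 𝕜 (fun u : G × (κ → 𝕜) => u.1 v i j) 0 :=
      (((ContinuousLinearMap.proj (R := 𝕜) (φ := fun _ => 𝕜) j).comp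
        ((ContinuousLinearMap.proj (R := 𝕜) (φ := fun _ => d v → 𝕜) i).comp
          ((ContinuousLinearMap.proj (R := 𝕜) (φ := fun v => d v → d v → 𝕜) v).comp
            (ContinuousLinearMap.fst 𝕜 G (κ → 𝕜))))).analyticAt 0)
    simp only [J, Matrix.add_apply, Matrix.of_apply]
    exact analyticAt_const.fun_add h1
  have hΨ : AnalyticAt 𝕜 Ψ 0 := by
    refine AnalyticAt.pi fun α => AnalyticAt.pi fun i => AnalyticAt.pi fun j => ?_
    refine analyticAt_matrix_mul (fun i j => analyticAt_matrix_mul (fun i j =>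
      analyticAt_matrix_inv (hJan _) ?_ i j) (fun i j => ?_) i j) (hJan _) i j
    · change (J 0 _).det ≠ 0
      simp [hJ0]
    · exact AnalyticAt.comp (g := fun x => 𝒜 x α i j) (f := fun u : G × (κ → 𝕜) => u.2)
        (han α i j) analyticAt_snd
  have hΨ0 : Ψ 0 = fun α i j => A α i j := by
    funext α i j
    change ((J 0 (Q.tgt α))⁻¹ * 𝒜 0 α * J 0 (Q.src α)) i j = _
    simp [hJ0, h0]
  have hunit : ∀ᶠ u : G × (κ → 𝕜) in 𝓝 0, ∀ v, IsUnit (J u.1 v).det :=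
    eventually_isUnit_det (fun v i j => (hJan v i j).continuousAt) hJ0
  -- The derivative is read off along lines from the relation `J * Ψ = 𝒜 * J`, which avoids
  -- differentiating the inverse.
  have hder : ∀ (Y : G) (y : κ → 𝕜) α i j, fderiv 𝕜 Ψ 0 (Y, y) α i j =
      fderiv 𝕜 (fun x => 𝒜 x α i j) 0 y - infinitesimalAction A Y α i j := by
    intro Y y α i j
    let c : 𝕜 → G × (κ → 𝕜) := fun t => t • (Y, y)
    have hc0 : c 0 = 0 := zero_smul _ _
    have hc : HasDerivAt c (Y, y) 0 := by
      have h1 := (hasDerivAt_id (0 : 𝕜)).smul_const (Y, y)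
      rw [one_smul] at h1
      exact h1
    have hct : Filter.Tendsto c (𝓝 0) (𝓝 0) := by
      simpa [ContinuousAt, hc0] using hc.continuousAt
    have hΨd : HasFDerivAt Ψ (fderiv 𝕜 Ψ 0) (c 0) := by
      rw [hc0]
      exact hΨ.differentiableAt.hasFDerivAt
    have hΨc := hΨd.comp_hasDerivAt (0 : 𝕜) hc
    have hy : HasDerivAt (fun t : 𝕜 => (c t).2) y 0 := by
      simpa [c] using (hasDerivAt_id (0 : 𝕜)).smul_const y
    have hrel := tangent_relation (Q := Q) (d := d) (a := fun t => 𝒜 (c t).2)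
      (b := fun t α => Matrix.of (Ψ (c t) α))
      (J := fun t => J (c t).1) (J' := fun v => Matrix.of (Y v))
      (a' := fun α => Matrix.of fun i j => fderiv 𝕜 (fun x => 𝒜 x α i j) 0 y)
      (b' := fun α => Matrix.of (fderiv 𝕜 Ψ 0 (Y, y) α))
      (fun v i j => by
        change HasDerivAt (fun t : 𝕜 => (1 : Matrix (d v) (d v) 𝕜) i j + t * Y v i j) (Y v i j) 0
        simpa using ((hasDerivAt_id (0 : 𝕜)).mul_const (Y v i j)).const_add
          ((1 : Matrix (d v) (d v) 𝕜) i j))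
      (fun α i j => by
        have h1 : HasFDerivAt (fun x => 𝒜 x α i j) (fderiv 𝕜 (fun x => 𝒜 x α i j) 0)
            (c 0).2 := by
          rw [hc0]
          exact (han α i j).differentiableAt.hasFDerivAt
        exact h1.comp_hasDerivAt (0 : 𝕜) hy)
      (fun α i j => by
        have h1 := hasDerivAt_pi.1 (hasDerivAt_pi.1 (hasDerivAt_pi.1 hΨc α) i) j
        exact h1)
      (fun v => by
        rw [hc0]
        exact hJ0 v)
      (by
        filter_upwards [hct.eventually hunit] with t hu α
        change J (c t).1 _ * ((J (c t).1 (Q.tgt α))⁻¹ * 𝒜 (c t).2 α * J (c t).1 (Q.src α)) = _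
        rw [Matrix.mul_assoc (J (c t).1 (Q.tgt α))⁻¹,
          Matrix.mul_nonsing_inv_cancel_left _ _ (hu _)]) α
    have h1 := congrFun (congrFun hrel i) j
    simp only [hc0, hΨ0, Prod.snd_zero, h0] at h1
    rw [Matrix.add_apply, Matrix.add_apply] at h1
    change (Matrix.of (Y (Q.tgt α)) * A α) i j + fderiv 𝕜 Ψ 0 (Y, y) α i j =
      fderiv 𝕜 (fun x => 𝒜 x α i j) 0 y + (A α * Matrix.of (Y (Q.src α))) i j at h1
    change _ = _ - ((Matrix.of (Y (Q.tgt α)) * A α) i j - (A α * Matrix.of (Y (Q.src α))) i j)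
    linear_combination h1
  have hsurj : Function.Surjective (fderiv 𝕜 Ψ 0).toLinearMap := by
    intro E
    obtain ⟨X, y, hXy⟩ := h (fun α => Matrix.of (E α))
    refine ⟨(fun v => -X v, y), ?_⟩
    funext α i j
    refine (hder _ _ α i j).trans ?_
    have h1 := hXy α i j
    have h2 : infinitesimalAction A (fun v => -X v) = - infinitesimalAction A X :=
      map_neg (infinitesimalAction A) X
    rw [show infinitesimalAction A (fun v i j => (-X v) i j) = infinitesimalAction A
      (fun v => -X v) from rfl, h2]
    change _ - -(infinitesimalAction A X α i j) = _
    rw [Matrix.of_apply] at h1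
    linear_combination -h1
  -- Composing with a linear right inverse of the derivative gives a map `Θ` with derivative the
  -- identity. The ordinary inverse function theorem then provides an analytic local section `L' ∘
  -- Θ⁻¹` of `Ψ`.
  obtain ⟨L, hL⟩ := (fderiv 𝕜 Ψ 0).toLinearMap.exists_rightInverse_of_surjective
    (LinearMap.range_eq_top.2 hsurj)
  let L' : P →L[𝕜] G × (κ → 𝕜) := L.toContinuousLinearMap
  let Θ : P → P := fun E => Ψ (L' E)
  have hL0 : L' 0 = 0 := map_zero _
  have hΘan : AnalyticAt 𝕜 Θ 0 := by
    refine AnalyticAt.comp (g := Ψ) (f := L') ?_ (L'.analyticAt 0)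
    rw [hL0]
    exact hΨ
  have hΘd : HasFDerivAt Θ (ContinuousLinearEquiv.refl 𝕜 P : P →L[𝕜] P) 0 := by
    have h1 : HasFDerivAt Ψ (fderiv 𝕜 Ψ 0) (L' 0) := by
      rw [hL0]
      exact hΨ.differentiableAt.hasFDerivAt
    have h2 := h1.comp (0 : P) L'.hasFDerivAt
    have h3 : (fderiv 𝕜 Ψ 0).comp L' = (ContinuousLinearEquiv.refl 𝕜 P : P →L[𝕜] P) :=
      ContinuousLinearMap.ext fun E => LinearMap.congr_fun hL E
    rwa [h3] at h2
  have hΘs : HasStrictFDerivAt Θ (ContinuousLinearEquiv.refl 𝕜 P : P →L[𝕜] P) 0 := by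
    have := hΘan.hasStrictFDerivAt
    rwa [hΘd.fderiv] at this
  let e := hΘs.toOpenPartialHomeomorph Θ
  have heΘ : ∀ x, e x = Θ x := fun x => rfl
  have he0 : (0 : P) ∈ e.source := hΘs.mem_toOpenPartialHomeomorph_source
  have hg : AnalyticAt 𝕜 e.symm (Θ 0) := e.analyticAt_symm' he0 hΘan hΘd.fderiv
  have hg0 : e.symm (Θ 0) = 0 := e.left_inv he0
  have hΘ0 : Θ 0 = fun α i j => A α i j := by
    change Ψ (L' 0) = _
    rw [hL0, hΨ0]
  let β : (Fin l → 𝕜) → P := fun μ α i j => ℬ μ α i j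
  have hβ : AnalyticAt 𝕜 β 0 :=
    AnalyticAt.pi fun α => AnalyticAt.pi fun i => AnalyticAt.pi fun j => hℬ.1 α i j
  have hβ0 : β 0 = Θ 0 := by
    rw [hΘ0]
    funext α i j
    exact congrFun (congrFun (congrFun hℬ.2 α) i) j
  let ψ : (Fin l → 𝕜) → G × (κ → 𝕜) := fun μ => L' (e.symm (β μ))
  have hψ : AnalyticAt 𝕜 ψ 0 := by
    refine (L'.analyticAt _).comp (AnalyticAt.comp (g := e.symm) (f := β) ?_ hβ)
    rw [hβ0]
    exact hg
  have hψ0 : ψ 0 = 0 := by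
    change L' (e.symm (β 0)) = 0
    rw [hβ0, hg0, hL0]
  have hψΨ : ∀ᶠ μ in 𝓝 0, Ψ (ψ μ) = β μ := by
    have h1 : ∀ᶠ y in 𝓝 (Θ 0), e (e.symm y) = y := e.eventually_right_inverse' he0
    rw [← hβ0] at h1
    exact (hβ.continuousAt.eventually h1)
  have hψt : Filter.Tendsto ψ (𝓝 0) (𝓝 0) := by
    simpa [ContinuousAt, hψ0] using hψ.continuousAt
  have hIan : ∀ v i j, AnalyticAt 𝕜 (fun μ => J (ψ μ).1 v i j) 0 := fun v i j => by
    have h1 : AnalyticAt 𝕜 (fun u : G × (κ → 𝕜) => J u.1 v i j) (ψ 0) := by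
      rw [hψ0]
      exact hJan v i j
    exact h1.comp hψ
  refine ⟨fun μ => (ψ μ).2, fun k => ?_, ?_, fun μ => J (ψ μ).1, hIan, ?_, ?_⟩
  · have h1 : AnalyticAt 𝕜 (fun u : G × (κ → 𝕜) => u.2 k) (ψ 0) :=
      ((ContinuousLinearMap.proj (R := 𝕜) (φ := fun _ : κ => 𝕜) k).comp
        (ContinuousLinearMap.snd 𝕜 G (κ → 𝕜))).analyticAt _
    exact h1.comp hψ
  · change (ψ 0).2 = 0
    rw [hψ0]
    rfl
  · intro v
    change J (ψ 0).1 v = 1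
    rw [hψ0]
    exact hJ0 v
  · filter_upwards [hψΨ, hψt.eventually hunit] with μ h1 hu α
    have h2 : ℬ μ α = (J (ψ μ).1 (Q.tgt α))⁻¹ * 𝒜 (ψ μ).2 α * J (ψ μ).1 (Q.src α) := by
      ext i j
      exact (congrFun (congrFun (congrFun h1 α) i) j).symm
    rw [h2, Matrix.mul_assoc (J (ψ μ).1 (Q.tgt α))⁻¹,
      Matrix.mul_nonsing_inv_cancel_left _ _ (hu _),
      Matrix.mul_nonsing_inv_cancel_right _ _ (hu _)]

end Transversality

/-! ### Coordinate complements of the tangent space and counting parameters. -/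

section Complements

variable {𝕜 : Type} [RCLike 𝕜] {Q : QuiverData} {d : Q.Vert → Type}
  [∀ v, Fintype (d v)] [∀ v, DecidableEq (d v)]

/-- The entries of the matrices of a representation. -/
abbrev Place (Q : QuiverData) (d : Q.Vert → Type) : Type :=
  Σ α : Q.Arrow, d (Q.tgt α) × d (Q.src α)

/-- The entries of `F` outside the range of `pos` vanish. -/
def SupportedOn {κ : Type} (pos : κ → Place Q d) (F : MatRep Q d 𝕜) : Prop :=
  ∀ p, p ∉ Set.range pos → F p.1 p.2.1 p.2.2 = 0

/-- The representations supported on the range of `pos` form a complement of the tangent space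
to the orbit of `A`. -/
def IsComplement {κ : Type} (A : MatRep Q d 𝕜) (pos : κ → Place Q d) : Prop :=
  (∀ E : MatRep Q d 𝕜, ∃ X F, SupportedOn pos F ∧ E = infinitesimalAction A X + F) ∧
  ∀ X, SupportedOn pos (infinitesimalAction A X) → infinitesimalAction A X = 0

/-- `𝒜` is obtained from `A` by adding the parameters to the entries `pos c`. -/
def IsCoordinateFamily {κ : Type} (A : MatRep Q d 𝕜) (pos : κ → Place Q d)
    (𝒜 : (κ → 𝕜) → MatRep Q d 𝕜) : Prop :=
  ∀ x : κ → 𝕜,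
    (∀ c, 𝒜 x (pos c).1 (pos c).2.1 (pos c).2.2 = A (pos c).1 (pos c).2.1 (pos c).2.2 + x c) ∧
    ∀ p, p ∉ Set.range pos → 𝒜 x p.1 p.2.1 p.2.2 = A p.1 p.2.1 p.2.2

open Classical in
/-- The representation with the entries `x c` at the places `pos c` and zeros elsewhere. -/
noncomputable def placeEmbedding {κ : Type} [Fintype κ] (pos : κ → Place Q d) :
    (κ → 𝕜) →ₗ[𝕜] MatRep Q d 𝕜 where
  toFun x := fun α => Matrix.of fun i j => ∑ c, if pos c = ⟨α, i, j⟩ then x c else 0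
  map_add' x y := by
    funext α
    ext i j
    simp only [Pi.add_apply, Matrix.add_apply, Matrix.of_apply, ← Finset.sum_add_distrib]
    exact Finset.sum_congr rfl fun c _ => by split_ifs <;> simp
  map_smul' a x := by
    funext α
    ext i j
    simp [Finset.mul_sum]

theorem placeEmbedding_apply_pos {κ : Type} [Fintype κ] {pos : κ → Place Q d}
    (hpos : Function.Injective pos) (x : κ → 𝕜) (c : κ) :
    placeEmbedding pos x (pos c).1 (pos c).2.1 (pos c).2.2 = x c := by
  classical
  change (∑ c', if pos c' = pos c then x c' else 0) = x c
  simp [hpos.eq_iff]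

theorem supportedOn_placeEmbedding {κ : Type} [Fintype κ] (pos : κ → Place Q d) (x : κ → 𝕜) :
    SupportedOn pos (placeEmbedding pos x) := by
  classical
  intro p hp
  change (∑ c', if pos c' = p then x c' else 0) = 0
  exact Finset.sum_eq_zero fun c _ => if_neg fun h => hp ⟨c, h⟩

theorem SupportedOn.eq_placeEmbedding {κ : Type} [Fintype κ] {pos : κ → Place Q d}
    (hpos : Function.Injective pos) {F : MatRep Q d 𝕜} (hF : SupportedOn pos F) :
    F = placeEmbedding pos fun c => F (pos c).1 (pos c).2.1 (pos c).2.2 := by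
  funext α
  ext i j
  by_cases hp : (⟨α, i, j⟩ : Place Q d) ∈ Set.range pos
  · obtain ⟨c, hc⟩ := hp
    have := placeEmbedding_apply_pos hpos (fun c => F (pos c).1 (pos c).2.1 (pos c).2.2) c
    rw [hc] at this
    exact this.symm
  · exact (hF _ hp).trans (supportedOn_placeEmbedding pos _ _ hp).symm

theorem placeEmbedding_injective {κ : Type} [Fintype κ] {pos : κ → Place Q d}
    (hpos : Function.Injective pos) :
    Function.Injective (placeEmbedding (𝕜 := 𝕜) pos) := by
  intro x y h
  funext c
  rw [← placeEmbedding_apply_pos hpos x c, h, placeEmbedding_apply_pos hpos y c]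

theorem isCoordinateFamily_placeEmbedding {κ : Type} [Fintype κ] {pos : κ → Place Q d}
    (hpos : Function.Injective pos) (A : MatRep Q d 𝕜) :
    IsCoordinateFamily A pos fun x => A + placeEmbedding pos x := fun x =>
  ⟨fun c => congrArg (_ + ·) (placeEmbedding_apply_pos hpos x c), fun p hp =>
    (congrArg (_ + ·) (supportedOn_placeEmbedding pos x p hp)).trans (add_zero _)⟩

section Families

variable {κ : Type} {A : MatRep Q d 𝕜} {pos : κ → Place Q d}
  {𝒜 : (κ → 𝕜) → MatRep Q d 𝕜}

theorem IsCoordinateFamily.eq_add_placeEmbedding [Fintype κ] (hpos : Function.Injective pos)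
    (h : IsCoordinateFamily A pos 𝒜) (x : κ → 𝕜) : 𝒜 x = A + placeEmbedding pos x := by
  have h1 : SupportedOn pos (𝒜 x - A) := fun p hp => sub_eq_zero.2 ((h x).2 p hp)
  have h2 := h1.eq_placeEmbedding hpos
  have h3 : (fun c => (𝒜 x - A) (pos c).1 (pos c).2.1 (pos c).2.2) = x := by
    funext c
    exact sub_eq_iff_eq_add'.2 ((h x).1 c)
  rw [h3] at h2
  rw [← h2]
  abel

/-- An entry of `placeEmbedding pos x` as a linear form in `x`. -/
noncomputable def placeEntry [Fintype κ] (pos : κ → Place Q d) (α : Q.Arrow) (i : d (Q.tgt α))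
    (j : d (Q.src α)) : (κ → 𝕜) →L[𝕜] 𝕜 :=
  LinearMap.toContinuousLinearMap {
    toFun := fun x => placeEmbedding pos x α i j
    map_add' := fun x y => by rw [map_add]; rfl
    map_smul' := fun a x => by rw [map_smul]; rfl }

theorem IsCoordinateFamily.fderiv_apply [Fintype κ] (hpos : Function.Injective pos)
    (h : IsCoordinateFamily A pos 𝒜) (α : Q.Arrow) (i : d (Q.tgt α)) (j : d (Q.src α))
    (x y : κ → 𝕜) :
    fderiv 𝕜 (fun x => 𝒜 x α i j) x y = placeEmbedding pos y α i j := by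
  simp_rw [h.eq_add_placeEmbedding hpos]
  have h1 : HasFDerivAt (fun x => A α i j + placeEntry pos α i j x)
      (placeEntry (𝕜 := 𝕜) pos α i j) x :=
    (placeEntry (𝕜 := 𝕜) pos α i j).hasFDerivAt.const_add _
  exact congrArg (· y) h1.fderiv

theorem IsCoordinateFamily.isDeformation [Fintype κ] (hpos : Function.Injective pos)
    (h : IsCoordinateFamily A pos 𝒜) : IsDeformation A 𝒜 := by
  refine ⟨fun α i j => ?_, ?_⟩
  · simp_rw [h.eq_add_placeEmbedding hpos]
    exact (analyticAt_const (v := A α i j)).fun_add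
      ((placeEntry (𝕜 := 𝕜) pos α i j).analyticAt 0)
  · rw [h.eq_add_placeEmbedding hpos, map_zero, add_zero]

variable [Fintype Q.Vert] [Fintype Q.Arrow]

theorem IsCoordinateFamily.isVersal [Fintype κ] (hpos : Function.Injective pos)
    (h : IsCoordinateFamily A pos 𝒜)
    (hc : ∀ E : MatRep Q d 𝕜, ∃ X F, SupportedOn pos F ∧ E = infinitesimalAction A X + F) :
    IsVersal A 𝒜 := by
  refine isVersal_of_exists_tangent (h.isDeformation hpos) fun E => ?_
  obtain ⟨X, F, hF, rfl⟩ := hc E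
  refine ⟨X, fun c => F (pos c).1 (pos c).2.1 (pos c).2.2, fun α i j => ?_⟩
  rw [h.fderiv_apply hpos, ← hF.eq_placeEmbedding hpos]
  rfl

theorem IsComplement.isCompl [Fintype κ] (hpos : Function.Injective pos)
    (h : IsComplement A pos) :
    IsCompl (infinitesimalAction A).range (placeEmbedding (𝕜 := 𝕜) pos).range := by
  refine ⟨Submodule.disjoint_def.2 ?_, codisjoint_iff.2 (Submodule.eq_top_iff'.2 fun E => ?_)⟩
  · rintro _ ⟨X, rfl⟩ ⟨x, hx⟩
    exact h.2 X (hx ▸ supportedOn_placeEmbedding pos x)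
  · obtain ⟨X, F, hF, rfl⟩ := h.1 E
    exact Submodule.add_mem_sup ⟨X, rfl⟩ ⟨_, (hF.eq_placeEmbedding hpos).symm⟩

theorem IsComplement.finrank_eq [Fintype κ] (hpos : Function.Injective pos)
    (h : IsComplement A pos) :
    Module.finrank 𝕜 (infinitesimalAction A).range + Fintype.card κ =
      Module.finrank 𝕜 (MatRep Q d 𝕜) := by
  rw [← Submodule.finrank_add_eq_of_isCompl (h.isCompl hpos),
    LinearMap.finrank_range_of_inj (placeEmbedding_injective hpos), Module.finrank_fintype_fun_eq_card]

/-- The first-order variations of the parameters must fill whatever the tangent space to the orbit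
misses, and they span a space of dimension at most the number of parameters. -/
theorem IsVersal.finrank_le [Fintype κ] (h : IsVersal A 𝒜) :
    Module.finrank 𝕜 (MatRep Q d 𝕜) ≤
      Module.finrank 𝕜 (infinitesimalAction A).range + Fintype.card κ := by
  let D : (κ → 𝕜) →ₗ[𝕜] MatRep Q d 𝕜 := {
    toFun := fun y α => Matrix.of fun i j => fderiv 𝕜 (fun x => 𝒜 x α i j) 0 y
    map_add' := fun x y => by
      funext α
      ext i j
      exact map_add (fderiv 𝕜 (fun x => 𝒜 x α i j) 0) x y
    map_smul' := fun a x => by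
      funext α
      ext i j
      exact map_smul (fderiv 𝕜 (fun x => 𝒜 x α i j) 0) a x }
  have h1 : (infinitesimalAction A).range ⊔ D.range = ⊤ :=
    Submodule.eq_top_iff'.2 fun E => by
      obtain ⟨X, y, hXy⟩ := h.exists_tangent E
      have : E = infinitesimalAction A X + D y := by
        funext α
        ext i j
        exact hXy α i j
      rw [this]
      exact Submodule.add_mem_sup ⟨X, rfl⟩ ⟨y, rfl⟩
  have h2 := Submodule.finrank_add_le_finrank_add_finrank (infinitesimalAction A).range D.range
  rw [h1, finrank_top] at h2
  have h3 := LinearMap.finrank_range_le D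
  rw [Module.finrank_fintype_fun_eq_card] at h3
  omega

/-- A family obtained by adding parameters at the places of a complement of the tangent space is
a simplest miniversal deformation. -/
theorem IsCoordinateFamily.isSimplestMiniversal [Fintype κ] (hpos : Function.Injective pos)
    (h : IsCoordinateFamily A pos 𝒜) (hc : IsComplement A pos) : IsSimplestMiniversal A 𝒜 := by
  refine ⟨⟨h.isVersal hpos hc.1, fun l ℬ hl hv => ?_⟩, pos, hpos, h⟩
  have h1 := hv.finrank_le
  have h2 := hc.finrank_eq hpos
  rw [Fintype.card_fin] at h1
  omega

/-- If some set of places is a complement of the tangent space, then so are the places of the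
parameters of any simplest miniversal deformation. -/
theorem IsSimplestMiniversal.exists_isComplement [Fintype κ] (h : IsSimplestMiniversal A 𝒜)
    {κ' : Type} [Fintype κ'] {pos' : κ' → Place Q d} (hpos' : Function.Injective pos')
    (hc' : IsComplement A pos') :
    ∃ pos : κ → Place Q d, Function.Injective pos ∧ IsCoordinateFamily A pos 𝒜 ∧
      IsComplement A pos := by
  obtain ⟨⟨hv, hmin⟩, pos, hpos, hco⟩ := h
  have hco : IsCoordinateFamily A pos 𝒜 := hco
  have hH1 : ∀ E : MatRep Q d 𝕜, ∃ X F, SupportedOn pos F ∧ E = infinitesimalAction A X + F := by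
    intro E
    obtain ⟨X, y, hXy⟩ := hv.exists_tangent E
    refine ⟨X, placeEmbedding pos y, supportedOn_placeEmbedding pos y, ?_⟩
    funext α
    ext i j
    rw [hXy α i j, hco.fderiv_apply hpos]
    rfl
  refine ⟨pos, hpos, hco, hH1, fun X hX => ?_⟩
  -- The family on the places `pos'` is versal; it is reindexed by `Fin` because minimality compares
  -- only with such families.
  have hcard : Fintype.card κ ≤ Fintype.card κ' := by
    by_contra hlt
    let e := Fintype.equivFin κ'
    have hpos'' : Function.Injective (pos' ∘ e.symm) := hpos'.comp e.symm.injective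
    refine hmin _ _ (not_le.1 hlt)
      ((isCoordinateFamily_placeEmbedding hpos'' A).isVersal hpos'' fun E => ?_)
    obtain ⟨X, F, hF, hE⟩ := hc'.1 E
    exact ⟨X, F, fun p hp => hF p fun ⟨c, hc⟩ => hp ⟨e c, by simp [hc]⟩, hE⟩
  have h1 := hc'.finrank_eq hpos'
  have h2 := Submodule.finrank_sup_add_finrank_inf_eq (infinitesimalAction A).range
    (placeEmbedding (𝕜 := 𝕜) pos).range
  have h3 : (infinitesimalAction A).range ⊔ (placeEmbedding (𝕜 := 𝕜) pos).range = ⊤ :=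
    Submodule.eq_top_iff'.2 fun E => by
      obtain ⟨X, F, hF, rfl⟩ := hH1 E
      exact Submodule.add_mem_sup ⟨X, rfl⟩ ⟨_, (hF.eq_placeEmbedding hpos).symm⟩
  rw [h3, finrank_top, LinearMap.finrank_range_of_inj (placeEmbedding_injective hpos),
    Module.finrank_fintype_fun_eq_card] at h2
  -- The two spaces span everything and their dimensions add up to at most the whole, so the
  -- dimension formula leaves nothing for the intersection.
  have h4 : (infinitesimalAction A).range ⊓ (placeEmbedding (𝕜 := 𝕜) pos).range = ⊥ :=
    Submodule.finrank_eq_zero.1 (by omega)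
  exact (Submodule.mem_bot 𝕜).1 (h4 ▸ ⟨⟨X, rfl⟩, ⟨_, (hX.eq_placeEmbedding hpos).symm⟩⟩)

end Families

end Complements

/-! ### Sylvester equations, intertwiners and cyclic vectors. -/

section Intertwining

variable {𝕜 : Type} [Field 𝕜] {m n : Type} [Fintype m] [Fintype n] [DecidableEq m] [DecidableEq n]

theorem mul_pow_of_intertwining {M : Matrix m m 𝕜} {N : Matrix n n 𝕜} {X : Matrix m n 𝕜}
    (h : X * N = M * X) (k : ℕ) : X * N ^ k = M ^ k * X := by
  induction k with
  | zero => simp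
  | succ k ih => rw [pow_succ, pow_succ, ← Matrix.mul_assoc, ih, Matrix.mul_assoc, h,
      Matrix.mul_assoc]

theorem mul_aeval_of_intertwining {M : Matrix m m 𝕜} {N : Matrix n n 𝕜} {X : Matrix m n 𝕜}
    (h : X * N = M * X) (f : Polynomial 𝕜) :
    X * Polynomial.aeval N f = Polynomial.aeval M f * X := by
  rw [Polynomial.aeval_eq_sum_range, Polynomial.aeval_eq_sum_range, Matrix.mul_sum, Matrix.sum_mul]
  exact Finset.sum_congr rfl fun k _ => by
    rw [Matrix.mul_smul, Matrix.smul_mul, mul_pow_of_intertwining h]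

/-- Matrices annihilated by coprime polynomials have no nonzero intertwiners. -/
theorem eq_zero_of_intertwining_of_isCoprime {M : Matrix m m 𝕜} {N : Matrix n n 𝕜}
    {X : Matrix m n 𝕜} (h : X * N = M * X) {f g : Polynomial 𝕜} (hfg : IsCoprime f g)
    (hM : Polynomial.aeval M f = 0) (hN : Polynomial.aeval N g = 0) : X = 0 := by
  obtain ⟨a, b, hab⟩ := hfg
  -- The polynomial `f * a` takes the value `1` at `N` and `0` at `M`.
  have h1 := mul_aeval_of_intertwining h (f * a)
  have h2 : Polynomial.aeval N (f * a) = 1 := by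
    have := congrArg (Polynomial.aeval N) hab
    rw [map_add, map_mul _ b, hN, mul_zero, add_zero, map_one, mul_comm] at this
    exact this
  rw [h2, Matrix.mul_one, map_mul, hM, zero_mul, Matrix.zero_mul] at h1
  exact h1

/-- The Sylvester equation is solvable if the homogeneous one has only the zero solution. -/
theorem exists_sylvester {M : Matrix m m 𝕜} {N : Matrix n n 𝕜}
    (h : ∀ X : Matrix m n 𝕜, X * N = M * X → X = 0) (E : Matrix m n 𝕜) :
    ∃ X : Matrix m n 𝕜, X * N - M * X = E := by
  let L : Matrix m n 𝕜 →ₗ[𝕜] Matrix m n 𝕜 := {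
    toFun := fun X => X * N - M * X
    map_add' := fun X Y => by
      rw [Matrix.add_mul, Matrix.mul_add]
      abel
    map_smul' := fun a X => by
      rw [Matrix.smul_mul, Matrix.mul_smul, smul_sub]
      rfl }
  have hL : Function.Injective L :=
    (injective_iff_map_eq_zero L).2 fun X hX => h X (sub_eq_zero.1 hX)
  exact LinearMap.injective_iff_surjective.1 hL E

/-- `v` generates the module over the polynomials defined by `N`. -/
def IsCyclicVector (N : Matrix n n 𝕜) (v : n → 𝕜) : Prop :=
  ∀ S : Submodule 𝕜 (n → 𝕜), (∀ u ∈ S, N.mulVec u ∈ S) → v ∈ S → S = ⊤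

theorem aeval_mulVec_mem {N : Matrix n n 𝕜} {S : Submodule 𝕜 (n → 𝕜)}
    (hS : ∀ u ∈ S, N.mulVec u ∈ S) (f : Polynomial 𝕜) {u : n → 𝕜} (hu : u ∈ S) :
    (Polynomial.aeval N f).mulVec u ∈ S := by
  have hpow : ∀ k : ℕ, (N ^ k).mulVec u ∈ S := fun k => by
    induction k with
    | zero => simpa using hu
    | succ k ih =>
      rw [pow_succ', ← Matrix.mulVec_mulVec]
      exact hS _ ih
  rw [Polynomial.aeval_eq_sum_range, Matrix.sum_mulVec]
  exact S.sum_mem fun k _ => by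
    rw [Matrix.smul_mulVec]
    exact S.smul_mem _ (hpow k)

/-- Nakayama's lemma for a nilpotent polynomial in a matrix. -/
theorem eq_top_of_forall_add {N : Matrix n n 𝕜} {S : Submodule 𝕜 (n → 𝕜)}
    (hS : ∀ u ∈ S, N.mulVec u ∈ S) {f : Polynomial 𝕜}
    (hf : IsNilpotent (Polynomial.aeval N f))
    (h : ∀ y, ∃ s ∈ S, ∃ y', y = s + (Polynomial.aeval N f).mulVec y') : S = ⊤ := by
  obtain ⟨k, hk⟩ := hf
  -- Iterating the hypothesis pushes the remainder into the range of ever higher powers, which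
  -- finally vanish.
  have key : ∀ k : ℕ, ∀ y, ∃ s ∈ S, ∃ y', y = s + ((Polynomial.aeval N f) ^ k).mulVec y' := by
    intro k
    induction k with
    | zero => exact fun y => ⟨0, S.zero_mem, y, by simp⟩
    | succ k ih =>
      intro y
      obtain ⟨s, hs, y', rfl⟩ := ih y
      obtain ⟨s', hs', y'', rfl⟩ := h y'
      refine ⟨s + ((Polynomial.aeval N f) ^ k).mulVec s', S.add_mem hs ?_, y'', ?_⟩
      · rw [← map_pow]
        exact aeval_mulVec_mem hS _ hs'
      · rw [Matrix.mulVec_add, Matrix.mulVec_mulVec, pow_succ, add_assoc]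
  refine Submodule.eq_top_iff'.2 fun y => ?_
  obtain ⟨s, hs, y', rfl⟩ := key k y
  rw [hk, Matrix.zero_mulVec, add_zero]
  exact hs

/-- If the covector at `o` is cyclic for `N`, there is a vector `u` such that the coordinates at
`o` of `u, N u, N² u, …` are `0, …, 0, 1`. -/
theorem exists_vector_of_isCyclicVector_transpose {N : Matrix n n 𝕜} {o : n} (ho : IsCyclicVector N.transpose (Pi.single o 1))
    {χ : Polynomial 𝕜} (hχ : χ.Monic) (hdeg : χ.natDegree = Fintype.card n)
    (hN : Polynomial.aeval N χ = 0) :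
    ∃ u : n → 𝕜, ∀ k < Fintype.card n,
      (N ^ k).mulVec u o = if k + 1 = Fintype.card n then 1 else 0 := by
  let L : (n → 𝕜) →ₗ[𝕜] (Fin (Fintype.card n) → 𝕜) :=
    LinearMap.pi fun k => (LinearMap.proj o).comp (N ^ k.val).mulVecLin
  have hL : ∀ u k, L u k = (N ^ k.val).mulVec u o := fun u k => rfl
  have hinj : Function.Injective L := by
    refine (injective_iff_map_eq_zero L).2 fun u hu => ?_
    have h1 : ∀ g : Polynomial 𝕜, (Polynomial.aeval N g).mulVec u o = 0 := by
      intro g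
      rw [← Polynomial.modByMonic_add_div g χ, map_add, map_mul, hN, zero_mul, add_zero]
      -- The degree bound for the remainder needs `χ ≠ 1`; a constant `χ` would make the index type
      -- empty, contrary to `o`.
      by_cases hχ1 : χ = 1
      · rw [hχ1, Polynomial.natDegree_one] at hdeg
        exact (Fintype.card_eq_zero_iff.1 hdeg.symm).elim o
      · rw [Polynomial.aeval_eq_sum_range' (n := Fintype.card n)
          (hdeg ▸ Polynomial.natDegree_modByMonic_lt g hχ hχ1), Matrix.sum_mulVec, Finset.sum_apply]
        refine Finset.sum_eq_zero fun k hk => ?_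
        have := congrFun hu ⟨k, Finset.mem_range.1 hk⟩
        rw [hL] at this
        rw [Matrix.smul_mulVec, Pi.smul_apply, this, Pi.zero_apply, smul_zero]
    -- `S` consists of the covectors vanishing on all `N ^ k u`. It is stable under the transpose
    -- and contains the cyclic covector at `o`, so `u = 0`.
    let S : Submodule 𝕜 (n → 𝕜) := {
      carrier := {v | ∀ k : ℕ, v ⬝ᵥ (N ^ k).mulVec u = 0}
      add_mem' := fun {a b} ha hb k => by rw [add_dotProduct, ha k, hb k, add_zero]
      zero_mem' := fun k => zero_dotProduct _
      smul_mem' := fun c v hv k => by rw [smul_dotProduct, hv k, smul_zero] }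
    have hS : S = ⊤ := ho S
      (fun v hv k => by
        rw [Matrix.mulVec_transpose, ← Matrix.dotProduct_mulVec, Matrix.mulVec_mulVec, ← pow_succ']
        exact hv (k + 1))
      (fun k => by
        rw [single_dotProduct, one_mul]
        simpa using h1 (Polynomial.X ^ k))
    funext i
    have h2 : Pi.single i 1 ∈ S := hS ▸ Submodule.mem_top
    simpa using h2 0
  have hsurj : Function.Surjective L :=
    (LinearMap.injective_iff_surjective_of_finrank_eq_finrank (by simp)).1 hinj
  obtain ⟨u, hu⟩ := hsurj fun k => if k.val + 1 = Fintype.card n then 1 else 0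
  exact ⟨u, fun k hk => by rw [← hL u ⟨k, hk⟩, hu]⟩

variable {M : Matrix m m 𝕜} {N : Matrix n n 𝕜} {o : n}
  {χ : Polynomial 𝕜} {v : n → 𝕜}

/-- Let `w` be the only possibly nonzero column of the commutator, and let `u` have `o`-coordinates
`0, …, 0, 1` along `u, N u, N² u, …`. Then `X` commutes past the powers of `N` on `u` below the top
one, where the error `w` appears once. Since `χ` is monic of this degree, `0 = X χ(N) u = χ(M) X u +
w = w`. -/
theorem intertwining_of_supported_column (ho : IsCyclicVector N.transpose (Pi.single o 1))
    (hχ : χ.Monic) (hdeg : χ.natDegree = Fintype.card n)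
    (hN : Polynomial.aeval N χ = 0) (hM : Polynomial.aeval M χ = 0) {X : Matrix m n 𝕜}
    (hX : ∀ i j, j ≠ o → (X * N - M * X) i j = 0) : X * N = M * X := by
  obtain ⟨u, hu⟩ := exists_vector_of_isCyclicVector_transpose ho hχ hdeg hN
  set w : m → 𝕜 := fun i => (X * N - M * X) i o with hw
  have hstep : ∀ y : n → 𝕜, X.mulVec (N.mulVec y) = M.mulVec (X.mulVec y) + y o • w := by
    intro y
    have h1 : (X * N - M * X).mulVec y = y o • w := by
      funext i
      simp only [Matrix.mulVec, dotProduct, Pi.smul_apply, smul_eq_mul, hw]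
      rw [Finset.sum_eq_single o (fun j _ hj => by rw [hX i j hj, zero_mul])
        (fun h => absurd (Finset.mem_univ o) h), mul_comm]
    rw [Matrix.sub_mulVec, ← Matrix.mulVec_mulVec, ← Matrix.mulVec_mulVec] at h1
    rw [← h1]
    abel
  have hcard : 0 < Fintype.card n := Fintype.card_pos_iff.2 ⟨o⟩
  have hlow : ∀ k < Fintype.card n, X.mulVec ((N ^ k).mulVec u) = (M ^ k).mulVec (X.mulVec u) := by
    intro k
    induction k with
    | zero => simp
    | succ k ih =>
      intro hk
      rw [pow_succ', pow_succ', ← Matrix.mulVec_mulVec, hstep, ih (by omega), hu k (by omega),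
        if_neg (by omega), zero_smul, add_zero, Matrix.mulVec_mulVec]
  have htop : X.mulVec ((N ^ Fintype.card n).mulVec u) =
      (M ^ Fintype.card n).mulVec (X.mulVec u) + w := by
    obtain ⟨k, hk⟩ : ∃ k, Fintype.card n = k + 1 := ⟨Fintype.card n - 1, by omega⟩
    have h1 := hu k (by omega)
    rw [if_pos hk.symm] at h1
    have h2 := hlow k (by omega)
    rw [hk, pow_succ', pow_succ', ← Matrix.mulVec_mulVec, hstep, h2, h1, one_smul,
      Matrix.mulVec_mulVec]
  have hsum : ∀ {l : Type} [Fintype l] [DecidableEq l] (P : Matrix l l 𝕜) (y : l → 𝕜),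
      (Polynomial.aeval P χ).mulVec y = (P ^ Fintype.card n).mulVec y +
        ∑ k ∈ Finset.range (Fintype.card n), χ.coeff k • (P ^ k).mulVec y := by
    intro l _ _ P y
    rw [Polynomial.aeval_eq_sum_range, Finset.sum_range_succ, hdeg, ← hdeg,
      hχ.coeff_natDegree, one_smul, hdeg, Matrix.add_mulVec, Matrix.sum_mulVec, add_comm]
    simp_rw [Matrix.smul_mulVec]
  have hw0 : w = 0 := by
    have h1 := congrArg X.mulVec (hsum N u)
    rw [hN, Matrix.zero_mulVec, Matrix.mulVec_zero, Matrix.mulVec_add, htop, Matrix.mulVec_sum] at h1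
    have h2 := hsum M (X.mulVec u)
    rw [hM, Matrix.zero_mulVec] at h2
    have h3 : ∑ k ∈ Finset.range (Fintype.card n), X.mulVec (χ.coeff k • (N ^ k).mulVec u) =
        ∑ k ∈ Finset.range (Fintype.card n), χ.coeff k • (M ^ k).mulVec (X.mulVec u) :=
      Finset.sum_congr rfl fun k hk => by
        rw [Matrix.mulVec_smul, hlow k (Finset.mem_range.1 hk)]
    rw [h3, add_right_comm, ← h2, zero_add] at h1
    exact h1.symm
  refine sub_eq_zero.1 (Matrix.ext fun i j => ?_)
  by_cases hj : j = o
  · subst hj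
    exact congrFun hw0 i
  · exact hX i j hj

/-- A free vector `w` in column `o` is added to the unknowns, and the value of `X` at the cyclic
vector `v` to the equations. The resulting endomorphism is injective: its kernel consists of pairs
with `w = 0` and `X` an intertwiner killing a cyclic vector, hence zero. So it is surjective, and
`E` is reached up to column `o`. -/
theorem exists_sylvester_modulo_column (ho : IsCyclicVector N.transpose (Pi.single o 1))
    (hχ : χ.Monic) (hdeg : χ.natDegree = Fintype.card n)
    (hN : Polynomial.aeval N χ = 0) (hM : Polynomial.aeval M χ = 0) (hv : IsCyclicVector N v)
    (E : Matrix m n 𝕜) : ∃ X : Matrix m n 𝕜, ∀ i j, j ≠ o → E i j = (X * N - M * X) i j := by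
  let L : Matrix m n 𝕜 × (m → 𝕜) →ₗ[𝕜] Matrix m n 𝕜 × (m → 𝕜) := {
    toFun := fun u => (u.1 * N - M * u.1 + Matrix.vecMulVec u.2 (Pi.single o 1), u.1.mulVec v)
    map_add' := fun a b => by
      refine Prod.ext ?_ (Matrix.add_mulVec _ _ _)
      simp only [Prod.fst_add, Prod.snd_add, Matrix.add_mul, Matrix.mul_add, Matrix.add_vecMulVec]
      abel
    map_smul' := fun c a => by
      refine Prod.ext ?_ (Matrix.smul_mulVec _ _ _)
      simp [Matrix.smul_vecMulVec, smul_sub] }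
  have hinj : Function.Injective L := by
    refine (injective_iff_map_eq_zero L).2 fun ⟨X, w⟩ hu => ?_
    have h1 : X * N - M * X + Matrix.vecMulVec w (Pi.single o 1) = 0 := congrArg Prod.fst hu
    have h2 : X.mulVec v = 0 := congrArg Prod.snd hu
    have h3 : X * N = M * X := intertwining_of_supported_column ho hχ hdeg hN hM fun i j hj => by
      have := congrFun (congrFun h1 i) j
      simpa [Matrix.vecMulVec_apply, hj] using this
    have hw : w = 0 := by
      funext i
      have := congrFun (congrFun h1 i) o
      simpa [Matrix.vecMulVec_apply, h3] using this
    have hS := hv (LinearMap.ker X.mulVecLin)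
      (fun y hy => by
        have hy : X.mulVec y = 0 := hy
        change X.mulVec (N.mulVec y) = 0
        rw [Matrix.mulVec_mulVec, h3, ← Matrix.mulVec_mulVec, hy, Matrix.mulVec_zero]) h2
    have hX : X = 0 := by
      ext i j
      have : Pi.single j 1 ∈ LinearMap.ker X.mulVecLin := hS ▸ Submodule.mem_top
      simpa using congrFun (show X.mulVec (Pi.single j 1) = 0 from this) i
    rw [hX, hw]
    rfl
  obtain ⟨⟨X, w⟩, hXw⟩ := LinearMap.injective_iff_surjective.1 hinj (E, 0)
  have h1 : X * N - M * X + Matrix.vecMulVec w (Pi.single o 1) = E := congrArg Prod.fst hXw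
  refine ⟨X, fun i j hj => ?_⟩
  rw [← h1]
  simp [Matrix.vecMulVec_apply, hj]

end Intertwining

/-! ### The irreducible polynomials of the cells. -/

section CellPolynomial

open Polynomial in
open Classical in
/-- The irreducible polynomial a power of which annihilates the cells `J_r^𝕜(z)`. -/
noncomputable def cellPoly (𝕜 : Type) [RCLike 𝕜] (z : ℂ) : Polynomial 𝕜 :=
  if (RCLike.I : 𝕜) = 0 ∧ z.im ≠ 0 then (X - C (z.re : 𝕜)) ^ 2 + C ((z.im : 𝕜) ^ 2)
  else X - C ((z.re : 𝕜) + (z.im : 𝕜) * RCLike.I)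

open Polynomial

variable {𝕜 : Type} [RCLike 𝕜]

theorem monic_X_sub_C_sq_add_C (a c : 𝕜) : ((X - C a) ^ 2 + C c).Monic := by
  monicity!

theorem natDegree_X_sub_C_sq_add_C (a c : 𝕜) : ((X - C a) ^ 2 + C c).natDegree = 2 := by
  compute_degree!

theorem monic_cellPoly (z : ℂ) : (cellPoly 𝕜 z).Monic := by
  unfold cellPoly
  split_ifs
  · exact monic_X_sub_C_sq_add_C _ _
  · exact monic_X_sub_C _

theorem eq_re_of_I_eq_zero (hI : (RCLike.I : 𝕜) = 0) (x : 𝕜) : x = ((RCLike.re x : ℝ) : 𝕜) := by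
  have := RCLike.re_add_im x
  rw [hI, mul_zero, add_zero] at this
  exact this.symm

theorem irreducible_cellPoly (z : ℂ) : Irreducible (cellPoly 𝕜 z) := by
  unfold cellPoly
  split_ifs with h
  · have hd := natDegree_X_sub_C_sq_add_C (z.re : 𝕜) ((z.im : 𝕜) ^ 2)
    rw [(monic_X_sub_C_sq_add_C _ _).irreducible_iff_roots_eq_zero_of_degree_le_three (by omega)
      (by omega)]
    refine Multiset.eq_zero_of_forall_notMem fun x hx => ?_
    have h1 := (mem_roots'.1 hx).2
    simp only [IsRoot.def, eval_add, eval_pow, eval_sub, eval_X, eval_C] at h1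
    -- Here the field is real, so a root would make the sum of a square and the positive number
    -- `z.im ^ 2` vanish.
    rw [eq_re_of_I_eq_zero h.1 x] at h1
    have h2 : (RCLike.re x - z.re) ^ 2 + z.im ^ 2 = 0 := by exact_mod_cast h1
    have h3 := sq_nonneg (RCLike.re x - z.re)
    have h4 : 0 < z.im ^ 2 := by
      have := h.2
      positivity
    linarith
  · exact irreducible_X_sub_C _

/-- Over the reals, conjugate numbers have the same polynomial; restriction to the closed upper
half-plane removes this ambiguity. -/
theorem cellPoly_injective {z w : ℂ} (hz : (RCLike.I : 𝕜) = 0 → 0 ≤ z.im)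
    (hw : (RCLike.I : 𝕜) = 0 → 0 ≤ w.im) (h : cellPoly 𝕜 z = cellPoly 𝕜 w) : z = w := by
  unfold cellPoly at h
  have hlin : ∀ x : 𝕜, (X - C x).natDegree = 1 := natDegree_X_sub_C
  split_ifs at h with h1 h2 h2
  -- Evaluating at both real parts and adding gives twice the square of their difference equal to
  -- zero.
  · have e1 := congrArg (eval (z.re : 𝕜)) h
    have e2 := congrArg (eval (w.re : 𝕜)) h
    simp only [eval_add, eval_pow, eval_sub, eval_X, eval_C] at e1 e2
    have e1' : (z.re - z.re) ^ 2 + z.im ^ 2 = (z.re - w.re) ^ 2 + w.im ^ 2 := by exact_mod_cast e1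
    have e2' : (w.re - z.re) ^ 2 + z.im ^ 2 = (w.re - w.re) ^ 2 + w.im ^ 2 := by exact_mod_cast e2
    have e3 : z.re - w.re = 0 := by
      have : (z.re - w.re) ^ 2 = 0 := by linarith [sq_nonneg (z.re - w.re)]
      exact pow_eq_zero_iff two_ne_zero |>.1 this
    refine Complex.ext (by linarith) ?_
    rw [e3] at e1'
    exact (pow_left_inj₀ (hz h1.1) (hw h1.1) two_ne_zero).1 (by linarith)
  · have := congrArg natDegree h
    rw [natDegree_X_sub_C_sq_add_C, hlin] at this
    omega
  · have := congrArg natDegree h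
    rw [natDegree_X_sub_C_sq_add_C, hlin] at this
    omega
  · have e := C_injective (sub_right_injective h)
    have hre : z.re = w.re := by
      have := congrArg RCLike.re e
      simpa [RCLike.I_re] using this
    refine Complex.ext hre ?_
    by_cases hI : (RCLike.I : 𝕜) = 0
    · have h1' : z.im = 0 := by tauto
      have h2' : w.im = 0 := by tauto
      rw [h1', h2']
    · rw [hre, add_right_inj] at e
      exact RCLike.ofReal_injective (mul_right_cancel₀ hI e)

theorem isCoprime_cellPoly {z w : ℂ} (hz : (RCLike.I : 𝕜) = 0 → 0 ≤ z.im)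
    (hw : (RCLike.I : 𝕜) = 0 → 0 ≤ w.im) (h : z ≠ w) :
    IsCoprime (cellPoly 𝕜 z) (cellPoly 𝕜 w) := by
  refine ((irreducible_cellPoly z).isCoprime_or_dvd _).resolve_right fun hd => h ?_
  exact cellPoly_injective hz hw (eq_of_monic_of_associated (monic_cellPoly z) (monic_cellPoly w)
    ((irreducible_cellPoly z).associated_of_dvd (irreducible_cellPoly w) hd))

end CellPolynomial

/-! ### Jordan cells: annihilating powers, reflection symmetry and cyclic vectors. -/

section Shifts

variable {𝕜 : Type} [RCLike 𝕜]

/-- Each factor raises the height by at least one, so a nonzero entry of the `k`-th power raises it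
by at least `k`. -/
theorem add_le_of_pow_apply_ne_zero {n : Type} [Fintype n] [DecidableEq n] {M : Matrix n n 𝕜}
    {h : n → ℕ} (hM : ∀ i j, M i j ≠ 0 → h i < h j) :
    ∀ k i j, (M ^ k) i j ≠ 0 → h i + k ≤ h j := by
  intro k
  induction k with
  | zero =>
    intro i j hij
    rw [pow_zero, Matrix.one_apply] at hij
    have : i = j := by
      by_contra hne
      exact hij (if_neg hne)
    rw [this, add_zero]
  | succ k ih =>
    intro i j hij
    rw [pow_succ, Matrix.mul_apply] at hij
    obtain ⟨l, -, hl⟩ := Finset.exists_ne_zero_of_sum_ne_zero hij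
    have h1 := ih i l (left_ne_zero_of_mul hl)
    have h2 := hM l j (right_ne_zero_of_mul hl)
    omega

theorem pow_eq_zero_of_height {n : Type} [Fintype n] [DecidableEq n] {M : Matrix n n 𝕜}
    {h : n → ℕ} (hM : ∀ i j, M i j ≠ 0 → h i < h j) {k : ℕ} (hk : ∀ j, h j < k) : M ^ k = 0 := by
  ext i j
  by_contra hij
  have h1 := add_le_of_pow_apply_ne_zero hM k i j hij
  have h2 := hk j
  omega

/-- The matrix with ones on the `k`-th superdiagonal. -/
def shiftMatrix (𝕜 : Type) [RCLike 𝕜] (k r : ℕ) : Matrix (Fin r) (Fin r) 𝕜 :=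
  Matrix.of fun i j => if j.val = i.val + k then 1 else 0

theorem shiftMatrix_mul_apply {k r : ℕ} {n : Type} (P : Matrix (Fin r) n 𝕜) (i : Fin r) (j : n) :
    (shiftMatrix 𝕜 k r * P) i j = if h : i.val + k < r then P ⟨i.val + k, h⟩ j else 0 := by
  rw [Matrix.mul_apply]
  split_ifs with h
  · rw [Finset.sum_eq_single ⟨i.val + k, h⟩]
    · simp [shiftMatrix]
    · intro l _ hl
      have : l.val ≠ i.val + k := fun h' => hl (Fin.ext h')
      simp [shiftMatrix, this]
    · exact fun h' => absurd (Finset.mem_univ _) h'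
  · refine Finset.sum_eq_zero fun l _ => ?_
    have : l.val ≠ i.val + k := by omega
    simp [shiftMatrix, this]

theorem shiftMatrix_mulVec {k r : ℕ} (y : Fin r → 𝕜) (i : Fin r) :
    (shiftMatrix 𝕜 k r).mulVec y i = if h : i.val + k < r then y ⟨i.val + k, h⟩ else 0 :=
  shiftMatrix_mul_apply (Matrix.of fun i (_ : Unit) => y i) i ()

theorem exists_shiftMatrix_mulVec_eq {k r : ℕ} {y : Fin r → 𝕜}
    (hy : ∀ i : Fin r, r ≤ i.val + k → y i = 0) : ∃ y', (shiftMatrix 𝕜 k r).mulVec y' = y := by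
  refine ⟨fun i => if h : k ≤ i.val then y ⟨i.val - k, by omega⟩ else 0, ?_⟩
  funext i
  rw [shiftMatrix_mulVec]
  split_ifs with h1 h2
  · exact congrArg y (Fin.ext (by simp))
  · simp at h2
  · exact (hy i (by omega)).symm

/-- The block diagonal matrix with the blocks `[0 1; -1 0]`. -/
def pairRotation (𝕜 : Type) [RCLike 𝕜] (r : ℕ) : Matrix (Fin r) (Fin r) 𝕜 :=
  Matrix.of fun i j => if j.val = i.val + 1 ∧ i.val % 2 = 0 then 1 else
    if i.val = j.val + 1 ∧ j.val % 2 = 0 then -1 else 0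

theorem pairRotation_mul_apply_even {r : ℕ} (hr : Even r) {n : Type} (P : Matrix (Fin r) n 𝕜)
    (i : Fin r) (j : n) (hi : i.val % 2 = 0) :
    (pairRotation 𝕜 r * P) i j = P ⟨i.val + 1, by
      have := Nat.even_iff.1 hr
      omega⟩ j := by
  rw [Matrix.mul_apply, Finset.sum_eq_single ⟨i.val + 1, by
      have := Nat.even_iff.1 hr
      omega⟩]
  · simp [pairRotation, hi]
  · intro l _ hl
    have h1 : l.val ≠ i.val + 1 := fun h' => hl (Fin.ext h')
    have h2 : ¬ (i.val = l.val + 1 ∧ l.val % 2 = 0) := by omega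
    simp [pairRotation, h1, h2]
  · exact fun h' => absurd (Finset.mem_univ _) h'

theorem pairRotation_mul_apply_odd {r : ℕ} {n : Type} (P : Matrix (Fin r) n 𝕜)
    (i : Fin r) (j : n) (hi : i.val % 2 = 1) :
    (pairRotation 𝕜 r * P) i j = - P ⟨i.val - 1, by omega⟩ j := by
  rw [Matrix.mul_apply, Finset.sum_eq_single ⟨i.val - 1, by omega⟩]
  · have h1 : i.val = i.val - 1 + 1 ∧ (i.val - 1) % 2 = 0 := by omega
    have h2 : ¬ (i.val - 1 = i.val + 1 ∧ i.val % 2 = 0) := by omega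
    simp only [pairRotation, Matrix.of_apply]
    rw [if_neg h2, if_pos h1, neg_one_mul]
  · intro l _ hl
    have h1 : ¬ (i.val = l.val + 1 ∧ l.val % 2 = 0) := fun h' => hl (Fin.ext (by simp; omega))
    have h2 : ¬ (l.val = i.val + 1 ∧ i.val % 2 = 0) := by omega
    simp only [pairRotation, Matrix.of_apply]
    rw [if_neg h2, if_neg h1, zero_mul]
  · exact fun h' => absurd (Finset.mem_univ _) h'

theorem pairRotation_mul_self {r : ℕ} (hr : Even r) : pairRotation 𝕜 r * pairRotation 𝕜 r = -1 := by
  ext i j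
  rcases Nat.mod_two_eq_zero_or_one i.val with hi | hi
  · rw [pairRotation_mul_apply_even hr _ _ _ hi]
    simp only [pairRotation, Matrix.of_apply, Matrix.neg_apply, Matrix.one_apply, Fin.ext_iff]
    rw [if_neg (by omega)]
    by_cases h : i.val = j.val
    · rw [if_pos (by omega), if_pos h]
    · rw [if_neg (by omega), if_neg h, neg_zero]
  · rw [pairRotation_mul_apply_odd _ _ _ hi]
    simp only [pairRotation, Matrix.of_apply, Matrix.neg_apply, Matrix.one_apply, Fin.ext_iff]
    by_cases h : i.val = j.val
    · rw [if_pos (by omega), if_pos h]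
    · rw [if_neg (by omega), if_neg (by omega), if_neg h]

theorem pairRotation_mul_shiftMatrix {r : ℕ} (hr : Even r) :
    pairRotation 𝕜 r * shiftMatrix 𝕜 2 r = shiftMatrix 𝕜 2 r * pairRotation 𝕜 r := by
  have hr' := Nat.even_iff.1 hr
  ext i j
  rw [shiftMatrix_mul_apply]
  rcases Nat.mod_two_eq_zero_or_one i.val with hi | hi
  · rw [pairRotation_mul_apply_even hr _ _ _ hi]
    simp only [pairRotation, shiftMatrix, Matrix.of_apply]
    by_cases h : j.val = i.val + 3
    · rw [if_pos (by omega), dif_pos (by omega), if_pos (by omega)]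
    · rw [if_neg (by omega)]
      split_ifs <;> first | rfl | omega
  · rw [pairRotation_mul_apply_odd _ _ _ hi]
    simp only [pairRotation, shiftMatrix, Matrix.of_apply]
    by_cases h : j.val = i.val + 1
    · rw [if_pos (by omega), dif_pos (by omega), if_neg (by omega), if_pos (by omega)]
    · rw [if_neg (by omega), neg_zero]
      split_ifs <;> first | rfl | omega

theorem jordanBlock_eq (r : ℕ) (a : 𝕜) : jordanBlock r a = a • 1 + shiftMatrix 𝕜 1 r := by
  ext i j
  simp only [jordanBlock, shiftMatrix, Matrix.of_apply, Matrix.add_apply, Matrix.smul_apply,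
    Matrix.one_apply, smul_eq_mul]
  by_cases h : i = j
  · subst h
    simp
  · simp [h]

theorem realJordanBlock_eq (r : ℕ) (a b : ℝ) : (realJordanBlock r a b : Matrix _ _ 𝕜) =
    (a : 𝕜) • 1 + ((b : 𝕜) • pairRotation 𝕜 r + shiftMatrix 𝕜 2 r) := by
  have h0 : ∀ i : Fin r, i.val % 2 = 0 → Fin.ofNat 2 i.val = 0 := fun i hi => Fin.ext hi
  have h1 : ∀ i : Fin r, i.val % 2 = 1 → Fin.ofNat 2 i.val = 1 := fun i hi => Fin.ext hi
  ext i j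
  simp only [realJordanBlock, pairRotation, shiftMatrix, Matrix.of_apply, Matrix.add_apply,
    Matrix.smul_apply, Matrix.one_apply, smul_eq_mul, Fin.ext_iff]
  by_cases h : i.val / 2 = j.val / 2
  · rw [if_pos h, if_neg (show ¬ j.val = i.val + 2 by omega)]
    rcases Nat.mod_two_eq_zero_or_one i.val with hi | hi <;>
    rcases Nat.mod_two_eq_zero_or_one j.val with hj | hj
    · rw [h0 i hi, h0 j hj, if_pos (by omega), if_neg (by omega), if_neg (by omega)]
      simp [rotBlock]
    · rw [h0 i hi, h1 j hj, if_neg (by omega), if_pos (by omega)]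
      simp [rotBlock]
    · rw [h1 i hi, h0 j hj, if_neg (by omega), if_neg (by omega), if_pos (by omega)]
      simp [rotBlock]
    · rw [h1 i hi, h1 j hj, if_pos (by omega), if_neg (by omega), if_neg (by omega)]
      simp [rotBlock]
  · rw [if_neg h, if_neg (show ¬ i.val = j.val by omega),
      if_neg (show ¬ (j.val = i.val + 1 ∧ i.val % 2 = 0) by omega),
      if_neg (show ¬ (i.val = j.val + 1 ∧ j.val % 2 = 0) by omega)]
    simp

theorem rev_shiftMatrix (k r : ℕ) (i j : Fin r) :
    shiftMatrix 𝕜 k r j.rev i.rev = shiftMatrix 𝕜 k r i j := by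
  have h : i.rev.val = j.rev.val + k ↔ j.val = i.val + k := by
    simp only [Fin.val_rev]
    omega
  simp only [shiftMatrix, Matrix.of_apply, h]

theorem rev_pairRotation {r : ℕ} (hr : Even r) (i j : Fin r) :
    pairRotation 𝕜 r j.rev i.rev = pairRotation 𝕜 r i j := by
  have hr' := Nat.even_iff.1 hr
  have h1 : (i.rev.val = j.rev.val + 1 ∧ j.rev.val % 2 = 0) ↔ (j.val = i.val + 1 ∧ i.val % 2 = 0) := by
    simp only [Fin.val_rev]
    omega
  have h2 : (j.rev.val = i.rev.val + 1 ∧ i.rev.val % 2 = 0) ↔ (i.val = j.val + 1 ∧ j.val % 2 = 0) := by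
    simp only [Fin.val_rev]
    omega
  simp only [pairRotation, Matrix.of_apply, h1, h2]

theorem rev_one (r : ℕ) (i j : Fin r) :
    (1 : Matrix (Fin r) (Fin r) 𝕜) j.rev i.rev = (1 : Matrix (Fin r) (Fin r) 𝕜) i j := by
  simp only [Matrix.one_apply, Fin.rev_inj, eq_comm]

/-- Cells are symmetric about the antidiagonal. -/
theorem rev_jordanCell {r : ℕ} {z : ℂ} (hr : (RCLike.I : 𝕜) = 0 → z.im ≠ 0 → Even r)
    (i j : Fin r) : jordanCell 𝕜 r z j.rev i.rev = jordanCell 𝕜 r z i j := by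
  unfold jordanCell
  split_ifs with h
  · simp only [realJordanBlock_eq, Matrix.add_apply, Matrix.smul_apply, rev_shiftMatrix, rev_one,
      rev_pairRotation (hr h.1 h.2)]
  · simp only [jordanBlock_eq, Matrix.add_apply, Matrix.smul_apply, rev_shiftMatrix, rev_one]

open Polynomial in
theorem aeval_jordanBlock (r : ℕ) (a : 𝕜) :
    aeval (jordanBlock r a) (X - C a) = shiftMatrix 𝕜 1 r := by
  rw [map_sub, aeval_X, aeval_C, jordanBlock_eq, Algebra.algebraMap_eq_smul_one]
  abel

-- With `R` the rotation and `S` the two-step shift, which commute, `(bR + S)² + b² = S(2bR + S)`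
-- because `R² = -1`. The second factor is a unit when `b ≠ 0`, so the polynomial behaves like `S`.
open Polynomial in
theorem aeval_realJordanBlock {r : ℕ} (hr : Even r) (a b : ℝ) :
    aeval (realJordanBlock r a b : Matrix (Fin r) (Fin r) 𝕜) ((X - C (a : 𝕜)) ^ 2 + C ((b : 𝕜) ^ 2)) =
      shiftMatrix 𝕜 2 r * ((2 * (b : 𝕜)) • pairRotation 𝕜 r + shiftMatrix 𝕜 2 r) := by
  rw [map_add, map_pow, map_sub, aeval_X, aeval_C, aeval_C, realJordanBlock_eq,
    Algebra.algebraMap_eq_smul_one, Algebra.algebraMap_eq_smul_one, add_sub_cancel_left, pow_two,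
    add_mul, mul_add, mul_add, smul_mul_smul_comm, pairRotation_mul_self hr, smul_mul_assoc,
    pairRotation_mul_shiftMatrix hr, mul_smul_comm, mul_add, mul_smul_comm]
  module

/-- The height of an index is the number of its diagonal block, of size `1` or `2` according to the
degree; the polynomial of the cell is strictly upper triangular with respect to these blocks. -/
theorem aeval_cellPoly_apply_ne_zero {r : ℕ} {z : ℂ}
    (hr : (RCLike.I : 𝕜) = 0 → z.im ≠ 0 → Even r) (i j : Fin r)
    (h : Polynomial.aeval (jordanCell 𝕜 r z) (cellPoly 𝕜 z) i j ≠ 0) :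
    i.val / (cellPoly 𝕜 z).natDegree < j.val / (cellPoly 𝕜 z).natDegree := by
  unfold cellPoly jordanCell at *
  split_ifs at * with h1
  · rw [natDegree_X_sub_C_sq_add_C]
    rw [aeval_realJordanBlock (hr h1.1 h1.2), shiftMatrix_mul_apply] at h
    by_contra hlt
    refine h ?_
    split_ifs with h2
    · simp only [Matrix.add_apply, Matrix.smul_apply, pairRotation, shiftMatrix, Matrix.of_apply]
      rw [if_neg (by omega), if_neg (by omega), if_neg (by omega), smul_zero, add_zero]
    · rfl
  · rw [Polynomial.natDegree_X_sub_C, Nat.div_one, Nat.div_one]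
    rw [aeval_jordanBlock] at h
    by_contra hlt
    exact h (if_neg (by omega))

theorem natDegree_cellPoly_dvd {r : ℕ} {z : ℂ}
    (hr : (RCLike.I : 𝕜) = 0 → z.im ≠ 0 → Even r) : (cellPoly 𝕜 z).natDegree ∣ r := by
  unfold cellPoly
  split_ifs with h1
  · rw [natDegree_X_sub_C_sq_add_C]
    exact (hr h1.1 h1.2).two_dvd
  · rw [Polynomial.natDegree_X_sub_C]
    exact one_dvd _

theorem natDegree_cellPoly_pos (z : ℂ) : 0 < (cellPoly 𝕜 z).natDegree :=
  (irreducible_cellPoly z).natDegree_pos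

theorem aeval_cellPoly_pow {r : ℕ} {z : ℂ}
    (hr : (RCLike.I : 𝕜) = 0 → z.im ≠ 0 → Even r) {k : ℕ} (hk : r ≤ (cellPoly 𝕜 z).natDegree * k) :
    Polynomial.aeval (jordanCell 𝕜 r z) (cellPoly 𝕜 z) ^ k = 0 :=
  pow_eq_zero_of_height (h := fun i => i.val / (cellPoly 𝕜 z).natDegree)
    (aeval_cellPoly_apply_ne_zero hr) fun j => by
      rw [Nat.div_lt_iff_lt_mul (natDegree_cellPoly_pos z), mul_comm]
      omega

/-- By the Nakayama argument it suffices to generate modulo the range of `cellPoly`. That range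
consists of the vectors vanishing in the last coordinate, or in the last two for a real cell with
nonreal eigenvalue; in the latter case the last basis vector and its image span a complement, since
their coordinates there are independent for `b ≠ 0`. -/
theorem isCyclicVector_jordanCell {r : ℕ} {z : ℂ}
    (hr : (RCLike.I : 𝕜) = 0 → z.im ≠ 0 → Even r) (h0 : 0 < r) :
    IsCyclicVector (jordanCell 𝕜 r z) (Pi.single ⟨r - 1, Nat.sub_lt h0 one_pos⟩ 1) := by
  intro S hS hlast
  have hnil : IsNilpotent (Polynomial.aeval (jordanCell 𝕜 r z) (cellPoly 𝕜 z)) :=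
    ⟨r, aeval_cellPoly_pow hr (Nat.le_mul_of_pos_left r (natDegree_cellPoly_pos z))⟩
  refine eq_top_of_forall_add hS hnil fun y => ?_
  unfold cellPoly jordanCell at *
  split_ifs at * with h1
  · have hr2 := Nat.even_iff.1 (hr h1.1 h1.2)
    have hb : (z.im : 𝕜) ≠ 0 := by exact_mod_cast h1.2
    rw [aeval_realJordanBlock (hr h1.1 h1.2)]
    set e : Fin r → 𝕜 := Pi.single ⟨r - 1, Nat.sub_lt h0 one_pos⟩ 1 with he
    set f := (realJordanBlock r z.re z.im : Matrix _ _ 𝕜).mulVec e with hf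
    have hf2 : f ⟨r - 2, Nat.sub_lt h0 two_pos⟩ = (z.im : 𝕜) := by
      rw [hf, he, Matrix.mulVec_single_one, Matrix.col_apply, realJordanBlock_eq]
      simp only [pairRotation, shiftMatrix, Matrix.of_apply, Matrix.add_apply,
        Matrix.smul_apply, Matrix.one_apply, smul_eq_mul, Fin.ext_iff]
      rw [if_neg (by omega), if_pos (by omega), if_neg (by omega)]
      simp
    have hU : IsUnit ((2 * (z.im : 𝕜)) • pairRotation 𝕜 r + shiftMatrix 𝕜 2 r) := by
      rw [add_comm]
      refine IsNilpotent.isUnit_add_right_of_commute ?_ ?_ ?_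
      · refine ⟨r, pow_eq_zero_of_height (h := Fin.val) (fun i j hij => ?_) fun j => j.2⟩
        by_contra hlt
        exact hij (if_neg (by omega))
      · refine IsUnit.of_mul_eq_one ((-(2 * (z.im : 𝕜))⁻¹) • pairRotation 𝕜 r) ?_
        rw [smul_mul_smul_comm, pairRotation_mul_self (hr h1.1 h1.2), smul_neg, mul_neg, neg_smul,
          neg_neg, mul_inv_cancel₀ (mul_ne_zero two_ne_zero hb), one_smul]
      · exact Commute.smul_right ((commute_iff_eq _ _).2
          (pairRotation_mul_shiftMatrix (hr h1.1 h1.2)).symm) _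
    -- `β` and `γ` are chosen so that `y - (β f + γ e)` vanishes in the last two coordinates: `e` is
    -- zero at `r - 2`, where `f` equals `z.im`.
    let β := (z.im : 𝕜)⁻¹ * y ⟨r - 2, Nat.sub_lt h0 two_pos⟩
    let γ := y ⟨r - 1, Nat.sub_lt h0 one_pos⟩ - β * f ⟨r - 1, Nat.sub_lt h0 one_pos⟩
    obtain ⟨y', hy'⟩ := exists_shiftMatrix_mulVec_eq (k := 2) (y := y - (β • f + γ • e)) (by
      intro i hi
      rcases (show i.val = r - 2 ∨ i.val = r - 1 by omega) with h | h
      · have : i = ⟨r - 2, Nat.sub_lt h0 two_pos⟩ := Fin.ext h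
        subst this
        have hne : (⟨r - 2, Nat.sub_lt h0 two_pos⟩ : Fin r) ≠ ⟨r - 1, Nat.sub_lt h0 one_pos⟩ := fun h' => by
          have := Fin.ext_iff.1 h'
          simp at this
          omega
        simp only [Pi.sub_apply, Pi.add_apply, Pi.smul_apply, smul_eq_mul, hf2, he,
          Pi.single_eq_of_ne hne, β]
        field_simp
        ring
      · have : i = ⟨r - 1, Nat.sub_lt h0 one_pos⟩ := Fin.ext h
        subst this
        simp only [Pi.sub_apply, Pi.add_apply, Pi.smul_apply, smul_eq_mul, he,
          Pi.single_eq_same, γ]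
        ring)
    obtain ⟨V, hV⟩ := hU.exists_right_inv
    refine ⟨β • f + γ • e, S.add_mem (S.smul_mem _ (hS _ hlast)) (S.smul_mem _ hlast),
      V.mulVec y', ?_⟩
    rw [Matrix.mulVec_mulVec, Matrix.mul_assoc, hV, Matrix.mul_one, hy']
    abel
  · rw [aeval_jordanBlock]
    obtain ⟨y', hy'⟩ := exists_shiftMatrix_mulVec_eq (k := 1)
      (y := y - y ⟨r - 1, Nat.sub_lt h0 one_pos⟩ • Pi.single ⟨r - 1, Nat.sub_lt h0 one_pos⟩ 1) (by
      intro i hi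
      have : i = ⟨r - 1, Nat.sub_lt h0 one_pos⟩ := Fin.ext (by simp; omega)
      subst this
      simp)
    refine ⟨_, S.smul_mem (y ⟨r - 1, Nat.sub_lt h0 one_pos⟩) hlast, y', ?_⟩
    rw [hy']
    abel

/-- Reversing the order of the basis turns the cell into its transpose and the last basis vector
into the first. -/
theorem isCyclicVector_transpose_jordanCell {r : ℕ} {z : ℂ}
    (hr : (RCLike.I : 𝕜) = 0 → z.im ≠ 0 → Even r) (h0 : 0 < r) :
    IsCyclicVector (jordanCell 𝕜 r z).transpose (Pi.single ⟨0, h0⟩ 1) := by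
  intro S hS hfirst
  let R : (Fin r → 𝕜) →ₗ[𝕜] (Fin r → 𝕜) := LinearMap.funLeft 𝕜 𝕜 Fin.rev
  have hR : ∀ y i, R y i = y i.rev := fun y i => rfl
  have h1 : S.comap R = ⊤ := by
    refine isCyclicVector_jordanCell hr h0 _ (fun u hu => ?_) ?_
    · have h2 : R ((jordanCell 𝕜 r z).mulVec u) = (jordanCell 𝕜 r z).transpose.mulVec (R u) := by
        funext i
        rw [hR]
        simp only [Matrix.mulVec, dotProduct, Matrix.transpose_apply, hR]
        rw [← Equiv.sum_comp Fin.revPerm]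
        exact Finset.sum_congr rfl fun k _ => by rw [Fin.revPerm_apply, rev_jordanCell hr]
      rw [Submodule.mem_comap, h2]
      exact hS _ hu
    · have h2 : R (Pi.single ⟨r - 1, Nat.sub_lt h0 one_pos⟩ 1) = Pi.single ⟨0, h0⟩ 1 := by
        funext i
        rw [hR]
        simp only [Pi.single_apply, Fin.ext_iff, Fin.val_rev]
        congr 1
        simp only [eq_iff_iff]
        omega
      rw [Submodule.mem_comap, h2]
      exact hfirst
  refine Submodule.eq_top_iff'.2 fun y => ?_
  have h2 : R y ∈ S.comap R := h1 ▸ Submodule.mem_top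
  have h3 : R (R y) = y := by
    funext i
    rw [hR, hR, Fin.rev_rev]
  rw [Submodule.mem_comap, h3] at h2
  exact h2

end Shifts

/-! ### Blocks between two cells of `C`. -/

section CellBlocks

variable {𝕜 : Type} [RCLike 𝕜] {z : ℂ} {p q : ℕ}

/-- The power of `cellPoly` of degree `q` annihilates the larger cell, and all the more the smaller
one with the same eigenvalue. -/
theorem jordanCell_column_annihilator (hp : (RCLike.I : 𝕜) = 0 → z.im ≠ 0 → Even p)
    (hq : (RCLike.I : 𝕜) = 0 → z.im ≠ 0 → Even q) (hpq : p ≤ q) :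
    ∃ χ : Polynomial 𝕜, χ.Monic ∧ χ.natDegree = Fintype.card (Fin q) ∧
      Polynomial.aeval (jordanCell 𝕜 q z) χ = 0 ∧ Polynomial.aeval (jordanCell 𝕜 p z) χ = 0 := by
  obtain ⟨k, hk⟩ := natDegree_cellPoly_dvd hq
  refine ⟨cellPoly 𝕜 z ^ k, (monic_cellPoly z).pow k, ?_, ?_, ?_⟩
  · rw [(monic_cellPoly z).natDegree_pow, Fintype.card_fin, mul_comm, ← hk]
  · rw [map_pow]
    exact aeval_cellPoly_pow hq hk.le
  · rw [map_pow]
    exact aeval_cellPoly_pow hp (hpq.trans hk.le)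

/-- Transposition about the antidiagonal. -/
def antitranspose (X : Matrix (Fin p) (Fin q) 𝕜) : Matrix (Fin q) (Fin p) 𝕜 :=
  Matrix.of fun i j => X j.rev i.rev

/-- Reflection in the antidiagonal fixes the cells and reverses products, so it exchanges the two
sizes and changes the sign of the commutator. It also interchanges first column and last row, which
reduces the case `p > q` to `p ≤ q`. -/
theorem antitranspose_commutator (hp : (RCLike.I : 𝕜) = 0 → z.im ≠ 0 → Even p)
    (hq : (RCLike.I : 𝕜) = 0 → z.im ≠ 0 → Even q) (X : Matrix (Fin p) (Fin q) 𝕜)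
    (i : Fin q) (j : Fin p) :
    (antitranspose X * jordanCell 𝕜 p z - jordanCell 𝕜 q z * antitranspose X) i j =
      -(X * jordanCell 𝕜 q z - jordanCell 𝕜 p z * X) j.rev i.rev := by
  rw [Matrix.sub_apply, Matrix.sub_apply, neg_sub, Matrix.mul_apply, Matrix.mul_apply,
    Matrix.mul_apply, Matrix.mul_apply]
  congr 1
  · rw [← Equiv.sum_comp Fin.revPerm]
    refine Finset.sum_congr rfl fun k _ => ?_
    rw [Fin.revPerm_apply, ← rev_jordanCell hp]
    simp only [antitranspose, Matrix.of_apply, Fin.rev_rev]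
    exact mul_comm _ _
  · rw [← Equiv.sum_comp Fin.revPerm]
    refine Finset.sum_congr rfl fun k _ => ?_
    rw [Fin.revPerm_apply, ← rev_jordanCell hq]
    simp only [antitranspose, Matrix.of_apply, Fin.rev_rev]
    exact mul_comm _ _

theorem not_isStarH_of_le (h : p ≤ q) (hq : 0 < q) {i : Fin p} {j : Fin q} (hj : j ≠ ⟨0, hq⟩) :
    ¬ IsStarH p q i j := by
  rintro (⟨-, h0⟩ | ⟨h', -⟩)
  · exact hj (Fin.ext h0)
  · omega

theorem intertwining_of_supported_stars (hp : (RCLike.I : 𝕜) = 0 → z.im ≠ 0 → Even p)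
    (hq : (RCLike.I : 𝕜) = 0 → z.im ≠ 0 → Even q) (hp0 : 0 < p) (hq0 : 0 < q)
    {X : Matrix (Fin p) (Fin q) 𝕜}
    (hX : ∀ i j, ¬ IsStarH p q i j → (X * jordanCell 𝕜 q z - jordanCell 𝕜 p z * X) i j = 0) :
    X * jordanCell 𝕜 q z - jordanCell 𝕜 p z * X = 0 := by
  rcases le_or_gt p q with h | h
  · obtain ⟨χ, h1, h2, h3, h4⟩ := jordanCell_column_annihilator hp hq h
    exact sub_eq_zero.2 (intertwining_of_supported_column
      (isCyclicVector_transpose_jordanCell hq hq0) h1 h2 h3 h4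
      fun i j hj => hX i j (not_isStarH_of_le h hq0 hj))
  · obtain ⟨χ, h1, h2, h3, h4⟩ := jordanCell_column_annihilator hq hp h.le
    have h5 := sub_eq_zero.2 (intertwining_of_supported_column (X := antitranspose X)
      (isCyclicVector_transpose_jordanCell hp hp0) h1 h2 h3 h4 fun i j hj => by
        rw [antitranspose_commutator hp hq, hX _ _ ?_, neg_zero]
        rintro (⟨h', -⟩ | ⟨-, h'⟩)
        · omega
        · rw [Fin.val_rev] at h'
          exact hj (Fin.ext (by simp; omega)))
    ext i j
    have h6 := antitranspose_commutator hp hq X j.rev i.rev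
    rw [h5, Fin.rev_rev, Fin.rev_rev] at h6
    exact neg_eq_zero.1 h6.symm

theorem exists_sylvester_modulo_stars (hp : (RCLike.I : 𝕜) = 0 → z.im ≠ 0 → Even p)
    (hq : (RCLike.I : 𝕜) = 0 → z.im ≠ 0 → Even q) (hp0 : 0 < p) (hq0 : 0 < q)
    (E : Matrix (Fin p) (Fin q) 𝕜) : ∃ X : Matrix (Fin p) (Fin q) 𝕜, ∀ i j, ¬ IsStarH p q i j →
      E i j = (X * jordanCell 𝕜 q z - jordanCell 𝕜 p z * X) i j := by
  rcases le_or_gt p q with h | h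
  · obtain ⟨χ, h1, h2, h3, h4⟩ := jordanCell_column_annihilator hp hq h
    obtain ⟨X, hX⟩ := exists_sylvester_modulo_column
      (isCyclicVector_transpose_jordanCell hq hq0) h1 h2 h3 h4 (isCyclicVector_jordanCell hq hq0) E
    exact ⟨X, fun i j hij => hX i j fun hj => hij (Or.inl ⟨h, by rw [hj]⟩)⟩
  · obtain ⟨χ, h1, h2, h3, h4⟩ := jordanCell_column_annihilator hq hp h.le
    obtain ⟨X, hX⟩ := exists_sylvester_modulo_column
      (isCyclicVector_transpose_jordanCell hp hp0) h1 h2 h3 h4 (isCyclicVector_jordanCell hp hp0)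
      -- The sign compensates the one produced by reflecting the commutator.
      (antitranspose (-E))
    refine ⟨antitranspose X, fun i j hij => ?_⟩
    have h5 := antitranspose_commutator hq hp X i j
    rw [h5, ← hX]
    · simp [antitranspose]
    · intro hi
      refine hij (Or.inr ⟨h, ?_⟩)
      have := Fin.ext_iff.1 hi
      rw [Fin.val_rev] at this
      simp at this
      omega

theorem eq_zero_of_intertwining_jordanCell {w : ℂ}
    (hp : (RCLike.I : 𝕜) = 0 → z.im ≠ 0 → Even p)
    (hq : (RCLike.I : 𝕜) = 0 → w.im ≠ 0 → Even q)
    (hz : (RCLike.I : 𝕜) = 0 → 0 ≤ z.im) (hw : (RCLike.I : 𝕜) = 0 → 0 ≤ w.im) (hzw : z ≠ w)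
    {X : Matrix (Fin p) (Fin q) 𝕜} (hX : X * jordanCell 𝕜 q w = jordanCell 𝕜 p z * X) : X = 0 := by
  refine eq_zero_of_intertwining_of_isCoprime hX
    ((isCoprime_cellPoly hz hw hzw).pow (m := p) (n := q)) ?_ ?_
  · rw [map_pow]
    exact aeval_cellPoly_pow hp (Nat.le_mul_of_pos_left p (natDegree_cellPoly_pos z))
  · rw [map_pow]
    exact aeval_cellPoly_pow hq (Nat.le_mul_of_pos_left q (natDegree_cellPoly_pos w))

end CellBlocks

/-! ### Commutators with block diagonal matrices, block by block. -/

section BlockDiagonal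

variable {𝕜 : Type} [RCLike 𝕜] {K : Type} [Fintype K] [DecidableEq K]

theorem mul_blockDiagonal'_apply {m : Type} {a b : K → Type} [∀ k, Fintype (a k)]
    (X : Matrix m (Σ k, a k) 𝕜) (D : ∀ k, Matrix (a k) (b k) 𝕜) (i : m) (l : K) (j : b l) :
    (X * Matrix.blockDiagonal' D) i ⟨l, j⟩ =
      ((Matrix.of fun (_ : Unit) (j : a l) => X i ⟨l, j⟩) * D l) () j := by
  rw [Matrix.mul_apply, Fintype.sum_sigma, Finset.sum_eq_single l]
  · simp only [Matrix.blockDiagonal'_apply_eq]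
    rfl
  · intro k _ hk
    exact Finset.sum_eq_zero fun x _ => by
      rw [Matrix.blockDiagonal'_apply_ne _ _ _ hk, mul_zero]
  · exact fun h => absurd (Finset.mem_univ _) h

theorem blockDiagonal'_mul_apply {m : Type} {a b : K → Type} [∀ k, Fintype (b k)]
    (X : Matrix (Σ k, b k) m 𝕜) (D : ∀ k, Matrix (a k) (b k) 𝕜) (k : K) (i : a k) (j : m) :
    (Matrix.blockDiagonal' D * X) ⟨k, i⟩ j =
      (D k * (Matrix.of fun (i : b k) (_ : Unit) => X ⟨k, i⟩ j)) i () := by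
  rw [Matrix.mul_apply, Fintype.sum_sigma, Finset.sum_eq_single k]
  · simp only [Matrix.blockDiagonal'_apply_eq]
    rfl
  · intro l _ hl
    exact Finset.sum_eq_zero fun x _ => by
      rw [Matrix.blockDiagonal'_apply_ne _ _ _ hl.symm, zero_mul]
  · exact fun h => absurd (Finset.mem_univ _) h

theorem blockDiagonal'_commutator_apply {a : K → Type} [∀ k, Fintype (a k)]
    (X : Matrix (Σ k, a k) (Σ k, a k) 𝕜) (D : ∀ k, Matrix (a k) (a k) 𝕜)
    (k l : K) (i : a k) (j : a l) :
    (X * Matrix.blockDiagonal' D - Matrix.blockDiagonal' D * X) ⟨k, i⟩ ⟨l, j⟩ =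
      ((Matrix.of fun i j => X ⟨k, i⟩ ⟨l, j⟩) * D l -
        D k * (Matrix.of fun i j => X ⟨k, i⟩ ⟨l, j⟩)) i j := by
  rw [Matrix.sub_apply, Matrix.sub_apply, mul_blockDiagonal'_apply, blockDiagonal'_mul_apply]
  rfl

end BlockDiagonal

instance : Fintype loopQuiver.Vert := inferInstanceAs (Fintype Unit)
instance : Fintype loopQuiver.Arrow := inferInstanceAs (Fintype Unit)
instance : Fintype contraQuiver.Vert := inferInstanceAs (Fintype Bool)
instance : Fintype contraQuiver.Arrow := inferInstanceAs (Fintype Bool)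

/-! ### Square matrices under similarity. -/

section Similarity

variable {𝕜 : Type} [RCLike 𝕜] {n κ : Type} [Fintype n] [DecidableEq n]

/-- `IsComplement` for square matrices under similarity. -/
theorem isComplement_loopRep_iff {C : Matrix n n 𝕜} {pos : κ → Place loopQuiver fun _ => n} :
    IsComplement (loopRep C) pos ↔
      (∀ E : Matrix n n 𝕜, ∃ X F : Matrix n n 𝕜,
        (∀ i j, ⟨(), i, j⟩ ∉ Set.range pos → F i j = 0) ∧ E = X * C - C * X + F) ∧
      ∀ X : Matrix n n 𝕜, (∀ i j, ⟨(), i, j⟩ ∉ Set.range pos → (X * C - C * X) i j = 0) →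
        X * C - C * X = 0 := by
  constructor
  · rintro ⟨h1, h2⟩
    refine ⟨fun E => ?_, fun X hX => ?_⟩
    · obtain ⟨X, F, hF, hE⟩ := h1 fun _ => E
      exact ⟨X (), F (), fun i j h => hF ⟨(), i, j⟩ h, congrFun hE ()⟩
    · exact congrFun (h2 (fun _ => X) fun ⟨_, i, j⟩ h => hX i j h) ()
  · rintro ⟨h1, h2⟩
    refine ⟨fun E => ?_, fun X hX => ?_⟩
    · obtain ⟨X, F, hF, hE⟩ := h1 (E ())
      exact ⟨fun _ => X, fun _ => F, fun ⟨_, i, j⟩ h => hF i j h, funext fun _ => hE⟩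
    · exact funext fun _ => h2 (X ()) fun i j h => hX ⟨(), i, j⟩ h

/-- The places of the stars `P` in a square matrix. -/
def loopStarPlace (P : n → n → Prop) (e : Stars P) : Place loopQuiver fun _ => n :=
  ⟨(), e.1⟩

theorem loopStarPlace_injective (P : n → n → Prop) : Function.Injective (loopStarPlace P) := by
  rintro ⟨a, ha⟩ ⟨b, hb⟩ h
  exact Subtype.ext (eq_of_heq (Sigma.mk.inj h).2)

theorem mem_range_loopStarPlace {P : n → n → Prop} {i j : n} :
    (⟨(), i, j⟩ : Place loopQuiver fun _ => n) ∈ Set.range (loopStarPlace P) ↔ P i j := by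
  constructor
  · rintro ⟨⟨⟨a, b⟩, h⟩, he⟩
    have := eq_of_heq (Sigma.mk.inj he).2
    cases this
    exact h
  · exact fun h => ⟨⟨(i, j), h⟩, rfl⟩

theorem starMatrix_apply_star {m : Type} {P : m → n → Prop} (x : Stars P → 𝕜) (e : Stars P) :
    starMatrix P x e.1.1 e.1.2 = x e := by
  simp only [starMatrix, Matrix.of_apply]
  exact dif_pos e.2

theorem starMatrix_apply_of_not {m : Type} {P : m → n → Prop} (x : Stars P → 𝕜) {i : m} {j : n}
    (h : ¬ P i j) : starMatrix P x i j = 0 := by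
  simp only [starMatrix, Matrix.of_apply]
  exact dif_neg h

theorem isCoordinateFamily_loop (C : Matrix n n 𝕜) (P : n → n → Prop) :
    IsCoordinateFamily (loopRep C) (loopStarPlace P) fun x => loopRep (C + starMatrix P x) :=
  fun x => ⟨fun e => congrArg (C e.1.1 e.1.2 + ·) (starMatrix_apply_star x e),
    fun ⟨_, i, j⟩ h => (congrArg (C i j + ·)
      (starMatrix_apply_of_not x fun h' => h (mem_range_loopStarPlace.2 h'))).trans (add_zero _)⟩

end Similarity

/-! ### The explicit complement for `C`. -/

section CanonicalC

variable {𝕜 : Type} [RCLike 𝕜] {g : ℕ} {z : Fin g → ℂ} {T : Fin g → ℕ}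
  {s : ∀ i, Fin (T i) → ℕ}

/-- Commutation with a block diagonal matrix acts on each block separately. Blocks within one
eigenvalue are governed by the star lemmas; between distinct eigenvalues the Sylvester equation is
solvable outright, which is why such blocks carry no stars. -/
theorem isComplement_canonicalC (hz : Function.Injective z) (hs0 : ∀ i j, 0 < s i j)
    (hreal : (RCLike.I : 𝕜) = 0 → ∀ i, 0 ≤ (z i).im ∧ (0 < (z i).im → ∀ j, Even (s i j))) :
    IsComplement (loopRep (canonicalC 𝕜 z T s)) (loopStarPlace (starsC T s)) := by
  have heven : ∀ k : (Σ i, Fin (T i)), (RCLike.I : 𝕜) = 0 → (z k.1).im ≠ 0 → Even (s k.1 k.2) :=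
    fun k hI h => (hreal hI k.1).2 (lt_of_le_of_ne (hreal hI k.1).1 h.symm) k.2
  rw [isComplement_loopRep_iff]
  simp only [mem_range_loopStarPlace]
  constructor
  · intro E
    have hblock : ∀ k l : (Σ i, Fin (T i)), ∃ X : Matrix (Fin (s k.1 k.2)) (Fin (s l.1 l.2)) 𝕜,
        ∀ i j, ¬ (k.1 = l.1 ∧ IsStarH (s k.1 k.2) (s l.1 l.2) i j) → E ⟨k, i⟩ ⟨l, j⟩ =
          (X * jordanCell 𝕜 (s l.1 l.2) (z l.1) - jordanCell 𝕜 (s k.1 k.2) (z k.1) * X) i j := by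
      intro k l
      by_cases hkl : k.1 = l.1
      · obtain ⟨k1, k2⟩ := k
        obtain ⟨l1, l2⟩ := l
        obtain rfl : k1 = l1 := hkl
        obtain ⟨X, hX⟩ := exists_sylvester_modulo_stars (heven ⟨k1, k2⟩) (heven ⟨k1, l2⟩)
          (hs0 k1 k2) (hs0 k1 l2) (Matrix.of fun i j => E ⟨⟨k1, k2⟩, i⟩ ⟨⟨k1, l2⟩, j⟩)
        exact ⟨X, fun i j h => hX i j fun h' => h ⟨rfl, h'⟩⟩
      · obtain ⟨X, hX⟩ := exists_sylvester (M := jordanCell 𝕜 (s k.1 k.2) (z k.1))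
          (N := jordanCell 𝕜 (s l.1 l.2) (z l.1))
          (fun X => eq_zero_of_intertwining_jordanCell (heven k) (heven l)
            (fun hI => (hreal hI k.1).1) (fun hI => (hreal hI l.1).1) (fun h => hkl (hz h)))
          (Matrix.of fun i j => E ⟨k, i⟩ ⟨l, j⟩)
        exact ⟨X, fun i j _ => (congrFun (congrFun hX i) j).symm⟩
    choose X hX using hblock
    let Y : Matrix (CIdx T s) (CIdx T s) 𝕜 := Matrix.of fun a b => X a.1 b.1 a.2 b.2
    refine ⟨Y, E - (Y * canonicalC 𝕜 z T s - canonicalC 𝕜 z T s * Y), ?_, by abel⟩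
    rintro ⟨k, i⟩ ⟨l, j⟩ h
    rw [Matrix.sub_apply, canonicalC, blockDiagonal'_commutator_apply, sub_eq_zero]
    exact hX k l i j h
  · intro X hX
    ext ⟨k, i⟩ ⟨l, j⟩
    by_cases hkl : k.1 = l.1
    · obtain ⟨k1, k2⟩ := k
      obtain ⟨l1, l2⟩ := l
      obtain rfl : k1 = l1 := hkl
      have h1 := intertwining_of_supported_stars (heven ⟨k1, k2⟩) (heven ⟨k1, l2⟩)
        (hs0 k1 k2) (hs0 k1 l2)
        (X := Matrix.of fun i j => X ⟨⟨k1, k2⟩, i⟩ ⟨⟨k1, l2⟩, j⟩) (fun i j h => by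
          have h2 := hX ⟨⟨k1, k2⟩, i⟩ ⟨⟨k1, l2⟩, j⟩ fun h' => h h'.2
          rw [canonicalC, blockDiagonal'_commutator_apply] at h2
          exact h2)
      rw [canonicalC, blockDiagonal'_commutator_apply]
      exact congrFun (congrFun h1 i) j
    · exact hX _ _ fun h => hkl h.1

end CanonicalC

/-! ### Commutators with nilpotent Jordan blocks along diagonals. -/

section ShiftBlocks

variable {𝕜 : Type} [RCLike 𝕜] {p q : ℕ}

theorem mul_shiftMatrix_one_apply {m : Type} (X : Matrix m (Fin q) 𝕜) (i : m) (j : Fin q) :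
    (X * shiftMatrix 𝕜 1 q) i j = if 0 < j.val then X i ⟨j.val - 1, by omega⟩ else 0 := by
  rw [Matrix.mul_apply]
  split_ifs with h
  · rw [Finset.sum_eq_single ⟨j.val - 1, by omega⟩]
    · have h1 : j.val = j.val - 1 + 1 := by omega
      simp only [shiftMatrix, Matrix.of_apply]
      rw [if_pos h1, mul_one]
    · intro l _ hl
      have h1 : ¬ j.val = l.val + 1 := fun h' => hl (Fin.ext (by simp; omega))
      simp only [shiftMatrix, Matrix.of_apply]
      rw [if_neg h1, mul_zero]
    · exact fun h' => absurd (Finset.mem_univ _) h'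
  · refine Finset.sum_eq_zero fun l _ => ?_
    simp only [shiftMatrix, Matrix.of_apply]
    rw [if_neg (by omega), mul_zero]

/-- The commutator with nilpotent Jordan blocks is determined along diagonals. -/
theorem shift_commutator_apply (X : Matrix (Fin p) (Fin q) 𝕜) (i : Fin p) (j : Fin q) :
    (X * shiftMatrix 𝕜 1 q - shiftMatrix 𝕜 1 p * X) i j =
      (if 0 < j.val then X i ⟨j.val - 1, by omega⟩ else 0) -
        if h : i.val + 1 < p then X ⟨i.val + 1, h⟩ j else 0 := by
  rw [Matrix.sub_apply, mul_shiftMatrix_one_apply, shiftMatrix_mul_apply]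

/-- If every diagonal from the first column to the last row contains a place of `St`, then the
commutator equation with nilpotent Jordan blocks is solvable outside `St`. -/
theorem exists_shift_commutator {St : Fin p → Fin q → Prop}
    (hSt : ∀ (a : Fin p) (b : Fin q), b.val ≤ a.val → p + b.val ≤ q + a.val →
      ∃ a' b', St a' b' ∧ a.val + b'.val = a'.val + b.val) (E : Matrix (Fin p) (Fin q) 𝕜) :
    ∃ X : Matrix (Fin p) (Fin q) 𝕜, ∀ i j, ¬ St i j →
      E i j = (X * shiftMatrix 𝕜 1 q - shiftMatrix 𝕜 1 p * X) i j := by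
  -- `K` is the sum of the space of commutators and the space of matrices supported on `St`; it is
  -- shown to contain every matrix unit.
  let K : Submodule 𝕜 (Matrix (Fin p) (Fin q) 𝕜) := {
    carrier := {E | ∃ X : Matrix (Fin p) (Fin q) 𝕜, ∀ i j, ¬ St i j →
      E i j = (X * shiftMatrix 𝕜 1 q - shiftMatrix 𝕜 1 p * X) i j}
    add_mem' := by
      rintro a b ⟨X, hX⟩ ⟨Y, hY⟩
      refine ⟨X + Y, fun i j h => ?_⟩
      rw [Matrix.add_apply, hX i j h, hY i j h, ← Matrix.add_apply, Matrix.add_mul, Matrix.mul_add]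
      refine congrFun (congrFun ?_ i) j
      abel
    zero_mem' := ⟨0, fun i j _ => by simp⟩
    smul_mem' := by
      rintro c a ⟨X, hX⟩
      refine ⟨c • X, fun i j h => ?_⟩
      rw [Matrix.smul_apply, hX i j h, ← Matrix.smul_apply, Matrix.smul_mul, Matrix.mul_smul,
        smul_sub] }
  have hcomm : ∀ X : Matrix (Fin p) (Fin q) 𝕜,
      X * shiftMatrix 𝕜 1 q - shiftMatrix 𝕜 1 p * X ∈ K := fun X => ⟨X, fun i j _ => rfl⟩
  let P : ℕ → ℕ → Prop := fun a b => ∀ (ha : a < p) (hb : b < q),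
    Matrix.single ⟨a, ha⟩ ⟨b, hb⟩ (1 : 𝕜) ∈ K
  -- The commutator of a matrix unit is its right neighbour minus its upper neighbour. These two lie
  -- consecutively on one diagonal, so membership in `K` propagates along diagonals.
  have hsingle : ∀ (i : Fin p) (j : Fin q),
      Matrix.single i j (1 : 𝕜) * shiftMatrix 𝕜 1 q - shiftMatrix 𝕜 1 p * Matrix.single i j (1 : 𝕜) =
      (if h : j.val + 1 < q then Matrix.single i ⟨j.val + 1, h⟩ 1 else 0) -
        if 0 < i.val then Matrix.single ⟨i.val - 1, by omega⟩ j 1 else 0 := by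
    intro i j
    ext a b
    rw [shift_commutator_apply, Matrix.sub_apply]
    congr 1
    · split_ifs with h1 h2 h2
      · simp only [Matrix.single_apply, Fin.ext_iff]
        congr 1
        simp only [eq_iff_iff]
        omega
      · simp only [Matrix.single_apply, Matrix.zero_apply, Fin.ext_iff]
        exact if_neg (by omega)
      · simp only [Matrix.single_apply, Fin.ext_iff]
        exact (if_neg (by omega)).symm
      · rfl
    · split_ifs with h1 h2 h2
      · simp only [Matrix.single_apply, Fin.ext_iff]
        congr 1
        simp only [eq_iff_iff]
        omega
      · simp only [Matrix.single_apply, Matrix.zero_apply, Fin.ext_iff]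
        exact if_neg (by omega)
      · simp only [Matrix.single_apply, Fin.ext_iff]
        exact (if_neg (by omega)).symm
      · rfl
  have hstep : ∀ a b, a + 1 < p → b + 1 < q → (P a b ↔ P (a + 1) (b + 1)) := by
    intro a b ha hb
    have h1 := hcomm (Matrix.single ⟨a + 1, ha⟩ ⟨b, by omega⟩ 1)
    rw [hsingle, dif_pos hb, if_pos (Nat.succ_pos a)] at h1
    constructor
    · intro h _ _
      simpa using K.add_mem h1 (h (by omega) (by omega))
    · intro h _ _
      simpa using K.sub_mem (h ha hb) h1
  have hdiag : ∀ t a b, a + t < p → b + t < q → (P a b ↔ P (a + t) (b + t)) := by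
    intro t
    induction t with
    | zero => exact fun a b _ _ => Iff.rfl
    | succ t ih =>
      intro a b ha hb
      rw [ih a b (by omega) (by omega), hstep (a + t) (b + t) (by omega) (by omega)]
      rfl
  have hall : ∀ a b, P a b := by
    intro a b ha hb
    by_cases h1 : b ≤ a
    · by_cases h2 : p + b ≤ q + a
      · obtain ⟨a', b', hs, hd⟩ := hSt ⟨a, ha⟩ ⟨b, hb⟩ h1 h2
        have hd : a + b'.val = a'.val + b := hd
        have hP : P a'.val b'.val := fun _ _ => ⟨0, fun i j hij => by
          rw [Matrix.single_apply, if_neg]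
          · simp
          · rintro ⟨rfl, rfl⟩
            exact hij hs⟩
        rcases le_total a a'.val with hle | hle
        · have h3 := hdiag (a'.val - a) a b (by omega) (by omega)
          rw [show a + (a'.val - a) = a'.val by omega, show b + (a'.val - a) = b'.val by omega] at h3
          exact h3.2 hP ha hb
        · have h3 := hdiag (a - a'.val) a'.val b'.val (by omega) (by omega)
          rw [show a'.val + (a - a'.val) = a by omega,
            show b'.val + (a - a'.val) = b by omega] at h3
          exact h3.1 hP ha hb
      -- This diagonal meets the last column above the last row. The unit just below that meeting
      -- point has no right neighbour, so its commutator is a single unit of the diagonal.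
      · have h3 := hdiag (q - 1 - b) a b (by omega) (by omega)
        refine h3.2 (fun ha' hb' => ?_) ha hb
        have h4 := hcomm (Matrix.single ⟨a + (q - 1 - b) + 1, by omega⟩ ⟨b + (q - 1 - b), hb'⟩ 1)
        rw [hsingle, dif_neg (show ¬ b + (q - 1 - b) + 1 < q by omega),
          if_pos (Nat.succ_pos _), zero_sub] at h4
        exact neg_mem_iff.1 h4
    -- This diagonal starts in the top row to the right of the first column. The unit to the left of
    -- its start has no upper neighbour, so its commutator is the starting unit.
    · have h3 := hdiag a 0 (b - a) (by omega) (by omega)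
      rw [zero_add, Nat.sub_add_cancel (by omega)] at h3
      refine h3.1 (fun ha' hb' => ?_) ha hb
      have h4 := hcomm (Matrix.single ⟨0, ha'⟩ ⟨b - a - 1, by omega⟩ 1)
      rw [hsingle, dif_pos (show b - a - 1 + 1 < q by omega), if_neg (lt_irrefl 0), sub_zero] at h4
      rw [show (⟨b - a, hb'⟩ : Fin q) = ⟨b - a - 1 + 1, by omega⟩ from
        Fin.ext (show b - a = b - a - 1 + 1 by omega)]
      exact h4
  have hE : E ∈ K := by
    rw [Matrix.matrix_eq_sum_single E]
    refine K.sum_mem fun i _ => K.sum_mem fun j _ => ?_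
    have := K.smul_mem (E i j) (hall i.val j.val i.2 j.2)
    rwa [Matrix.smul_single, smul_eq_mul, mul_one] at this
  exact hE

/-- If the places of `St` are on pairwise distinct diagonals from the first column to the last
row, then no nonzero commutator with nilpotent Jordan blocks is supported on `St`. -/
theorem shift_commutator_eq_zero {St : Fin p → Fin q → Prop}
    (hSt : ∀ a b, St a b → b.val ≤ a.val ∧ p + b.val ≤ q + a.val)
    (huniq : ∀ a b a' b', St a b → St a' b' → a.val + b'.val = a'.val + b.val → b.val = b'.val)
    {X : Matrix (Fin p) (Fin q) 𝕜}
    (hX : ∀ i j, ¬ St i j → (X * shiftMatrix 𝕜 1 q - shiftMatrix 𝕜 1 p * X) i j = 0) :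
    X * shiftMatrix 𝕜 1 q - shiftMatrix 𝕜 1 p * X = 0 := by
  ext a b
  by_cases hab : St a b
  swap
  · exact hX a b hab
  obtain ⟨h1, h2⟩ := hSt a b hab
  -- On the diagonal of `(a, b)` the commutator vanishes except possibly there, so the entries of
  -- `X` entering it agree from step to step. They are zero at both ends, the first column and the
  -- last row; propagation from both sides makes the two terms at `(a, b)` vanish.
  have hoff : ∀ (a' : Fin p) (b' : Fin q), a.val + b'.val = a'.val + b.val → b'.val ≠ b.val →
      (if 0 < b'.val then X a' ⟨b'.val - 1, by omega⟩ else 0) =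
        if h : a'.val + 1 < p then X ⟨a'.val + 1, h⟩ b' else 0 := by
    intro a' b' hd hne
    rw [← sub_eq_zero, ← shift_commutator_apply]
    exact hX a' b' fun h => hne (huniq a b a' b' hab h hd).symm
  have hleft : ∀ t, ∀ (ht : t < b.val), X ⟨a.val - b.val + t + 1, by omega⟩ ⟨t, by omega⟩ = 0 := by
    intro t
    induction t with
    | zero =>
      intro ht
      have := hoff ⟨a.val - b.val, by omega⟩ ⟨0, by omega⟩ (by simp; omega) (by simp; omega)
      rw [if_neg (lt_irrefl 0), dif_pos (show a.val - b.val + 1 < p by omega)] at this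
      exact this.symm
    | succ t ih =>
      intro ht
      have := hoff ⟨a.val - b.val + (t + 1), by omega⟩ ⟨t + 1, by omega⟩ (by simp; omega)
        (by simp; omega)
      rw [if_pos (Nat.succ_pos t), dif_pos (show a.val - b.val + (t + 1) + 1 < p by omega)] at this
      rw [← this]
      exact ih (by omega)
  have hright : ∀ t, ∀ (ht : a.val + 1 + t < p),
      X ⟨p - 1 - t, by omega⟩ ⟨p - 1 - t + b.val - a.val - 1, by omega⟩ = 0 := by
    intro t
    induction t with
    | zero =>
      intro ht
      have := hoff ⟨p - 1, by omega⟩ ⟨p - 1 + b.val - a.val, by omega⟩ (by simp; omega)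
        (by simp; omega)
      rw [if_pos (show 0 < p - 1 + b.val - a.val by omega),
        dif_neg (show ¬ p - 1 + 1 < p by omega)] at this
      exact this
    | succ t ih =>
      intro ht
      have := hoff ⟨p - 1 - (t + 1), by omega⟩ ⟨p - 1 - (t + 1) + b.val - a.val, by omega⟩
        (by simp; omega) (by simp; omega)
      rw [if_pos (show 0 < p - 1 - (t + 1) + b.val - a.val by omega),
        dif_pos (show p - 1 - (t + 1) + 1 < p by omega)] at this
      rw [this, ← ih (by omega)]
      congr 1 <;> exact Fin.ext (by simp; omega)
  rw [shift_commutator_apply]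
  have e1 : (if 0 < b.val then X a ⟨b.val - 1, by omega⟩ else 0) = 0 := by
    split_ifs with hb
    · rw [← hleft (b.val - 1) (by omega)]
      congr 1
      exact Fin.ext (by simp; omega)
    · rfl
  have e2 : (if h : a.val + 1 < p then X ⟨a.val + 1, h⟩ b else 0) = 0 := by
    split_ifs with ha
    · rw [← hright (p - 2 - a.val) (by omega)]
      congr 1 <;> exact Fin.ext (by simp; omega)
    · rfl
  rw [e1, e2, sub_zero]
  rfl

end ShiftBlocks

/-! ### The nilpotent part as a direct sum of alternating chains. -/

section Strings

variable {t1 t2 t3 t4 : ℕ}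
  (r1 : Fin t1 → ℕ) (r2 : Fin t2 → ℕ) (r3 : Fin t3 → ℕ) (r4 : Fin t4 → ℕ)

/-- `0` if the chain of basis vectors of the cell ends in a row index of the first matrix, and `1`
if it ends in a column index. -/
def cellParity : Cell t1 t2 t3 t4 → ℕ
  | .c1 _ => 0
  | .c2 _ => 1
  | .c3 _ => 0
  | .c4 _ => 1

/-- The length of the chain of basis vectors of a cell. -/
abbrev cellLen (k : Cell t1 t2 t3 t4) : ℕ := cellV r1 r2 r3 r4 k + cellU r1 r2 r3 r4 k

/-- A chain alternates between row and column indices, so the two numbers agree or the kind standing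
at its end has one more. The truncated subtraction is that of `cellV` and `cellU`. -/
theorem cellParity_cases (k : Cell t1 t2 t3 t4) :
    (cellParity k = 0 ∧ (cellV r1 r2 r3 r4 k = cellU r1 r2 r3 r4 k ∨
      cellV r1 r2 r3 r4 k - 1 = cellU r1 r2 r3 r4 k)) ∨
    (cellParity k = 1 ∧ (cellU r1 r2 r3 r4 k = cellV r1 r2 r3 r4 k ∨
      cellU r1 r2 r3 r4 k - 1 = cellV r1 r2 r3 r4 k)) := by
  cases k <;> simp [cellParity, cellV, cellU]

theorem chainPlace_lt_of_row (k : Cell t1 t2 t3 t4) (i : Fin (cellV r1 r2 r3 r4 k)) :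
    2 * i.val + cellParity k < cellLen r1 r2 r3 r4 k := by
  have := cellParity_cases r1 r2 r3 r4 k
  have := i.2
  simp only [cellLen]
  omega

theorem chainPlace_lt_of_column (k : Cell t1 t2 t3 t4) (i : Fin (cellU r1 r2 r3 r4 k)) :
    2 * i.val + (1 - cellParity k) < cellLen r1 r2 r3 r4 k := by
  have := cellParity_cases r1 r2 r3 r4 k
  have := i.2
  simp only [cellLen]
  omega

/-- The place of a basis vector in the chain of its cell. -/
def chainPlace : VIdx r1 r2 r3 r4 ⊕ UIdx r1 r2 r3 r4 →
    Σ k : Cell t1 t2 t3 t4, Fin (cellLen r1 r2 r3 r4 k)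
  | .inl ⟨k, i⟩ => ⟨k, ⟨2 * i.val + cellParity k, chainPlace_lt_of_row r1 r2 r3 r4 k i⟩⟩
  | .inr ⟨k, i⟩ => ⟨k, ⟨2 * i.val + (1 - cellParity k), chainPlace_lt_of_column r1 r2 r3 r4 k i⟩⟩

theorem chainPlace_bijective : Function.Bijective (chainPlace r1 r2 r3 r4) := by
  have hmk : ∀ {k l : Cell t1 t2 t3 t4} {a : Fin (cellLen r1 r2 r3 r4 k)}
      {b : Fin (cellLen r1 r2 r3 r4 l)}, (⟨k, a⟩ : Σ k, Fin (cellLen r1 r2 r3 r4 k)) = ⟨l, b⟩ →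
      k = l ∧ a.val = b.val := by
    intro k l a b h
    obtain ⟨rfl, h2⟩ := Sigma.mk.inj h
    exact ⟨rfl, by rw [eq_of_heq h2]⟩
  constructor
  · rintro (⟨k, i⟩ | ⟨k, i⟩) (⟨l, j⟩ | ⟨l, j⟩) h <;> obtain ⟨rfl, h2⟩ := hmk h <;>
      have := cellParity_cases r1 r2 r3 r4 k <;> simp only at h2
    · rw [show i = j from Fin.ext (by omega)]
    · omega
    · omega
    · rw [show i = j from Fin.ext (by omega)]
  · rintro ⟨k, a, ha⟩
    have hk := cellParity_cases r1 r2 r3 r4 k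
    simp only [cellLen] at ha
    -- The places whose parity agrees with the end of the chain are row indices exactly when
    -- `cellParity` is `0`; in both kinds of chain this sum is even at row indices.
    by_cases h : (a + cellParity k) % 2 = 0
    · refine ⟨.inl ⟨k, ⟨(a - cellParity k) / 2, by omega⟩⟩, ?_⟩
      refine congrArg (Sigma.mk k) (Fin.ext ?_)
      change 2 * ((a - cellParity k) / 2) + cellParity k = a
      omega
    · refine ⟨.inr ⟨k, ⟨(a - (1 - cellParity k)) / 2, by omega⟩⟩, ?_⟩
      refine congrArg (Sigma.mk k) (Fin.ext ?_)
      change 2 * ((a - (1 - cellParity k)) / 2) + (1 - cellParity k) = a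
      omega

/-- The basis vectors of all cells as places in chains. -/
noncomputable def chainEquiv : VIdx r1 r2 r3 r4 ⊕ UIdx r1 r2 r3 r4 ≃
    Σ k : Cell t1 t2 t3 t4, Fin (cellLen r1 r2 r3 r4 k) :=
  Equiv.ofBijective _ (chainPlace_bijective r1 r2 r3 r4)

theorem chainEquiv_inl (k : Cell t1 t2 t3 t4) (i : Fin (cellV r1 r2 r3 r4 k)) :
    chainEquiv r1 r2 r3 r4 (.inl ⟨k, i⟩) =
      ⟨k, ⟨2 * i.val + cellParity k, chainPlace_lt_of_row r1 r2 r3 r4 k i⟩⟩ := rfl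

theorem chainEquiv_inr (k : Cell t1 t2 t3 t4) (i : Fin (cellU r1 r2 r3 r4 k)) :
    chainEquiv r1 r2 r3 r4 (.inr ⟨k, i⟩) =
      ⟨k, ⟨2 * i.val + (1 - cellParity k), chainPlace_lt_of_column r1 r2 r3 r4 k i⟩⟩ := rfl

variable (𝕜 : Type) [RCLike 𝕜]

theorem one_fin_apply {r : ℕ} (i j : Fin r) :
    (1 : Matrix (Fin r) (Fin r) 𝕜) i j = if j.val = i.val then 1 else 0 := by
  rw [Matrix.one_apply]
  exact if_congr (by rw [Fin.ext_iff, eq_comm]) rfl rfl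

theorem jordanBlock_zero_apply {r : ℕ} (i j : Fin r) :
    jordanBlock r (0 : 𝕜) i j = if j.val = i.val + 1 then 1 else 0 := by
  rw [jordanBlock_eq, zero_smul, zero_add]
  rfl

theorem cellA_apply (k : Cell t1 t2 t3 t4) (i : Fin (cellV r1 r2 r3 r4 k))
    (j : Fin (cellU r1 r2 r3 r4 k)) : cellA r1 r2 r3 r4 𝕜 k i j =
      if 2 * j.val + (1 - cellParity k) = 2 * i.val + cellParity k + 1 then 1 else 0 := by
  cases k with
  | c1 k =>
    refine (one_fin_apply 𝕜 (r := r1 k) i j).trans (if_congr ?_ rfl rfl)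
    simp only [cellParity]
    omega
  | c2 k =>
    refine (jordanBlock_zero_apply 𝕜 (r := r2 k) i j).trans (if_congr ?_ rfl rfl)
    simp only [cellParity]
    omega
  | c3 k =>
    change (if i.val = j.val then 1 else 0) = _
    refine if_congr ?_ rfl rfl
    simp only [cellParity]
    omega
  | c4 k =>
    change (if j.val = i.val + 1 then 1 else 0) = _
    refine if_congr ?_ rfl rfl
    simp only [cellParity]
    omega

theorem cellB_apply (k : Cell t1 t2 t3 t4) (i : Fin (cellU r1 r2 r3 r4 k))
    (j : Fin (cellV r1 r2 r3 r4 k)) : cellB r1 r2 r3 r4 𝕜 k i j =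
      if 2 * j.val + cellParity k = 2 * i.val + (1 - cellParity k) + 1 then 1 else 0 := by
  cases k with
  | c1 k =>
    refine (jordanBlock_zero_apply 𝕜 (r := r1 k) i j).trans (if_congr ?_ rfl rfl)
    simp only [cellParity]
    omega
  | c2 k =>
    refine (one_fin_apply 𝕜 (r := r2 k) i j).trans (if_congr ?_ rfl rfl)
    simp only [cellParity]
    omega
  | c3 k =>
    change (if j.val = i.val + 1 then 1 else 0) = _
    refine if_congr ?_ rfl rfl
    simp only [cellParity]
    omega
  | c4 k =>
    change (if i.val = j.val then 1 else 0) = _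
    refine if_congr ?_ rfl rfl
    simp only [cellParity]
    omega

theorem cellParity_le (k : Cell t1 t2 t3 t4) : cellParity k ≤ 1 := by
  cases k <;> simp [cellParity]

theorem blockDiagonal'_shiftMatrix_apply {K : Type} [DecidableEq K] (c : K → ℕ) (k l : K)
    (a : Fin (c k)) (b : Fin (c l)) :
    Matrix.blockDiagonal' (fun k => shiftMatrix 𝕜 1 (c k)) ⟨k, a⟩ ⟨l, b⟩ =
      if k = l ∧ b.val = a.val + 1 then 1 else 0 := by
  by_cases h : k = l
  · subst h
    rw [Matrix.blockDiagonal'_apply_eq]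
    exact if_congr (by simp) rfl rfl
  · rw [Matrix.blockDiagonal'_apply_ne _ _ _ h, if_neg fun h' => h h'.1]

theorem nilA_apply (k l : Cell t1 t2 t3 t4) (i : Fin (cellV r1 r2 r3 r4 k))
    (j : Fin (cellU r1 r2 r3 r4 l)) : nilA r1 r2 r3 r4 𝕜 ⟨k, i⟩ ⟨l, j⟩ =
      if k = l ∧ 2 * j.val + (1 - cellParity l) = 2 * i.val + cellParity k + 1 then 1 else 0 := by
  unfold nilA
  by_cases h : k = l
  · subst h
    rw [Matrix.blockDiagonal'_apply_eq, cellA_apply]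
    exact if_congr (by simp) rfl rfl
  · rw [Matrix.blockDiagonal'_apply_ne _ _ _ h, if_neg fun h' => h h'.1]

theorem nilB_apply (k l : Cell t1 t2 t3 t4) (i : Fin (cellU r1 r2 r3 r4 k))
    (j : Fin (cellV r1 r2 r3 r4 l)) : nilB r1 r2 r3 r4 𝕜 ⟨k, i⟩ ⟨l, j⟩ =
      if k = l ∧ 2 * j.val + cellParity l = 2 * i.val + (1 - cellParity k) + 1 then 1 else 0 := by
  unfold nilB
  by_cases h : k = l
  · subst h
    rw [Matrix.blockDiagonal'_apply_eq, cellB_apply]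
    exact if_congr (by simp) rfl rfl
  · rw [Matrix.blockDiagonal'_apply_ne _ _ _ h, if_neg fun h' => h h'.1]

/-- On the chains, the pair of matrices of the nilpotent part acts as a direct sum of nilpotent
Jordan blocks. -/
theorem fromBlocks_nilA_nilB :
    Matrix.fromBlocks 0 (nilA r1 r2 r3 r4 𝕜) (nilB r1 r2 r3 r4 𝕜) 0 =
      (Matrix.blockDiagonal' fun k => shiftMatrix 𝕜 1 (cellLen r1 r2 r3 r4 k)).submatrix
        (chainEquiv r1 r2 r3 r4) (chainEquiv r1 r2 r3 r4) := by
  ext (⟨k, i⟩ | ⟨k, i⟩) (⟨l, j⟩ | ⟨l, j⟩)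
  · rw [Matrix.submatrix_apply, chainEquiv_inl, chainEquiv_inl, blockDiagonal'_shiftMatrix_apply]
    refine (if_neg ?_).symm
    rintro ⟨rfl, h⟩
    change 2 * j.val + cellParity k = 2 * i.val + cellParity k + 1 at h
    omega
  · rw [Matrix.submatrix_apply, chainEquiv_inl, chainEquiv_inr, blockDiagonal'_shiftMatrix_apply]
    exact nilA_apply r1 r2 r3 r4 𝕜 k l i j
  · rw [Matrix.submatrix_apply, chainEquiv_inr, chainEquiv_inl, blockDiagonal'_shiftMatrix_apply]
    exact nilB_apply r1 r2 r3 r4 𝕜 k l i j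
  · rw [Matrix.submatrix_apply, chainEquiv_inr, chainEquiv_inr, blockDiagonal'_shiftMatrix_apply]
    refine (if_neg ?_).symm
    rintro ⟨rfl, h⟩
    change 2 * j.val + (1 - cellParity k) = 2 * i.val + (1 - cellParity k) + 1 at h
    omega

/-- The places, in an `m × n` array of chain positions with offsets `α` and `β`, of the stars of a
block `H`. -/
def IsStarNode (m n α β a b : ℕ) : Prop :=
  ∃ i < m, ∃ j < n, a = 2 * i + α ∧ b = 2 * j + β ∧ ((m ≤ n ∧ j = 0) ∨ (n < m ∧ i + 1 = m))

/-- The stars of the `(k, l)` blocks of both matrices as pairs of places in chains. -/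
def starNode (k l : Cell t1 t2 t3 t4) (a b : ℕ) : Prop :=
  (hasHA k l ∧ IsStarNode (cellV r1 r2 r3 r4 k) (cellU r1 r2 r3 r4 l) (cellParity k)
    (1 - cellParity l) a b) ∨
  (hasHB k l ∧ IsStarNode (cellU r1 r2 r3 r4 k) (cellV r1 r2 r3 r4 l) (1 - cellParity k)
    (cellParity l) a b)

theorem starsA_iff_starNode (k l : Cell t1 t2 t3 t4) (i : Fin (cellV r1 r2 r3 r4 k))
    (j : Fin (cellU r1 r2 r3 r4 l)) :
    starsA r1 r2 r3 r4 ⟨k, i⟩ ⟨l, j⟩ ↔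
      starNode r1 r2 r3 r4 k l (2 * i.val + cellParity k) (2 * j.val + (1 - cellParity l)) := by
  have hk := cellParity_cases r1 r2 r3 r4 k
  have hl := cellParity_cases r1 r2 r3 r4 l
  have hAB : ¬ (hasHA k l ∧ hasHB k l) := by
    cases k <;> cases l <;> simp [hasHA, hasHB]
  constructor
  · rintro ⟨h, hs⟩
    refine Or.inl ⟨h, i.val, i.2, j.val, j.2, rfl, rfl, hs⟩
  · rintro (⟨h, i', hi', j', hj', h1, h2, hs⟩ | ⟨h, i', hi', j', hj', h1, h2, hs⟩)
    · obtain rfl : i' = i.val := by omega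
      obtain rfl : j' = j.val := by omega
      exact ⟨h, hs⟩
    · omega

theorem starsB_iff_starNode (k l : Cell t1 t2 t3 t4) (i : Fin (cellU r1 r2 r3 r4 k))
    (j : Fin (cellV r1 r2 r3 r4 l)) :
    starsB r1 r2 r3 r4 ⟨k, i⟩ ⟨l, j⟩ ↔
      starNode r1 r2 r3 r4 k l (2 * i.val + (1 - cellParity k)) (2 * j.val + cellParity l) := by
  have hk := cellParity_cases r1 r2 r3 r4 k
  have hl := cellParity_cases r1 r2 r3 r4 l
  constructor
  · rintro ⟨h, hs⟩
    refine Or.inr ⟨h, i.val, i.2, j.val, j.2, rfl, rfl, hs⟩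
  · rintro (⟨h, i', hi', j', hj', h1, h2, hs⟩ | ⟨h, i', hi', j', hj', h1, h2, hs⟩)
    · omega
    · obtain rfl : i' = i.val := by omega
      obtain rfl : j' = j.val := by omega
      exact ⟨h, hs⟩

variable {r1 r2 r3 r4}

/-- For most pairs of kinds the first column or last row lies on obstructed diagonals whatever the
sizes are. Only for two cells of the third kind or two of the fourth does the order of the sizes
matter: it ensures that the matrix chosen for the block has its stars on the proper side. -/
theorem starNode_obstructed (h3 : Antitone r3) (h4 : Antitone r4)
    {k l : Cell t1 t2 t3 t4} {a b : ℕ} (h : starNode r1 r2 r3 r4 k l a b) :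
    b ≤ a ∧ cellLen r1 r2 r3 r4 k + b ≤ cellLen r1 r2 r3 r4 l + a := by
  cases k <;> cases l <;> rcases h with ⟨h, i, hi, j, hj, e1, e2, hs⟩ | ⟨h, i, hi, j, hj, e1, e2, hs⟩ <;>
    simp only [hasHA, hasHB, cellV, cellU, cellParity, cellLen] at * <;>
    first
    | omega
    | (have := h3 h; omega)
    | (have := h4 h; omega)
    | (have := h3 h.le; omega)
    | (have := h4 h.le; omega)

/-- For a given pair of cells only one of the two matrices carries stars, and these fill a single
column or a single row, which meets each diagonal at most once. -/
theorem starNode_unique {k l : Cell t1 t2 t3 t4} {a b a' b' : ℕ}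
    (h : starNode r1 r2 r3 r4 k l a b) (h' : starNode r1 r2 r3 r4 k l a' b')
    (hd : a + b' = a' + b) : b = b' := by
  have hAB : ¬ (hasHA k l ∧ hasHB k l) := by
    cases k <;> cases l <;> simp [hasHA, hasHB]
  rcases h with ⟨h, i, hi, j, hj, e1, e2, hs⟩ | ⟨h, i, hi, j, hj, e1, e2, hs⟩ <;>
  rcases h' with ⟨h', i', hi', j', hj', e1', e2', hs'⟩ | ⟨h', i', hi', j', hj', e1', e2', hs'⟩
  · omega
  · exact absurd ⟨h, h'⟩ hAB
  · exact absurd ⟨h', h⟩ hAB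
  · omega

/-- Exactly one of the two matrices has a block `H` for the given pair of cells. An odd diagonal
from the first column to the last row of the chain array crosses the starred column or row of that
block inside its bounds. -/
theorem exists_starNode {k l : Cell t1 t2 t3 t4} {a b : ℕ}
    (ha : a < cellLen r1 r2 r3 r4 k) (hb : b < cellLen r1 r2 r3 r4 l)
    (hodd : (a + cellParity k + (b + cellParity l)) % 2 = 1)
    (h1 : b ≤ a) (h2 : cellLen r1 r2 r3 r4 k + b ≤ cellLen r1 r2 r3 r4 l + a) :
    ∃ a' b', starNode r1 r2 r3 r4 k l a' b' ∧ a + b' = a' + b := by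
  have hAB : hasHA k l ∨ hasHB k l := by
    cases k <;> cases l <;> simp [hasHA, hasHB] <;> omega
  rcases hAB with h | h
  · by_cases hmn : cellV r1 r2 r3 r4 k ≤ cellU r1 r2 r3 r4 l
    -- For stars in the first column, column index `0` has chain place `1 - cellParity l`; adding `a
    -- - b` gives the place of the row, which is then converted into a row index.
    · refine ⟨_, _, Or.inl ⟨h, (a - b + (1 - cellParity l) - cellParity k) / 2, ?_, 0, ?_, rfl, rfl,
        Or.inl ⟨hmn, rfl⟩⟩, ?_⟩ <;>
      cases k <;> cases l <;> simp only [hasHA, cellV, cellU, cellParity, cellLen] at * <;>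
      omega
    -- For stars in the last row, its chain place minus `a - b` is the place of the column.
    · refine ⟨_, _, Or.inl ⟨h, cellV r1 r2 r3 r4 k - 1, ?_,
        (2 * (cellV r1 r2 r3 r4 k - 1) + cellParity k - (a - b) - (1 - cellParity l)) / 2, ?_,
        rfl, rfl, Or.inr ⟨not_le.1 hmn, ?_⟩⟩, ?_⟩ <;>
      cases k <;> cases l <;> simp only [hasHA, cellV, cellU, cellParity, cellLen] at * <;>
      omega
  · by_cases hmn : cellU r1 r2 r3 r4 k ≤ cellV r1 r2 r3 r4 l
    · refine ⟨_, _, Or.inr ⟨h, (a - b + cellParity l - (1 - cellParity k)) / 2, ?_, 0, ?_, rfl, rfl,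
        Or.inl ⟨hmn, rfl⟩⟩, ?_⟩ <;>
      cases k <;> cases l <;> simp only [hasHB, cellV, cellU, cellParity, cellLen] at * <;>
      omega
    · refine ⟨_, _, Or.inr ⟨h, cellU r1 r2 r3 r4 k - 1, ?_,
        (2 * (cellU r1 r2 r3 r4 k - 1) + (1 - cellParity k) - (a - b) - cellParity l) / 2, ?_,
        rfl, rfl, Or.inr ⟨not_le.1 hmn, ?_⟩⟩, ?_⟩ <;>
      cases k <;> cases l <;> simp only [hasHB, cellV, cellU, cellParity, cellLen] at * <;>
      omega

/-- The off-diagonal blocks of the commutator, which are the infinitesimal action on the pair,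
involve only the diagonal blocks `S`, `R` of `X`. Hence the parity-even part of the similarity
problem on chains is the contragredient problem. -/
theorem chain_commutator_submatrix {𝕜 : Type} [RCLike 𝕜]
    (S : Matrix (VIdx r1 r2 r3 r4) (VIdx r1 r2 r3 r4) 𝕜)
    (R : Matrix (UIdx r1 r2 r3 r4) (UIdx r1 r2 r3 r4) 𝕜)
    (Y1 : Matrix (VIdx r1 r2 r3 r4) (UIdx r1 r2 r3 r4) 𝕜)
    (Y2 : Matrix (UIdx r1 r2 r3 r4) (VIdx r1 r2 r3 r4) 𝕜)
    (X : Matrix (Σ k : Cell t1 t2 t3 t4, Fin (cellLen r1 r2 r3 r4 k))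
      (Σ k : Cell t1 t2 t3 t4, Fin (cellLen r1 r2 r3 r4 k)) 𝕜)
    (hX : X.submatrix (chainEquiv r1 r2 r3 r4) (chainEquiv r1 r2 r3 r4) =
      Matrix.fromBlocks S Y1 Y2 R) :
    (X * (Matrix.blockDiagonal' fun k => shiftMatrix 𝕜 1 (cellLen r1 r2 r3 r4 k)) -
      (Matrix.blockDiagonal' fun k => shiftMatrix 𝕜 1 (cellLen r1 r2 r3 r4 k)) * X).submatrix
        (chainEquiv r1 r2 r3 r4) (chainEquiv r1 r2 r3 r4) =
    Matrix.fromBlocks (Y1 * nilB r1 r2 r3 r4 𝕜 - nilA r1 r2 r3 r4 𝕜 * Y2)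
      (S * nilA r1 r2 r3 r4 𝕜 - nilA r1 r2 r3 r4 𝕜 * R)
      (R * nilB r1 r2 r3 r4 𝕜 - nilB r1 r2 r3 r4 𝕜 * S)
      (Y2 * nilA r1 r2 r3 r4 𝕜 - nilB r1 r2 r3 r4 𝕜 * Y1) := by
  have h1 : ∀ P Q : Matrix (Σ k : Cell t1 t2 t3 t4, Fin (cellLen r1 r2 r3 r4 k))
      (Σ k : Cell t1 t2 t3 t4, Fin (cellLen r1 r2 r3 r4 k)) 𝕜,
      (P * Q).submatrix (chainEquiv r1 r2 r3 r4) (chainEquiv r1 r2 r3 r4) =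
        P.submatrix (chainEquiv r1 r2 r3 r4) (chainEquiv r1 r2 r3 r4) *
          Q.submatrix (chainEquiv r1 r2 r3 r4) (chainEquiv r1 r2 r3 r4) := fun P Q =>
    (Matrix.submatrix_mul_equiv P Q _ (chainEquiv r1 r2 r3 r4) _).symm
  rw [Matrix.submatrix_sub, Pi.sub_apply, Pi.sub_apply, h1, h1, hX, ← fromBlocks_nilA_nilB,
    Matrix.fromBlocks_multiply,
    Matrix.fromBlocks_multiply, sub_eq_add_neg, Matrix.fromBlocks_neg, Matrix.fromBlocks_add]
  simp [sub_eq_add_neg]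

theorem exists_nilpotent_complement {𝕜 : Type} [RCLike 𝕜]
    (P : Matrix (VIdx r1 r2 r3 r4) (UIdx r1 r2 r3 r4) 𝕜)
    (Q : Matrix (UIdx r1 r2 r3 r4) (VIdx r1 r2 r3 r4) 𝕜) :
    ∃ (S : Matrix (VIdx r1 r2 r3 r4) (VIdx r1 r2 r3 r4) 𝕜)
      (R : Matrix (UIdx r1 r2 r3 r4) (UIdx r1 r2 r3 r4) 𝕜),
      (∀ i j, ¬ starsA r1 r2 r3 r4 i j →
        P i j = (S * nilA r1 r2 r3 r4 𝕜 - nilA r1 r2 r3 r4 𝕜 * R) i j) ∧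
      ∀ i j, ¬ starsB r1 r2 r3 r4 i j →
        Q i j = (R * nilB r1 r2 r3 r4 𝕜 - nilB r1 r2 r3 r4 𝕜 * S) i j := by
  let e := chainEquiv r1 r2 r3 r4
  let E := (Matrix.fromBlocks 0 P Q 0).submatrix e.symm e.symm
  have hblock : ∀ k l : Cell t1 t2 t3 t4,
      ∃ X : Matrix (Fin (cellLen r1 r2 r3 r4 k)) (Fin (cellLen r1 r2 r3 r4 l)) 𝕜, ∀ i j,
        -- Places of even parity join two rows or two columns and do not occur in the pair, so they
        -- are left unconstrained. The off-diagonal blocks of the solution are discarded at the end.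
        ¬ (starNode r1 r2 r3 r4 k l i.val j.val ∨
          (i.val + cellParity k + (j.val + cellParity l)) % 2 = 0) →
        E ⟨k, i⟩ ⟨l, j⟩ = (X * shiftMatrix 𝕜 1 (cellLen r1 r2 r3 r4 l) -
          shiftMatrix 𝕜 1 (cellLen r1 r2 r3 r4 k) * X) i j := by
    intro k l
    refine exists_shift_commutator (fun a b h1 h2 => ?_) (Matrix.of fun i j => E ⟨k, i⟩ ⟨l, j⟩)
    by_cases hodd : (a.val + cellParity k + (b.val + cellParity l)) % 2 = 1
    · obtain ⟨a', b', hs, hd⟩ := exists_starNode a.2 b.2 hodd h1 h2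
      have hb' : a' < cellLen r1 r2 r3 r4 k ∧ b' < cellLen r1 r2 r3 r4 l := by
        have hk := cellParity_cases r1 r2 r3 r4 k
        have hl := cellParity_cases r1 r2 r3 r4 l
        simp only [cellLen]
        rcases hs with ⟨_, i, hi, j, hj, rfl, rfl, _⟩ | ⟨_, i, hi, j, hj, rfl, rfl, _⟩ <;> omega
      exact ⟨⟨a', hb'.1⟩, ⟨b', hb'.2⟩, Or.inl hs, hd⟩
    · exact ⟨a, b, Or.inr (by omega), rfl⟩
  choose X hX using hblock
  let Y : Matrix (Σ k : Cell t1 t2 t3 t4, Fin (cellLen r1 r2 r3 r4 k))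
      (Σ k : Cell t1 t2 t3 t4, Fin (cellLen r1 r2 r3 r4 k)) 𝕜 :=
    Matrix.of fun a b => X a.1 b.1 a.2 b.2
  have hY : ∀ k l i j, ¬ (starNode r1 r2 r3 r4 k l i.val j.val ∨
      (i.val + cellParity k + (j.val + cellParity l)) % 2 = 0) →
      E ⟨k, i⟩ ⟨l, j⟩ = (Y * (Matrix.blockDiagonal' fun k => shiftMatrix 𝕜 1 (cellLen r1 r2 r3 r4 k)) -
      (Matrix.blockDiagonal' fun k => shiftMatrix 𝕜 1 (cellLen r1 r2 r3 r4 k)) * Y) ⟨k, i⟩ ⟨l, j⟩ :=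
    fun k l i j h => (hX k l i j h).trans (blockDiagonal'_commutator_apply Y
      (fun k => shiftMatrix 𝕜 1 (cellLen r1 r2 r3 r4 k)) k l i j).symm
  have hsub := chain_commutator_submatrix (Y.submatrix e e).toBlocks₁₁ (Y.submatrix e e).toBlocks₂₂
    (Y.submatrix e e).toBlocks₁₂ (Y.submatrix e e).toBlocks₂₁ Y
    (Matrix.fromBlocks_toBlocks _).symm
  have hE : E.submatrix e e = Matrix.fromBlocks 0 P Q 0 := by
    simp [E, Matrix.submatrix_submatrix]
  refine ⟨(Y.submatrix e e).toBlocks₁₁, (Y.submatrix e e).toBlocks₂₂, ?_, ?_⟩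
  · rintro ⟨k, i⟩ ⟨l, j⟩ h
    rw [starsA_iff_starNode] at h
    have e1 := congrFun (congrFun hsub (.inl ⟨k, i⟩)) (.inr ⟨l, j⟩)
    have e2 := congrFun (congrFun hE (.inl ⟨k, i⟩)) (.inr ⟨l, j⟩)
    rw [Matrix.fromBlocks_apply₁₂] at e1 e2
    rw [← e1, ← e2]
    refine hY k l _ _ (not_or.2 ⟨h, ?_⟩)
    have := cellParity_le l
    simp only
    omega
  · rintro ⟨k, i⟩ ⟨l, j⟩ h
    rw [starsB_iff_starNode] at h
    have e1 := congrFun (congrFun hsub (.inr ⟨k, i⟩)) (.inl ⟨l, j⟩)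
    have e2 := congrFun (congrFun hE (.inr ⟨k, i⟩)) (.inl ⟨l, j⟩)
    rw [Matrix.fromBlocks_apply₂₁] at e1 e2
    rw [← e1, ← e2]
    refine hY k l _ _ (not_or.2 ⟨h, ?_⟩)
    have := cellParity_le k
    simp only
    omega

theorem nilpotent_complement_eq_zero {𝕜 : Type} [RCLike 𝕜] (h3 : Antitone r3) (h4 : Antitone r4)
    (S : Matrix (VIdx r1 r2 r3 r4) (VIdx r1 r2 r3 r4) 𝕜)
    (R : Matrix (UIdx r1 r2 r3 r4) (UIdx r1 r2 r3 r4) 𝕜)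
    (hA : ∀ i j, ¬ starsA r1 r2 r3 r4 i j →
      (S * nilA r1 r2 r3 r4 𝕜 - nilA r1 r2 r3 r4 𝕜 * R) i j = 0)
    (hB : ∀ i j, ¬ starsB r1 r2 r3 r4 i j →
      (R * nilB r1 r2 r3 r4 𝕜 - nilB r1 r2 r3 r4 𝕜 * S) i j = 0) :
    S * nilA r1 r2 r3 r4 𝕜 - nilA r1 r2 r3 r4 𝕜 * R = 0 ∧
      R * nilB r1 r2 r3 r4 𝕜 - nilB r1 r2 r3 r4 𝕜 * S = 0 := by
  let e := chainEquiv r1 r2 r3 r4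
  let X := (Matrix.fromBlocks S 0 0 R).submatrix e.symm e.symm
  have hsub := chain_commutator_submatrix S R 0 0 X (by
    simp [X, e, Matrix.submatrix_submatrix])
  rw [Matrix.zero_mul, Matrix.zero_mul, Matrix.mul_zero, Matrix.mul_zero, sub_zero, sub_zero] at hsub
  set W := X * (Matrix.blockDiagonal' fun k => shiftMatrix 𝕜 1 (cellLen r1 r2 r3 r4 k)) -
      (Matrix.blockDiagonal' fun k => shiftMatrix 𝕜 1 (cellLen r1 r2 r3 r4 k)) * X with hW
  have hoff : ∀ k l i j, ¬ starNode r1 r2 r3 r4 k l i.val j.val → W ⟨k, i⟩ ⟨l, j⟩ = 0 := by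
    have key : ∀ x y, ¬ starNode r1 r2 r3 r4 (e x).1 (e y).1 (e x).2.val (e y).2.val →
        W (e x) (e y) = 0 := by
      rintro (⟨k, i⟩ | ⟨k, i⟩) (⟨l, j⟩ | ⟨l, j⟩) h
      · exact congrFun (congrFun hsub (.inl ⟨k, i⟩)) (.inl ⟨l, j⟩)
      · refine (congrFun (congrFun hsub (.inl ⟨k, i⟩)) (.inr ⟨l, j⟩)).trans
          (hA _ _ fun h' => h ?_)
        exact (starsA_iff_starNode r1 r2 r3 r4 k l i j).1 h'
      · refine (congrFun (congrFun hsub (.inr ⟨k, i⟩)) (.inl ⟨l, j⟩)).trans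
          (hB _ _ fun h' => h ?_)
        exact (starsB_iff_starNode r1 r2 r3 r4 k l i j).1 h'
      · exact congrFun (congrFun hsub (.inr ⟨k, i⟩)) (.inr ⟨l, j⟩)
    intro k l i j h
    have := key (e.symm ⟨k, i⟩) (e.symm ⟨l, j⟩)
    rw [Equiv.apply_symm_apply, Equiv.apply_symm_apply] at this
    exact this h
  have hW0 : W = 0 := by
    ext ⟨k, i⟩ ⟨l, j⟩
    have h1 := shift_commutator_eq_zero (𝕜 := 𝕜)
      (St := fun (a : Fin (cellLen r1 r2 r3 r4 k)) (b : Fin (cellLen r1 r2 r3 r4 l)) =>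
        starNode r1 r2 r3 r4 k l a.val b.val)
      (fun a b h => starNode_obstructed h3 h4 h) (fun a b a' b' h h' hd => starNode_unique h h' hd)
      (X := Matrix.of fun i j => X ⟨k, i⟩ ⟨l, j⟩)
      (fun i j h => (blockDiagonal'_commutator_apply _ _ _ _ _ _).symm.trans (hoff k l i j h))
    exact (blockDiagonal'_commutator_apply _ _ _ _ _ _).trans (congrFun (congrFun h1 i) j)
  rw [hW0] at hsub
  constructor
  · ext i j
    exact (congrFun (congrFun hsub (.inl i)) (.inr j)).symm
  · ext i j
    exact (congrFun (congrFun hsub (.inr i)) (.inl j)).symm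

end Strings

/-! ### Sylvester equations between nonsingular and nilpotent matrices. -/

section NilpotentSylvester

variable {𝕜 : Type} [RCLike 𝕜] {N m : Type} [Fintype N] [Fintype m] [DecidableEq N]
  [DecidableEq m]

theorem exists_sylvester_nilpotent_right {C : Matrix N N 𝕜} {M : Matrix m m 𝕜} (hC : IsUnit C.det)
    (hM : IsNilpotent M) (E : Matrix N m 𝕜) : ∃ X : Matrix N m 𝕜, X * M - C * X = E := by
  refine exists_sylvester (fun X hX => ?_) E
  obtain ⟨k, hk⟩ := hM
  have h1 := mul_pow_of_intertwining hX k
  rw [hk, Matrix.mul_zero] at h1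
  have h2 : IsUnit (C ^ k).det := by
    rw [Matrix.det_pow]
    exact hC.pow k
  rw [← Matrix.nonsing_inv_mul_cancel_left (C ^ k) X h2, ← h1, Matrix.mul_zero]

theorem exists_sylvester_nilpotent_left {C : Matrix N N 𝕜} {M : Matrix m m 𝕜} (hC : IsUnit C.det)
    (hM : IsNilpotent M) (E : Matrix m N 𝕜) : ∃ X : Matrix m N 𝕜, X * C - M * X = E := by
  refine exists_sylvester (fun X hX => ?_) E
  obtain ⟨k, hk⟩ := hM
  have h1 := mul_pow_of_intertwining hX k
  rw [hk, Matrix.zero_mul] at h1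
  have h2 : IsUnit (C ^ k).det := by
    rw [Matrix.det_pow]
    exact hC.pow k
  rw [← Matrix.mul_nonsing_inv_cancel_right (C ^ k) X h2, h1, Matrix.zero_mul]

theorem isNilpotent_mul_swap {n : Type} [Fintype n] [DecidableEq n] {A : Matrix m n 𝕜}
    {B : Matrix n m 𝕜} (h : IsNilpotent (A * B)) : IsNilpotent (B * A) := by
  obtain ⟨k, hk⟩ := h
  refine ⟨k + 1, ?_⟩
  have h1 : B * (A * B) = (B * A) * B := (Matrix.mul_assoc _ _ _).symm
  rw [pow_succ, ← Matrix.mul_assoc, ← mul_pow_of_intertwining h1 k, hk, Matrix.mul_zero,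
    Matrix.zero_mul]

end NilpotentSylvester

/-! ### Pairs under contragredient equivalence and the direct sum with `(I, C)`. -/

section Contragredient

variable {𝕜 : Type} [RCLike 𝕜]

theorem isComplement_contraRep {m n κ : Type} [Fintype m] [Fintype n] [DecidableEq m]
    [DecidableEq n] {A : Matrix m n 𝕜} {B : Matrix n m 𝕜}
    {pos : κ → Place contraQuiver (contraDim m n)} {PA : m → n → Prop} {PB : n → m → Prop}
    (hPA : ∀ i j, (⟨false, (i, j)⟩ : Place contraQuiver (contraDim m n)) ∈ Set.range pos ↔ PA i j)
    (hPB : ∀ i j, (⟨true, (i, j)⟩ : Place contraQuiver (contraDim m n)) ∈ Set.range pos ↔ PB i j)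
    (h1 : ∀ (P : Matrix m n 𝕜) (Q : Matrix n m 𝕜), ∃ (S : Matrix m m 𝕜) (R : Matrix n n 𝕜),
      (∀ i j, ¬ PA i j → P i j = (S * A - A * R) i j) ∧
      ∀ i j, ¬ PB i j → Q i j = (R * B - B * S) i j)
    (h2 : ∀ (S : Matrix m m 𝕜) (R : Matrix n n 𝕜),
      (∀ i j, ¬ PA i j → (S * A - A * R) i j = 0) →
      (∀ i j, ¬ PB i j → (R * B - B * S) i j = 0) →
      S * A - A * R = 0 ∧ R * B - B * S = 0) :
    IsComplement (contraRep A B) pos := by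
  constructor
  · intro E
    obtain ⟨S, R, hS, hR⟩ := h1 (E false) (E true)
    let X : ∀ v, Matrix (contraDim m n v) (contraDim m n v) 𝕜
      | false => R
      | true => S
    refine ⟨X, E - infinitesimalAction (contraRep A B) X, ?_, by abel⟩
    rintro ⟨α, i, j⟩ h
    refine sub_eq_zero.2 ?_
    cases α
    · exact hS i j fun h' => h ((hPA i j).2 h')
    · exact hR i j fun h' => h ((hPB i j).2 h')
  · intro X hX
    obtain ⟨e1, e2⟩ := h2 (X true) (X false)
      (fun i j h => hX ⟨false, (i, j)⟩ fun h' => h ((hPA i j).1 h'))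
      (fun i j h => hX ⟨true, (i, j)⟩ fun h' => h ((hPB i j).1 h'))
    funext α
    cases α
    · exact e1
    · exact e2

variable {N m n κ : Type}

/-- The places of the parameters in a direct sum `(I, C) ⊕ (A, B)`. -/
def directSumPlace (posC : κ → Place loopQuiver fun _ => N) (PA : m → n → Prop)
    (PB : n → m → Prop) :
    κ ⊕ Stars PA ⊕ Stars PB → Place contraQuiver (contraDim (N ⊕ m) (N ⊕ n))
  | .inl c => ⟨true, (Sum.inl (posC c).2.1 : N ⊕ n), (Sum.inl (posC c).2.2 : N ⊕ m)⟩
  | .inr (.inl e) => ⟨false, (Sum.inr e.1.1 : N ⊕ m), (Sum.inr e.1.2 : N ⊕ n)⟩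
  | .inr (.inr e) => ⟨true, (Sum.inr e.1.1 : N ⊕ n), (Sum.inr e.1.2 : N ⊕ m)⟩

theorem directSumPlace_injective {posC : κ → Place loopQuiver fun _ => N}
    (hpos : Function.Injective posC) (PA : m → n → Prop) (PB : n → m → Prop) :
    Function.Injective (directSumPlace posC PA PB) := by
  have hmk : ∀ {α : Bool} {x y : contraDim (N ⊕ m) (N ⊕ n) (contraQuiver.tgt α) ×
      contraDim (N ⊕ m) (N ⊕ n) (contraQuiver.src α)},
      (⟨α, x⟩ : Place contraQuiver (contraDim (N ⊕ m) (N ⊕ n))) = ⟨α, y⟩ → x = y :=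
    fun h => eq_of_heq (Sigma.mk.inj h).2
  rintro (c | ⟨⟨i, j⟩, h⟩ | ⟨⟨i, j⟩, h⟩) (c' | ⟨⟨i', j'⟩, h'⟩ | ⟨⟨i', j'⟩, h'⟩) he
  · have h1 := hmk he
    have e1 := Sum.inl_injective (Prod.mk.inj h1).1
    have e2 := Sum.inl_injective (Prod.mk.inj h1).2
    exact congrArg Sum.inl (hpos (Sigma.ext rfl (heq_of_eq (Prod.ext e1 e2))))
  · exact absurd (Sigma.mk.inj he).1 Bool.false_ne_true.symm
  · exact absurd (Prod.mk.inj (hmk he)).1 Sum.inl_ne_inr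
  · exact absurd (Sigma.mk.inj he).1 Bool.false_ne_true
  · have h1 := hmk he
    have e1 := Sum.inr_injective (Prod.mk.inj h1).1
    have e2 := Sum.inr_injective (Prod.mk.inj h1).2
    exact congrArg (Sum.inr ∘ Sum.inl) (Subtype.ext (Prod.ext e1 e2))
  · exact absurd (Sigma.mk.inj he).1 Bool.false_ne_true
  · exact absurd (Prod.mk.inj (hmk he)).1 Sum.inr_ne_inl
  · exact absurd (Sigma.mk.inj he).1 Bool.false_ne_true.symm
  · have h1 := hmk he
    have e1 := Sum.inr_injective (Prod.mk.inj h1).1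
    have e2 := Sum.inr_injective (Prod.mk.inj h1).2
    exact congrArg (Sum.inr ∘ Sum.inr) (Subtype.ext (Prod.ext e1 e2))

/-- The stars of the first matrix of `(I, C) ⊕ (A, B)`. -/
def directSumStarsA (N : Type) (PA : m → n → Prop) : N ⊕ m → N ⊕ n → Prop
  | .inr i, .inr j => PA i j
  | _, _ => False

/-- The stars of the second matrix of `(I, C) ⊕ (A, B)`. -/
def directSumStarsB (posC : κ → Place loopQuiver fun _ => N) (PB : n → m → Prop) :
    N ⊕ n → N ⊕ m → Prop
  | .inl i, .inl j => ⟨(), i, j⟩ ∈ Set.range posC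
  | .inr i, .inr j => PB i j
  | _, _ => False

theorem mem_range_directSumPlace_false {posC : κ → Place loopQuiver fun _ => N}
    {PA : m → n → Prop} {PB : n → m → Prop} (i : N ⊕ m) (j : N ⊕ n) :
    (⟨false, (i, j)⟩ : Place contraQuiver (contraDim (N ⊕ m) (N ⊕ n))) ∈
      Set.range (directSumPlace posC PA PB) ↔ directSumStarsA N PA i j := by
  constructor
  · rintro ⟨c | ⟨⟨i', j'⟩, h⟩ | e, he⟩
    · exact absurd (Sigma.mk.inj he).1 Bool.false_ne_true.symm
    · have h1 := eq_of_heq (Sigma.mk.inj he).2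
      obtain rfl : Sum.inr i' = i := (Prod.mk.inj h1).1
      obtain rfl : Sum.inr j' = j := (Prod.mk.inj h1).2
      exact h
    · exact absurd (Sigma.mk.inj he).1 Bool.false_ne_true.symm
  · intro h
    rcases i with i | i <;> rcases j with j | j
    · exact h.elim
    · exact h.elim
    · exact h.elim
    · exact ⟨.inr (.inl ⟨(i, j), h⟩), rfl⟩

theorem mem_range_directSumPlace_true {posC : κ → Place loopQuiver fun _ => N}
    {PA : m → n → Prop} {PB : n → m → Prop} (i : N ⊕ n) (j : N ⊕ m) :
    (⟨true, (i, j)⟩ : Place contraQuiver (contraDim (N ⊕ m) (N ⊕ n))) ∈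
      Set.range (directSumPlace posC PA PB) ↔ directSumStarsB posC PB i j := by
  constructor
  · rintro ⟨c | e | ⟨⟨i', j'⟩, h⟩, he⟩
    · have h1 := eq_of_heq (Sigma.mk.inj he).2
      obtain rfl : Sum.inl (posC c).2.1 = i := (Prod.mk.inj h1).1
      obtain rfl : Sum.inl (posC c).2.2 = j := (Prod.mk.inj h1).2
      exact ⟨c, rfl⟩
    · exact absurd (Sigma.mk.inj he).1 Bool.false_ne_true
    · have h1 := eq_of_heq (Sigma.mk.inj he).2
      obtain rfl : Sum.inr i' = i := (Prod.mk.inj h1).1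
      obtain rfl : Sum.inr j' = j := (Prod.mk.inj h1).2
      exact h
  · intro h
    rcases i with i | i <;> rcases j with j | j
    · obtain ⟨c, hc⟩ := h
      refine ⟨.inl c, ?_⟩
      change (⟨true, (Sum.inl (posC c).2.1 : N ⊕ n), (Sum.inl (posC c).2.2 : N ⊕ m)⟩ :
        Place contraQuiver (contraDim (N ⊕ m) (N ⊕ n))) = _
      rw [hc]
    · exact h.elim
    · exact h.elim
    · exact ⟨.inr (.inr ⟨(i, j), h⟩), rfl⟩

variable [Fintype N] [Fintype m] [Fintype n] [DecidableEq N] [DecidableEq m] [DecidableEq n]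

/-- Because the first matrix has an identity block, its equations in the three blocks touching `C`
can be solved for one unknown. Substitution leaves the similarity problem for `C` in the corner and
equations pairing `C` with `A * B` or `B * A` in the mixed blocks; the latter are always solvable,
so they need no parameters. -/
theorem isComplement_directSumIC {C : Matrix N N 𝕜} {A : Matrix m n 𝕜} {B : Matrix n m 𝕜}
    {posC : κ → Place loopQuiver fun _ => N} {PA : m → n → Prop} {PB : n → m → Prop}
    (hcompl : IsComplement (loopRep C) posC) (hC : IsUnit C.det) (hAB : IsNilpotent (A * B))
    (h1 : ∀ (P : Matrix m n 𝕜) (Q : Matrix n m 𝕜), ∃ (S : Matrix m m 𝕜) (R : Matrix n n 𝕜),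
      (∀ i j, ¬ PA i j → P i j = (S * A - A * R) i j) ∧
      ∀ i j, ¬ PB i j → Q i j = (R * B - B * S) i j)
    (h2 : ∀ (S : Matrix m m 𝕜) (R : Matrix n n 𝕜),
      (∀ i j, ¬ PA i j → (S * A - A * R) i j = 0) →
      (∀ i j, ¬ PB i j → (R * B - B * S) i j = 0) →
      S * A - A * R = 0 ∧ R * B - B * S = 0) :
    IsComplement (directSumIC C A B) (directSumPlace posC PA PB) := by
  rw [isComplement_loopRep_iff] at hcompl
  obtain ⟨c1, c2⟩ := hcompl
  have hmulA : ∀ (S11 : Matrix N N 𝕜) (S12 : Matrix N m 𝕜) (S21 : Matrix m N 𝕜) (S22 : Matrix m m 𝕜)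
      (R11 : Matrix N N 𝕜) (R12 : Matrix N n 𝕜) (R21 : Matrix n N 𝕜) (R22 : Matrix n n 𝕜),
      Matrix.fromBlocks S11 S12 S21 S22 * Matrix.fromBlocks (1 : Matrix N N 𝕜) 0 0 A -
        Matrix.fromBlocks (1 : Matrix N N 𝕜) 0 0 A * Matrix.fromBlocks R11 R12 R21 R22 =
      Matrix.fromBlocks (S11 - R11) (S12 * A - R12) (S21 - A * R21) (S22 * A - A * R22) := by
    intros
    rw [Matrix.fromBlocks_multiply, Matrix.fromBlocks_multiply, sub_eq_add_neg,
      Matrix.fromBlocks_neg, Matrix.fromBlocks_add]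
    simp [sub_eq_add_neg]
  have hmulB : ∀ (S11 : Matrix N N 𝕜) (S12 : Matrix N m 𝕜) (S21 : Matrix m N 𝕜) (S22 : Matrix m m 𝕜)
      (R11 : Matrix N N 𝕜) (R12 : Matrix N n 𝕜) (R21 : Matrix n N 𝕜) (R22 : Matrix n n 𝕜),
      Matrix.fromBlocks R11 R12 R21 R22 * Matrix.fromBlocks C 0 0 B -
        Matrix.fromBlocks C 0 0 B * Matrix.fromBlocks S11 S12 S21 S22 =
      Matrix.fromBlocks (R11 * C - C * S11) (R12 * B - C * S12) (R21 * C - B * S21)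
        (R22 * B - B * S22) := by
    intros
    rw [Matrix.fromBlocks_multiply, Matrix.fromBlocks_multiply, sub_eq_add_neg,
      Matrix.fromBlocks_neg, Matrix.fromBlocks_add]
    simp [sub_eq_add_neg]
  refine isComplement_contraRep mem_range_directSumPlace_false mem_range_directSumPlace_true
    (fun P Q => ?_) (fun S R hS hR => ?_)
  · obtain ⟨R11, F, hF, e11⟩ := c1 (Q.toBlocks₁₁ + C * P.toBlocks₁₁)
    obtain ⟨S12, e12⟩ := exists_sylvester_nilpotent_right hC hAB
      (Q.toBlocks₁₂ + P.toBlocks₁₂ * B)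
    obtain ⟨R21, e21⟩ := exists_sylvester_nilpotent_left hC (isNilpotent_mul_swap hAB)
      (Q.toBlocks₂₁ + B * P.toBlocks₂₁)
    obtain ⟨S22, R22, a22, b22⟩ := h1 P.toBlocks₂₂ Q.toBlocks₂₂
    -- The blocks `S11`, `S21` and `R12` are dictated by the first matrix; the right-hand sides
    -- chosen above absorb what they contribute to the second.
    refine ⟨Matrix.fromBlocks (R11 + P.toBlocks₁₁) S12 (A * R21 + P.toBlocks₂₁) S22,
      Matrix.fromBlocks R11 (S12 * A - P.toBlocks₁₂) R21 R22, ?_, ?_⟩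
    · rw [hmulA]
      rintro (i | i) (j | j) h
      · simp [Matrix.toBlocks₁₁]
      · simp [Matrix.toBlocks₁₂]
      · simp [Matrix.toBlocks₂₁]
      · exact a22 i j h
    · rw [hmulB]
      rintro (i | i) (j | j) h
      · rw [Matrix.fromBlocks_apply₁₁, Matrix.mul_add, ← sub_sub]
        have e := congrFun (congrFun e11 i) j
        rw [Matrix.add_apply, Matrix.add_apply, hF i j h, add_zero] at e
        rw [Matrix.sub_apply, ← e, add_sub_cancel_right]
        rfl
      · rw [Matrix.fromBlocks_apply₁₂, Matrix.sub_mul, Matrix.mul_assoc, sub_right_comm, e12,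
          add_sub_cancel_right]
        rfl
      · rw [Matrix.fromBlocks_apply₂₁, Matrix.mul_add, ← sub_sub, ← Matrix.mul_assoc, e21,
          add_sub_cancel_right]
        rfl
      · exact b22 i j h
  · rw [← Matrix.fromBlocks_toBlocks S, ← Matrix.fromBlocks_toBlocks R, hmulA] at hS
    rw [← Matrix.fromBlocks_toBlocks S, ← Matrix.fromBlocks_toBlocks R, hmulB] at hR
    have a11 : S.toBlocks₁₁ - R.toBlocks₁₁ = 0 := by
      ext i j
      exact hS (.inl i) (.inl j) id
    have a12 : S.toBlocks₁₂ * A - R.toBlocks₁₂ = 0 := by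
      ext i j
      exact hS (.inl i) (.inr j) id
    have a21 : S.toBlocks₂₁ - A * R.toBlocks₂₁ = 0 := by
      ext i j
      exact hS (.inr i) (.inl j) id
    have b12 : R.toBlocks₁₂ * B - C * S.toBlocks₁₂ = 0 := by
      ext i j
      exact hR (.inl i) (.inr j) id
    have b21 : R.toBlocks₂₁ * C - B * S.toBlocks₂₁ = 0 := by
      ext i j
      exact hR (.inr i) (.inl j) id
    have b11 : R.toBlocks₁₁ * C - C * S.toBlocks₁₁ = 0 := by
      rw [sub_eq_zero.1 a11]
      refine c2 _ fun i j h => ?_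
      have := hR (.inl i) (.inl j) h
      rwa [Matrix.fromBlocks_apply₁₁, sub_eq_zero.1 a11] at this
    obtain ⟨a22, b22⟩ := h2 S.toBlocks₂₂ R.toBlocks₂₂ (fun i j h => hS (.inr i) (.inr j) h)
      (fun i j h => hR (.inr i) (.inr j) h)
    constructor
    · rw [← Matrix.fromBlocks_toBlocks S, ← Matrix.fromBlocks_toBlocks R, hmulA, a11, a12, a21, a22,
        Matrix.fromBlocks_zero]
    · rw [← Matrix.fromBlocks_toBlocks S, ← Matrix.fromBlocks_toBlocks R, hmulB, b11, b12, b21, b22,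
        Matrix.fromBlocks_zero]

theorem isCoordinateFamily_directSumIC {C : Matrix N N 𝕜} {C' : (κ → 𝕜) → Matrix N N 𝕜}
    {posC : κ → Place loopQuiver fun _ => N}
    (h : IsCoordinateFamily (loopRep C) posC fun x => loopRep (C' x)) (A : Matrix m n 𝕜)
    (B : Matrix n m 𝕜) (PA : m → n → Prop) (PB : n → m → Prop) :
    IsCoordinateFamily (directSumIC C A B) (directSumPlace posC PA PB)
      fun x : κ ⊕ Stars PA ⊕ Stars PB → 𝕜 =>
        directSumIC (C' fun c => x (.inl c)) (A + starMatrix PA fun e => x (.inr (.inl e)))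
          (B + starMatrix PB fun e => x (.inr (.inr e))) := by
  intro x
  obtain ⟨hx1, hx2⟩ := h fun c => x (.inl c)
  constructor
  · rintro (c | e | e)
    · exact hx1 c
    · exact congrArg (A e.1.1 e.1.2 + ·) (starMatrix_apply_star (fun e => x (.inr (.inl e))) e)
    · exact congrArg (B e.1.1 e.1.2 + ·) (starMatrix_apply_star (fun e => x (.inr (.inr e))) e)
  · rintro ⟨α, i, j⟩ hp
    cases α
    · rcases i with i | i <;> rcases j with j | j
      · rfl
      · rfl
      · rfl
      · exact (congrArg (A i j + ·) (starMatrix_apply_of_not (P := PA) _ fun h' => hp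
          ((mem_range_directSumPlace_false _ _).2 h'))).trans (add_zero _)
    · rcases i with i | i <;> rcases j with j | j
      · exact hx2 ⟨(), i, j⟩ fun h' => hp ((mem_range_directSumPlace_true _ _).2 h')
      · rfl
      · rfl
      · exact (congrArg (B i j + ·) (starMatrix_apply_of_not (P := PB) _ fun h' => hp
          ((mem_range_directSumPlace_true _ _).2 h'))).trans (add_zero _)

end Contragredient

/-! ### Nilpotency of the product of the two nilpotent-part matrices. -/

section NilpotentProduct

variable {𝕜 : Type} [RCLike 𝕜] {t1 t2 t3 t4 : ℕ}
  (r1 : Fin t1 → ℕ) (r2 : Fin t2 → ℕ) (r3 : Fin t3 → ℕ) (r4 : Fin t4 → ℕ)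

/-- The product advances two places in a chain, that is, one row index within the same cell. -/
theorem isNilpotent_nilA_mul_nilB :
    IsNilpotent (nilA r1 r2 r3 r4 𝕜 * nilB r1 r2 r3 r4 𝕜) := by
  let h : VIdx r1 r2 r3 r4 → ℕ := fun a => a.2.val
  obtain ⟨b, hb⟩ := (Set.finite_range h).bddAbove
  refine ⟨b + 1, pow_eq_zero_of_height (h := h) ?_ fun j =>
    Nat.lt_succ_of_le (hb ⟨j, rfl⟩)⟩
  rintro ⟨k, i⟩ ⟨l, j⟩ hij
  rw [Matrix.mul_apply] at hij
  obtain ⟨⟨k', i'⟩, -, hne⟩ := Finset.exists_ne_zero_of_sum_ne_zero hij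
  have e1 := left_ne_zero_of_mul hne
  have e2 := right_ne_zero_of_mul hne
  rw [nilA_apply] at e1
  rw [nilB_apply] at e2
  obtain ⟨⟨rfl, h1⟩, -⟩ := ite_ne_right_iff.1 e1
  obtain ⟨⟨rfl, h2⟩, -⟩ := ite_ne_right_iff.1 e2
  change i.val < j.val
  omega

end NilpotentProduct

theorem theorem5p1
    {𝕜 : Type} [RCLike 𝕜]
    -- the matrix `C`: eigenvalues `z i` and, for each of them, the sizes of the cells
    {g : ℕ} (z : Fin g → ℂ) (hz : Function.Injective z)
    (T : Fin g → ℕ) (s : ∀ i, Fin (T i) → ℕ)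
    (hs : ∀ i, Antitone (s i)) (hs0 : ∀ i j, 0 < s i j)
    -- over `ℝ`: `z i = a + b i` with `b ≥ 0`, and cells with `b > 0` have even size
    (hreal : (RCLike.I : 𝕜) = 0 → ∀ i, 0 ≤ (z i).im ∧ (0 < (z i).im → ∀ j, Even (s i j)))
    (hC : IsUnit (canonicalC 𝕜 z T s).det)
    -- the sizes of the other cells
    {t1 t2 t3 t4 : ℕ}
    (r1 : Fin t1 → ℕ) (r2 : Fin t2 → ℕ) (r3 : Fin t3 → ℕ) (r4 : Fin t4 → ℕ)
    (h1 : Antitone r1) (h2 : Antitone r2) (h3 : Antitone r3) (h4 : Antitone r4)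
    (p1 : ∀ j, 0 < r1 j) (p2 : ∀ j, 0 < r2 j) (p3 : ∀ j, 0 < r3 j) (p4 : ∀ j, 0 < r4 j) :
    -- whatever simplest miniversal deformation `C'` of `C` under similarity is taken
    (∀ (κ : Type) [Fintype κ] (C' : (κ → 𝕜) → Matrix (CIdx T s) (CIdx T s) 𝕜),
      IsSimplestMiniversal (loopRep (canonicalC 𝕜 z T s)) (fun x => loopRep (C' x)) →
      IsSimplestMiniversal
        (directSumIC (canonicalC 𝕜 z T s) (nilA r1 r2 r3 r4 𝕜) (nilB r1 r2 r3 r4 𝕜))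
        (fun x : κ ⊕ Stars (starsA r1 r2 r3 r4) ⊕ Stars (starsB r1 r2 r3 r4) → 𝕜 =>
          directSumIC (C' fun c => x (.inl c))
            (nilA r1 r2 r3 r4 𝕜 + starMatrix (starsA r1 r2 r3 r4) fun e => x (.inr (.inl e)))
            (nilB r1 r2 r3 r4 𝕜 + starMatrix (starsB r1 r2 r3 r4) fun e => x (.inr (.inr e))))) ∧
    -- and `⊕ᵢ (Φ(zᵢ) + ℋᵢ)` is such a `C'`
    IsSimplestMiniversal (loopRep (canonicalC 𝕜 z T s))
      (fun x : Stars (starsC T s) → 𝕜 =>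
        loopRep (canonicalC 𝕜 z T s + starMatrix (starsC T s) x)) := by
  have hcompl := isComplement_canonicalC (𝕜 := 𝕜) (s := s) hz hs0 hreal
  refine ⟨fun κ _ C' hC' => ?_,
    (isCoordinateFamily_loop _ _).isSimplestMiniversal (loopStarPlace_injective _) hcompl⟩
  -- The explicit complement fixes the codimension, which forces the parameter places of the
  -- arbitrary `C'` to form a complement as well; only this is used about `C'`.
  obtain ⟨posC, hpos, hco, hc⟩ := hC'.exists_isComplement (loopStarPlace_injective _) hcompl
  exact (isCoordinateFamily_directSumIC hco (nilA r1 r2 r3 r4 𝕜) (nilB r1 r2 r3 r4 𝕜)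
    (starsA r1 r2 r3 r4) (starsB r1 r2 r3 r4)).isSimplestMiniversal
      (directSumPlace_injective hpos _ _)
      (isComplement_directSumIC hc hC (isNilpotent_nilA_mul_nilB r1 r2 r3 r4)
        exists_nilpotent_complement (nilpotent_complement_eq_zero h3 h4))
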